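/- **Problems.** For $1\le k\le d$ let $$\mathcal V_{d,k}=\Big\{v\in\mathbb S^{d-1}: k-\tfrac{k}{\log k}\le\|v\|_0\le k,\ |v_i|\ge \tfrac1{\sqrt k}\text{ for all } i\in\mathrm{supp}(v)\Big\}.$$ The symmetric rank-1 submatrix detection problem $\textsc{SROS}_D(n,k,\mu)$ is to test $H_0: M\sim N(0,1)^{\otimes n\times n}$ against $H_1: M\sim \mu\, vv^\top+N(0,1)^{\otimes n\times n}$ for some $v\in\mathcal V_{n,k}$. The sparse spiked Wigner problem $\textsc{SSW}_D(n,k,\mu)$ is the same with the noise $N(0,1)^{\otimes n\times n}$ replaced, under both hypotheses, by $\mathrm{GOE}(n)$ (a symmetric matrix with independent entries on and below the diagonal, $N(0,1)$ below and $N(0,2)$ on the diagonal). The Type I$+$II error of a randomized test $\phi$ with values in $\{0,1\}$ is $\mathbb P_{H_0}[\phi=1]+\sup_{P\in H_1}\mathbb P_{P}[\phi=0]$. **Computational model.** A sequence of randomized polynomial-time algorithms, the $n$-th acting on $d_n\times d_n$ matrices (or on graphs on $d_n$ vertices, given by their adjacency matrices), is a sequence of programs $A_n$, one for each $n$, whose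 length and worst-case number of steps are at most polynomial in $d_n$. Programs act on real registers by assignments, branching on the sign of a register, and bounded loops; real constants, exact arithmetic, $\exp$, $\log$, $\sqrt{\cdot}$, comparison of two numbers, and sampling a fair coin, an $N(0,1)$ variable or a Poisson variable cost one step each. **PC conjecture with density $p$.** For every sequence of randomized polynomial-time algorithms $A_n$ from graphs on $[n]$ to $\{0,1\}$ and every sequence of positive integers $k_n$ with $\limsup_{n\to\infty}\log_n k_n<\frac12$, $$\liminf_{n\to\infty}\Big(\mathbb P_{G\sim G(n,p)}[A_n(G)=1]+\mathbb P_{G\sim G(n,k_n,p)}[A_n(G)=0]\Big)\ge 1,$$ where $G(n,k,p)$ is $G(n,p)$ with a clique planted on a uniformly random set of $k$ vertices. **Regime.** For real $\alpha$ and $\beta$, a sequence $(N_n,K_n,\mu_n)$ with integers $1\le K_n\le N_n$, $N_n\to\infty$ and $\mu_n>0$ is in the regime $(\alpha,\beta)$, that is, $\mu/K=\tilde\Theta(N^{-\alpha})$ and $K=\tilde\Theta(N^\beta)$, if $$\lim_{n\to\infty}\frac{\log(K_n\mu_n^{-1})}{\log N_n}=\alpha\quad\text{and}\quad\lim_{n\to\infty}\frac{\log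 K_n}{\log N_n}=\beta .$$ **Theorem.** Let $\beta\in(0,1)$ and $\alpha\in\mathbb R$. 1. (Hardness.) If $\alpha>0$ and $\beta<\frac12+\alpha$, then there is a sequence $(N_n,K_n,\mu_n)$ in the regime $(\alpha,\beta)$ such that, if the PC conjecture holds with density $p=1/2$, then for every sequence of randomized polynomial-time tests $\phi_n:\mathbb R^{N_n\times N_n}\to\{0,1\}$ the Type I$+$II errors of $\phi_n$ on $\textsc{SROS}_D(N_n,K_n,\mu_n)$ and on $\textsc{SSW}_D(N_n,K_n,\mu_n/\sqrt2)$ both have $\liminf_{n\to\infty}$ at least $1$ (hence so do their asymptotic values $\limsup_{n\to\infty}$). 2. (The boundary is tight.) If $\alpha>0$ and $\beta>\frac12+\alpha$, or if $\beta<\frac12$ and $\alpha<0$, then for every sequence $(N_n,K_n,\mu_n)$ in the regime $(\alpha,\beta)$ there are sequences of randomized polynomial-time tests whose Type I$+$II errors on $\textsc{SROS}_D(N_n,K_n,\mu_n)$, respectively on $\textsc{SSW}_D(N_n,K_n,\mu_n)$, tend to $0$. Thus the computational boundary of both problems in this regime is $\beta^*=\frac12+\alpha$ (for $\alpha>0$),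 and $\alpha^*=0$ when $\beta<\frac12$. -/

import Mathlib

open MeasureTheory ProbabilityTheory Filter Topology
open scoped ENNReal

/-! ### Randomized programs with exact real arithmetic and a step count -/

namespace RealProgram

/-- The memory of a program: one real number in each register `0, 1, 2, …`. -/
abbrev Mem : Type := ℕ → ℝ

/-- Unit-cost operations. The arguments `a`, `b` are register numbers. Besides exact arithmetic and
elementary functions there are three sources of fresh randomness: a fair coin, a standard normal
variable, and a Poisson variable whose rate is held in a register. There is deliberately no
rounding operation and no indirect addressing: exact arithmetic together with rounding would give
unreasonable (`PSPACE`) power at unit cost. -/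
inductive Op : Type
  /-- a real constant -/
  | const (c : ℝ)
  | copy (a : ℕ)
  | add (a b : ℕ)
  | sub (a b : ℕ)
  | mul (a b : ℕ)
  | div (a b : ℕ)
  | exp (a : ℕ)
  | log (a : ℕ)
  | sqrt (a : ℕ)
  /-- `1` if register `a` is smaller than register `b`, and `0` otherwise -/
  | lt (a b : ℕ)
  | coin
  | gauss
  | poisson (a : ℕ)

/-- The Poisson law on `ℝ`, as a Markov kernel in its rate (a negative rate is read as `0`). -/
noncomputable def poissonKernel : Kernel ℝ ℝ where
  toFun x := (poissonMeasure x.toNNReal).map (fun k : ℕ => (k : ℝ))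
  measurable' := by
    refine Measure.measurable_of_measurable_coe _ fun s hs => ?_
    have h : ∀ x : ℝ, ((poissonMeasure x.toNNReal).map (fun k : ℕ => (k : ℝ))) s =
        ∑' k : ℕ, ENNReal.ofReal (Real.exp (-(x.toNNReal : ℝ)) * (x.toNNReal : ℝ) ^ k /
          (k.factorial : ℝ)) * Measure.dirac k ((fun k : ℕ => (k : ℝ)) ⁻¹' s) := by
      intro x
      rw [Measure.map_apply Measurable.of_discrete hs, poissonMeasure,
        Measure.sum_apply _ (MeasurableSet.of_discrete)]
      rfl
    simp_rw [h]
    refine Measurable.tsum fun k => Measurable.mul_const ?_ _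
    fun_prop

/-- The law of the value of an operation, given the current memory. -/
noncomputable def Op.value : Op → Kernel Mem ℝ
  | .const c => Kernel.const _ (Measure.dirac c)
  | .copy a => Kernel.deterministic (fun m => m a) (by fun_prop)
  | .add a b => Kernel.deterministic (fun m => m a + m b) (by fun_prop)
  | .sub a b => Kernel.deterministic (fun m => m a - m b) (by fun_prop)
  | .mul a b => Kernel.deterministic (fun m => m a * m b) (by fun_prop)
  | .div a b => Kernel.deterministic (fun m => m a / m b) (by fun_prop)
  | .exp a => Kernel.deterministic (fun m => Real.exp (m a)) (by fun_prop)
  | .log a => Kernel.deterministic (fun m => Real.log (m a)) (by fun_prop)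
  | .sqrt a => Kernel.deterministic (fun m => Real.sqrt (m a)) (by fun_prop)
  | .lt a b => Kernel.deterministic (fun m => if m a < m b then 1 else 0)
      (Measurable.ite (measurableSet_lt (measurable_pi_apply a) (measurable_pi_apply b))
        measurable_const measurable_const)
  | .coin => Kernel.const _ ((2⁻¹ : ℝ≥0∞) • Measure.dirac 0 + (2⁻¹ : ℝ≥0∞) • Measure.dirac 1)
  | .gauss => Kernel.const _ (gaussianReal 0 1)
  | .poisson a => poissonKernel.comap (fun m : Mem => m a) (measurable_pi_apply a)

/-- Programs. `assign d o` writes the value of `o` to register `d`; `ite r p q` runs `p` if register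
`r` holds a positive number and `q` otherwise; `loop k p` runs `p` exactly `k` times. -/
inductive Prog : Type
  | skip
  | assign (d : ℕ) (o : Op)
  | seq (p q : Prog)
  | ite (r : ℕ) (p q : Prog)
  | loop (k : ℕ) (p : Prog)

/-- The length of the text of a program. -/
def Prog.size : Prog → ℕ
  | .skip => 1
  | .assign _ _ => 1
  | .seq p q => p.size + q.size
  | .ite _ p q => 1 + p.size + q.size
  | .loop _ p => 1 + p.size

/-- The worst-case number of steps of a program. -/
def Prog.steps : Prog → ℕ
  | .skip => 1
  | .assign _ _ => 1
  | .seq p q => p.steps + q.steps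
  | .ite _ p q => 1 + max p.steps q.steps
  | .loop k p => 1 + k * (1 + p.steps)

open Classical in
/-- The semantics of a program: the law of the final memory, given the initial memory. Every
execution of a random operation uses fresh independent randomness. -/
noncomputable def Prog.run : Prog → Kernel Mem Mem
  | .skip => Kernel.id
  | .assign d o => (Kernel.id ×ₖ o.value).map (fun x : Mem × ℝ => Function.update x.1 d x.2)
  | .seq p q => q.run ∘ₖ p.run
  | .ite r p q => Kernel.piecewise
      (s := {m : Mem | 0 < m r}) (measurableSet_lt measurable_const (measurable_pi_apply r))
      p.run q.run
  | .loop k p => (fun κ : Kernel Mem Mem => p.run ∘ₖ κ)^[k] Kernel.id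

/-- The probability that a program started in memory `m` outputs `1`, that is, ends with a positive
number in register `0`. -/
noncomputable def Prog.prOne (p : Prog) (m : Mem) : ℝ≥0∞ := p.run m {m' | 0 < m' 0}

/-- The probability that a program started in memory `m` outputs `0`, that is, does not output
`1`. -/
noncomputable def Prog.prZero (p : Prog) (m : Mem) : ℝ≥0∞ := p.run m {m' | ¬ 0 < m' 0}

/-- A sequence of programs, the `n`-th of which takes an input of dimension `d n` (a `d n × d n`
matrix), runs in polynomial time: length and number of steps are polynomial in `d n`. -/
def PolyTime (d : ℕ → ℕ) (A : ℕ → Prog) : Prop :=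
  ∃ C : ℕ, ∀ n, (A n).size ≤ C * (d n + 1) ^ C ∧ (A n).steps ≤ C * (d n + 1) ^ C

/-- The initial memory for a matrix input: the entries row by row in the registers
`0, …, n * n - 1`, and `0` elsewhere. -/
noncomputable def encodeMatrix (n : ℕ) (M : Fin n → Fin n → ℝ) : Mem :=
  fun r => if h : r < n * n then M (Fin.divNat ⟨r, h⟩) (Fin.modNat ⟨r, h⟩) else 0

open Classical in
/-- The initial memory for a graph input: its adjacency matrix. -/
noncomputable def encodeGraph (n : ℕ) (G : SimpleGraph (Fin n)) : Mem :=
  encodeMatrix n fun i j => if G.Adj i j then 1 else 0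

end RealProgram

/-! ### Planted clique -/

namespace PlantedClique

open RealProgram

/-- The clique on the vertex set `S`, without further edges. -/
def cliqueOn {n : ℕ} (S : Finset (Fin n)) : SimpleGraph (Fin n) :=
  SimpleGraph.fromRel fun i j => i ∈ S ∧ j ∈ S

/-- `G(n, k, p)`: a sample of `G(n, p)` to which a clique on a uniformly random set of `k` vertices
is added. -/
noncomputable def plantedLaw (n k : ℕ) (p : unitInterval) : Measure (SimpleGraph (Fin n)) :=
  ((n.choose k : ℝ≥0∞))⁻¹ • ∑ S ∈ (Finset.univ : Finset (Fin n)).powersetCard k,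
    (SimpleGraph.binomialRandom (Fin n) p).map (fun G => G ⊔ cliqueOn S)

/-- The Type I+II error of the test `A` on planted clique detection. -/
noncomputable def error (n k : ℕ) (p : unitInterval) (A : Prog) : ℝ≥0∞ :=
  (∫⁻ G, A.prOne (encodeGraph n G) ∂(SimpleGraph.binomialRandom (Fin n) p)) +
    ∫⁻ G, A.prZero (encodeGraph n G) ∂(plantedLaw n k p)

/-- The planted clique conjecture with edge density `p`. The upper limit is taken in the extended
reals. -/
def Conjecture (p : unitInterval) : Prop :=
  ∀ A : ℕ → Prog, PolyTime (fun n => n) A →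
    ∀ k : ℕ → ℕ, (∀ n, 0 < k n) →
      limsup (fun n : ℕ => ((Real.logb n (k n) : ℝ) : EReal)) atTop < ((1 / 2 : ℝ) : EReal) →
      1 ≤ liminf (fun n => error n (k n) p (A n)) atTop

end PlantedClique

/-! ### Rank-1 submatrix with a symmetric spike, and sparse spiked Wigner matrices -/

namespace SparseSpike

open RealProgram

open Classical in
/-- The set `𝒱_{d,k}` of near-uniform sparse unit vectors. -/
def spikes (d k : ℕ) : Set (Fin d → ℝ) :=
  {v | ∑ i, v i ^ 2 = 1 ∧
    (k : ℝ) - k / Real.log k ≤ ((Finset.univ.filter fun i => v i ≠ 0).card : ℝ) ∧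
    (Finset.univ.filter fun i => v i ≠ 0).card ≤ k ∧
    ∀ i, v i ≠ 0 → 1 / Real.sqrt k ≤ |v i|}

/-- The law `N(0,1)^{⊗ n × n}` of a matrix with i.i.d. standard normal entries. -/
noncomputable def gaussianMatrix (n : ℕ) : Measure (Fin n → Fin n → ℝ) :=
  Measure.pi fun _ => Measure.pi fun _ => gaussianReal 0 1

/-- The law `GOE(n)` of a symmetric matrix whose entries below the diagonal are i.i.d. `N(0,1)` and
whose diagonal entries are i.i.d. `N(0,2)`, all independent. -/
noncomputable def goe (n : ℕ) : Measure (Fin n → Fin n → ℝ) :=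
  (gaussianMatrix n).map fun Z i j =>
    if i = j then Real.sqrt 2 * Z i i else if j < i then Z i j else Z j i

/-- The law of `μ v vᵀ + Z` for a noise matrix `Z` with the given law. -/
noncomputable def spiked {n : ℕ} (noise : Measure (Fin n → Fin n → ℝ)) (μ : ℝ) (v : Fin n → ℝ) :
    Measure (Fin n → Fin n → ℝ) :=
  noise.map fun Z i j => μ * (v i * v j) + Z i j

/-- The Type I+II error of the test `φ` for detecting a spike `μ v vᵀ`, `v ∈ 𝒱_{n,k}`, in the given
noise: the worst case over all spikes is taken in the Type II error. -/
noncomputable def error {n : ℕ} (noise : Measure (Fin n → Fin n → ℝ)) (k : ℕ) (μ : ℝ)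
    (φ : Prog) : ℝ≥0∞ :=
  (∫⁻ M, φ.prOne (encodeMatrix n M) ∂noise) +
    ⨆ v ∈ spikes n k, ∫⁻ M, φ.prZero (encodeMatrix n M) ∂(spiked noise μ v)

/-- The Type I+II error of `φ` on `SROS_D(n, k, μ)`. -/
noncomputable def srosError (n k : ℕ) (μ : ℝ) (φ : Prog) : ℝ≥0∞ := error (gaussianMatrix n) k μ φ

/-- The Type I+II error of `φ` on `SSW_D(n, k, μ)`. -/
noncomputable def sswError (n k : ℕ) (μ : ℝ) (φ : Prog) : ℝ≥0∞ := error (goe n) k μ φ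

/-- The parameter regime `μ / K = Θ̃(N ^ (-α))` and `K = Θ̃(N ^ β)`. -/
structure InRegime (α β : ℝ) (N K : ℕ → ℕ) (μ : ℕ → ℝ) : Prop where
  dim_tendsto : Tendsto N atTop atTop
  sparsity_pos : ∀ n, 1 ≤ K n
  sparsity_le : ∀ n, K n ≤ N n
  signal_pos : ∀ n, 0 < μ n
  signal_tendsto : Tendsto (fun n => Real.log (K n * (μ n)⁻¹) / Real.log (N n)) atTop (𝓝 α)
  sparsity_tendsto : Tendsto (fun n => Real.log (K n) / Real.log (N n)) atTop (𝓝 β)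

end SparseSpike

/-! ### Deterministic programs -/

namespace RealProgram

/-! Hardness is a reduction from planted clique. Seen through Gaussian noise, a clique on a set S of
k vertices is a mean shift l 1_S 1_Sᵀ = l k u uᵀ with u = 1_S / √k. Conjugation by an orthogonal W
preserves i.i.d. Gaussian noise and turns u into W u (`map_conj_assemble_planted`). If W is block
diagonal with Walsh–Hadamard blocks of size g and the points of S lie in distinct blocks, then W u
has exactly kg nonzero entries, all ±1/√(kg). A few collisions only cost a few entries, which the
definition of the spikes tolerates (`IsBlockHadamard.rotatedSpike_mem`), and a random S has few of
them when K log K = o(N) for K = kg (`badFraction_le`). With k = N^κ, g = N^γ, l = N^(-θ) this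
reaches β = κ + γ and α = γ + θ; if α > 0 and β < 1/2 + α, the exponents can be chosen positive with
κ < 1/2.

Bits become Gaussian pairs through two laws whose average is a standard pair, the one for the bit
`true` being dominated by c N(l,1)² with c^(k²) → 1 (`exists_truncation`). An edge {p, q} supplies
the entries (p,q) and (q,p). A graph has no diagonal bits, so it is placed on a random set B of
about half of the N indices, and membership in B serves as the fair diagonal bit. Averaged over B,
the null law is exactly Gaussian. Since S ⊆ B has probability 2^(-k), the planted law is dominated
by 1 + o(1) times a mixture of spiked laws, up to the bad sets S (`exists_tableMatrix`). Domination
from one side suffices, because the errors of the matrix test only have to be bounded below.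

Programs may contain arbitrary real constants and may vary with n. Hence the randomness of the
reduction can be frozen at values no worse than average: a set B and a table with one pair for each
site and bit. What is left is an affine map of the adjacency matrix, which a short program computes.
The sizes |B| form a strictly increasing sequence, and along it the conjecture applies
(`Conjecture.one_le_liminf`). The GOE case follows by passing to (Z + Zᵀ)/√2, which multiplies a
symmetric spike by √2.

On the easy side the diagonal suffices. The trace has mean shift μ and variance of order N, so it
detects when N/μ² → 0. On the support a diagonal entry is shifted by at least μ/K, which exceeds the
maximum of the noise when μ/K is a positive power of N. -/

instance (x : ℝ) : IsProbabilityMeasure (poissonKernel x) := by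
  change IsProbabilityMeasure ((poissonMeasure x.toNNReal).map (fun k : ℕ => (k : ℝ)))
  exact Measure.isProbabilityMeasure_map Measurable.of_discrete.aemeasurable

instance : IsMarkovKernel poissonKernel := ⟨fun _ => inferInstance⟩

instance Op.isMarkovKernel_value (o : Op) : IsMarkovKernel o.value := by
  cases o <;> simp only [Op.value] <;> try infer_instance
  refine ⟨fun m => ⟨?_⟩⟩
  simp [ENNReal.inv_two_add_inv_two]

theorem measurable_update_pair (d : ℕ) :
    Measurable (fun x : Mem × ℝ => Function.update x.1 d x.2) := by
  rw [measurable_pi_iff]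
  intro a
  by_cases h : a = d
  · subst h; simpa using measurable_snd
  · simp only [Function.update_of_ne h]
    exact (measurable_pi_apply a).comp measurable_fst

instance Prog.isMarkovKernel_run (p : Prog) : IsMarkovKernel p.run := by
  induction p with
  | skip => simp only [Prog.run]; infer_instance
  | assign d o =>
    simp only [Prog.run]
    exact Kernel.IsMarkovKernel.map _ (measurable_update_pair d)
  | seq p q hp hq => simp only [Prog.run]; infer_instance
  | ite r p q hp hq => simp only [Prog.run]; infer_instance
  | loop k p hp =>
    simp only [Prog.run]
    induction k with
    | zero => simp only [Function.iterate_zero, id]; infer_instance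
    | succ k ih => rw [Function.iterate_succ']; simp only [Function.comp]; infer_instance

theorem Prog.prZero_le_one (p : Prog) (m : Mem) : p.prZero m ≤ 1 := prob_le_one

theorem measurableSet_pos_zero : MeasurableSet {m : Mem | 0 < m 0} :=
  measurableSet_lt measurable_const (measurable_pi_apply 0)

theorem Prog.measurable_prOne (p : Prog) : Measurable p.prOne :=
  Kernel.measurable_coe _ measurableSet_pos_zero

theorem Prog.measurable_prZero (p : Prog) : Measurable p.prZero :=
  Kernel.measurable_coe _ measurableSet_pos_zero.compl

theorem measurable_encodeMatrix (n : ℕ) : Measurable (encodeMatrix n) := by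
  rw [measurable_pi_iff]
  intro r
  unfold encodeMatrix
  by_cases h : r < n * n
  · simp only [h, dite_true]
    fun_prop
  · simp [h]

theorem encodeMatrix_apply {n : ℕ} (M : Fin n → Fin n → ℝ) (i j : Fin n) :
    encodeMatrix n M (finProdFinEquiv (i, j) : Fin (n * n)) = M i j := by
  unfold encodeMatrix
  rw [dif_pos (finProdFinEquiv (i, j)).isLt]
  have h := finProdFinEquiv.symm_apply_apply (i, j)
  rw [finProdFinEquiv_symm_apply] at h
  simp only [Prod.mk.injEq] at h
  simp only [Fin.eta]
  rw [h.1, h.2]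

theorem encodeMatrix_of_le {n r : ℕ} (M : Fin n → Fin n → ℝ) (h : n * n ≤ r) :
    encodeMatrix n M r = 0 := by
  simp [encodeMatrix, not_lt.2 h]

/-- Started in memory `m`, the program `p` surely ends in memory `m'`. -/
def Prog.Maps (p : Prog) (m m' : Mem) : Prop := p.run m = Measure.dirac m'

theorem Prog.Maps.seq {p q : Prog} {m m' m'' : Mem} (hp : p.Maps m m') (hq : q.Maps m' m'') :
    (Prog.seq p q).Maps m m'' := by
  unfold Prog.Maps at *
  rw [Prog.run, Kernel.comp_apply, hp, Measure.dirac_bind (Kernel.measurable _), hq]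

theorem Prog.maps_skip (m : Mem) : Prog.skip.Maps m m := by
  simp [Prog.Maps, Prog.run, Kernel.id_apply]

theorem Prog.maps_assign {o : Op} {m : Mem} {x : ℝ} (h : o.value m = Measure.dirac x) (d : ℕ) :
    (Prog.assign d o).Maps m (Function.update m d x) := by
  unfold Prog.Maps
  rw [Prog.run, Kernel.map_apply _ (measurable_update_pair d), Kernel.prod_apply, h,
    Kernel.id_apply, Measure.dirac_prod_dirac, Measure.map_dirac' (measurable_update_pair d)]

theorem Prog.maps_const (m : Mem) (d : ℕ) (c : ℝ) :
    (Prog.assign d (.const c)).Maps m (Function.update m d c) :=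
  maps_assign (by simp [Op.value]) d

theorem Prog.maps_copy (m : Mem) (d a : ℕ) :
    (Prog.assign d (.copy a)).Maps m (Function.update m d (m a)) :=
  maps_assign (by simp [Op.value, Kernel.deterministic_apply]) d

theorem Prog.maps_add (m : Mem) (d a b : ℕ) :
    (Prog.assign d (.add a b)).Maps m (Function.update m d (m a + m b)) :=
  maps_assign (by simp [Op.value, Kernel.deterministic_apply]) d

theorem Prog.Maps.prOne_seq {p : Prog} {m m' : Mem} (h : p.Maps m m') (q : Prog) :
    (Prog.seq p q).prOne m = q.prOne m' := by
  unfold Prog.Maps at h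
  rw [Prog.prOne, Prog.run, Kernel.comp_apply, h, Measure.dirac_bind (Kernel.measurable _)]
  rfl

theorem Prog.Maps.prZero_seq {p : Prog} {m m' : Mem} (h : p.Maps m m') (q : Prog) :
    (Prog.seq p q).prZero m = q.prZero m' := by
  unfold Prog.Maps at h
  rw [Prog.prZero, Prog.run, Kernel.comp_apply, h, Measure.dirac_bind (Kernel.measurable _)]
  rfl

open Classical in
theorem Prog.Maps.prOne_eq {p : Prog} {m m' : Mem} (h : p.Maps m m') :
    p.prOne m = if 0 < m' 0 then 1 else 0 := by
  unfold Prog.Maps at h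
  rw [Prog.prOne, h, Measure.dirac_apply' _ measurableSet_pos_zero]
  simp [Set.indicator]

open Classical in
theorem Prog.Maps.prZero_eq {p : Prog} {m m' : Mem} (h : p.Maps m m') :
    p.prZero m = if 0 < m' 0 then 0 else 1 := by
  unfold Prog.Maps at h
  have hs : MeasurableSet {m : Mem | ¬ 0 < m 0} := measurableSet_pos_zero.compl
  rw [Prog.prZero, h, Measure.dirac_apply' _ hs]
  by_cases h0 : 0 < m' 0 <;> simp [Set.indicator, h0]

/-- Run the programs `f 0, …, f (n - 1)` one after another. -/
def Prog.forRange (n : ℕ) (f : ℕ → Prog) : Prog := n.rec .skip fun i p => .seq p (f i)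

theorem Prog.size_forRange_le {n c : ℕ} {f : ℕ → Prog} (h : ∀ i < n, (f i).size ≤ c) :
    (forRange n f).size ≤ 1 + n * c := by
  induction n with
  | zero => simp [forRange, Prog.size]
  | succ n ih =>
    have h1 := ih fun i hi => h i (by omega)
    have h2 := h n (by omega)
    change (forRange n f).size + (f n).size ≤ _
    rw [Nat.succ_mul]; omega

theorem Prog.steps_forRange_le {n c : ℕ} {f : ℕ → Prog} (h : ∀ i < n, (f i).steps ≤ c) :
    (forRange n f).steps ≤ 1 + n * c := by
  induction n with
  | zero => simp [forRange, Prog.steps]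
  | succ n ih =>
    have h1 := ih fun i hi => h i (by omega)
    have h2 := h n (by omega)
    change (forRange n f).steps + (f n).steps ≤ _
    rw [Nat.succ_mul]; omega

/-- A sequence of steps, each of which preserves an invariant, preserves it. -/
theorem Prog.exists_maps_forRange {n : ℕ} {f : ℕ → Prog} (I : ℕ → Mem → Prop)
    (h : ∀ i < n, ∀ m, I i m → ∃ m', (f i).Maps m m' ∧ I (i + 1) m') {m : Mem} (hm : I 0 m) :
    ∃ m', (forRange n f).Maps m m' ∧ I n m' := by
  induction n with
  | zero => exact ⟨m, maps_skip _, hm⟩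
  | succ n ih =>
    obtain ⟨m', h1, h2⟩ := ih fun i hi => h i (by omega)
    obtain ⟨m'', h3, h4⟩ := h n (by omega) m' h2
    exact ⟨m'', h1.seq h3, h4⟩

/-- Add to register `t` the sum of `w (c i) (m (ρ i))`, `i < n`, where the operation `bin` computes
`w`, and `tmp` is a scratch register. -/
def Prog.accumulate (bin : ℕ → ℕ → Op) (c : ℕ → ℝ) (ρ : ℕ → ℕ) (t tmp n : ℕ) : Prog :=
  forRange n fun i => .seq (.assign tmp (.const (c i)))
    (.seq (.assign tmp (bin tmp (ρ i))) (.assign t (.add t tmp)))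

theorem Prog.size_accumulate_le (bin : ℕ → ℕ → Op) (c : ℕ → ℝ) (ρ : ℕ → ℕ) (t tmp n : ℕ) :
    (accumulate bin c ρ t tmp n).size ≤ 1 + n * 3 :=
  size_forRange_le fun _ _ => by simp [Prog.size]

theorem Prog.steps_accumulate_le (bin : ℕ → ℕ → Op) (c : ℕ → ℝ) (ρ : ℕ → ℕ) (t tmp n : ℕ) :
    (accumulate bin c ρ t tmp n).steps ≤ 1 + n * 3 :=
  steps_forRange_le fun _ _ => by simp [Prog.steps]

theorem Prog.maps_accumulate {bin : ℕ → ℕ → Op} {w : ℝ → ℝ → ℝ}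
    (hbin : ∀ a b m, (bin a b).value m = Measure.dirac (w (m a) (m b)))
    (c : ℕ → ℝ) {ρ : ℕ → ℕ} {t tmp n : ℕ} (ht : ∀ i < n, ρ i ≠ t) (htmp : ∀ i < n, ρ i ≠ tmp)
    (hne : t ≠ tmp) (m : Mem) :
    ∃ m', (accumulate bin c ρ t tmp n).Maps m m' ∧
      m' t = m t + ∑ i ∈ Finset.range n, w (c i) (m (ρ i)) ∧
      ∀ r, r ≠ t → r ≠ tmp → m' r = m r := by
  refine exists_maps_forRange (fun i m' => m' t = m t + ∑ j ∈ Finset.range i, w (c j) (m (ρ j)) ∧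
    ∀ r, r ≠ t → r ≠ tmp → m' r = m r) ?_ ⟨by simp, fun _ _ _ => rfl⟩
  rintro i hi m' ⟨h1, h2⟩
  refine ⟨_, (maps_const _ _ _).seq ((maps_assign (hbin _ _ _) _).seq (maps_add _ _ _ _)), ?_, ?_⟩
  · simp [hne, htmp i hi, h1, h2 _ (ht i hi) (htmp i hi), Finset.sum_range_succ, add_assoc]
  · intro r hr1 hr2
    simp [hr1, hr2, h2 r hr1 hr2]

theorem Op.value_mul (a b : ℕ) (m : Mem) : (Op.mul a b).value m = Measure.dirac (m a * m b) := by
  simp [Op.value, Kernel.deterministic_apply]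

theorem Op.value_lt (a b : ℕ) (m : Mem) :
    (Op.lt a b).value m = Measure.dirac (if m a < m b then 1 else 0) := by
  simp only [Op.value, Kernel.deterministic_apply]

/-- Compute in register `0` the number `d + ∑ i < n, w (c i) (m (ρ i))`; the registers `L` and
`L + 1` are scratch registers. -/
def Prog.statistic (bin : ℕ → ℕ → Op) (c : ℕ → ℝ) (ρ : ℕ → ℕ) (d : ℝ) (n L : ℕ) : Prog :=
  .seq (.assign L (.const d)) (.seq (accumulate bin c ρ L (L + 1) n) (.assign 0 (.copy L)))

theorem Prog.size_statistic_le (bin : ℕ → ℕ → Op) (c : ℕ → ℝ) (ρ : ℕ → ℕ) (d : ℝ) (n L : ℕ) :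
    (statistic bin c ρ d n L).size ≤ 3 + n * 3 := by
  have := size_accumulate_le bin c ρ L (L + 1) n
  simp only [statistic, Prog.size]; omega

theorem Prog.steps_statistic_le (bin : ℕ → ℕ → Op) (c : ℕ → ℝ) (ρ : ℕ → ℕ) (d : ℝ) (n L : ℕ) :
    (statistic bin c ρ d n L).steps ≤ 3 + n * 3 := by
  have := steps_accumulate_le bin c ρ L (L + 1) n
  simp only [statistic, Prog.steps]; omega

theorem Prog.maps_statistic {bin : ℕ → ℕ → Op} {w : ℝ → ℝ → ℝ}
    (hbin : ∀ a b m, (bin a b).value m = Measure.dirac (w (m a) (m b)))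
    (c : ℕ → ℝ) {ρ : ℕ → ℕ} (d : ℝ) {n L : ℕ} (hρ : ∀ i < n, ρ i < L) (m : Mem) :
    ∃ m', (statistic bin c ρ d n L).Maps m m' ∧
      m' 0 = d + ∑ i ∈ Finset.range n, w (c i) (m (ρ i)) := by
  obtain ⟨m', h1, h2, h3⟩ := maps_accumulate hbin c (t := L) (tmp := L + 1) (ρ := ρ) (n := n)
    (fun i hi => (hρ i hi).ne) (fun i hi => by have := hρ i hi; omega)
    (by omega) (Function.update m L d)
  refine ⟨_, (maps_const m L d).seq (h1.seq (maps_copy _ _ _)), ?_⟩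
  simp only [Function.update_self, h2]
  congr 1
  refine Finset.sum_congr rfl fun i hi => ?_
  rw [Function.update_of_ne (hρ i (Finset.mem_range.1 hi)).ne]

/-- Replace the contents of the registers `0, …, L - 1` by `d r + ∑ i < n, c r i * m i`; all other
registers below `2 * L + 1` are erased. -/
def Prog.affine (c : ℕ → ℕ → ℝ) (d : ℕ → ℝ) (n L : ℕ) : Prog :=
  .seq (forRange L fun r => .seq (.assign (L + r) (.const (d r)))
      (accumulate .mul (c r) id (L + r) (2 * L) n))
    (.seq (forRange L fun r => .assign r (.copy (L + r)))
      (forRange (L + 1) fun r => .assign (L + r) (.const 0)))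

theorem Prog.size_affine_le (c : ℕ → ℕ → ℝ) (d : ℕ → ℝ) (n L : ℕ) :
    (affine c d n L).size ≤ 4 + L * (4 + n * 3) := by
  have h1 : (forRange L fun r => .seq (.assign (L + r) (.const (d r)))
      (accumulate .mul (c r) id (L + r) (2 * L) n)).size ≤ 1 + L * (2 + n * 3) :=
    size_forRange_le fun r _ => by
      have := size_accumulate_le .mul (c r) id (L + r) (2 * L) n
      simp only [Prog.size]; omega
  have h2 : (forRange L fun r => .assign r (.copy (L + r))).size ≤ 1 + L * 1 :=
    size_forRange_le fun r _ => by simp [Prog.size]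
  have h3 : (forRange (L + 1) fun r => .assign (L + r) (.const 0)).size ≤ 1 + (L + 1) * 1 :=
    size_forRange_le fun r _ => by simp [Prog.size]
  simp only [affine, Prog.size]
  nlinarith

theorem Prog.steps_affine_le (c : ℕ → ℕ → ℝ) (d : ℕ → ℝ) (n L : ℕ) :
    (affine c d n L).steps ≤ 4 + L * (4 + n * 3) := by
  have h1 : (forRange L fun r => .seq (.assign (L + r) (.const (d r)))
      (accumulate .mul (c r) id (L + r) (2 * L) n)).steps ≤ 1 + L * (2 + n * 3) :=
    steps_forRange_le fun r _ => by
      have := steps_accumulate_le .mul (c r) id (L + r) (2 * L) n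
      simp only [Prog.steps]; omega
  have h2 : (forRange L fun r => .assign r (.copy (L + r))).steps ≤ 1 + L * 1 :=
    steps_forRange_le fun r _ => by simp [Prog.steps]
  have h3 : (forRange (L + 1) fun r => .assign (L + r) (.const 0)).steps ≤ 1 + (L + 1) * 1 :=
    steps_forRange_le fun r _ => by simp [Prog.steps]
  simp only [affine, Prog.steps]
  nlinarith

/-- The final memory is determined in every register: a test run afterwards may read any register,
so it must find exactly an encoded matrix. The new values are first built in registers `L, …, 2 * L
- 1`, since every one of them needs the old input. -/
theorem Prog.maps_affine (c : ℕ → ℕ → ℝ) (d : ℕ → ℝ) {n L : ℕ} (hn : n ≤ L) {m : Mem}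
    (hm : ∀ r, L ≤ r → m r = 0) :
    (affine c d n L).Maps m
      (fun r => if r < L then d r + ∑ i ∈ Finset.range n, c r i * m i else 0) := by
  set F : ℕ → ℝ := fun r => d r + ∑ i ∈ Finset.range n, c r i * m i with hF
  obtain ⟨m₁, h1, h1a, h1b, h1c⟩ := exists_maps_forRange (n := L)
    (f := fun r => .seq (.assign (L + r) (.const (d r)))
      (accumulate .mul (c r) id (L + r) (2 * L) n))
    (fun i m' => (∀ r < L, m' r = m r) ∧ (∀ r < i, m' (L + r) = F r) ∧
      ∀ r, 2 * L < r → m' r = 0) (by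
      rintro i hi m' ⟨ha, hb, hc⟩
      obtain ⟨m'', k1, k2, k3⟩ := maps_accumulate (Op.value_mul) (c i) (t := L + i)
        (tmp := 2 * L) (ρ := id) (n := n) (fun j hj => by simp only [id]; omega)
        (fun j hj => by simp only [id]; omega) (by omega) (Function.update m' (L + i) (d i))
      refine ⟨_, (maps_const _ _ _).seq k1, ?_, ?_, ?_⟩
      · intro r hr
        rw [k3 r (by omega) (by omega), Function.update_of_ne (by omega), ha r hr]
      · intro r hr
        rcases Nat.lt_succ_iff_lt_or_eq.1 hr with hr | rfl
        · rw [k3 _ (by omega) (by omega), Function.update_of_ne (by omega), hb r hr]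
        · rw [k2, Function.update_self, hF]
          congr 1
          refine Finset.sum_congr rfl fun j hj => ?_
          have := Finset.mem_range.1 hj
          rw [id, Function.update_of_ne (by omega), ha j (by omega)]
      · intro r hr
        rw [k3 r (by omega) (by omega), Function.update_of_ne (by omega), hc r hr])
    (m := m) ⟨fun _ _ => rfl, fun r hr => absurd hr (by omega), fun r hr => hm r (by omega)⟩
  obtain ⟨m₂, h2, h2a, h2b, h2c⟩ := exists_maps_forRange (n := L)
    (f := fun r => .assign r (.copy (L + r)))
    (fun i m' => (∀ r < i, m' r = F r) ∧ (∀ r < L, m' (L + r) = F r) ∧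
      ∀ r, 2 * L < r → m' r = 0) (by
      rintro i hi m' ⟨ha, hb, hc⟩
      refine ⟨_, maps_copy _ _ _, ?_, ?_, ?_⟩
      · intro r hr
        rcases Nat.lt_succ_iff_lt_or_eq.1 hr with hr | rfl
        · rw [Function.update_of_ne (by omega), ha r hr]
        · rw [Function.update_self, hb r hi]
      · intro r hr
        rw [Function.update_of_ne (by omega), hb r hr]
      · intro r hr
        rw [Function.update_of_ne (by omega), hc r hr])
    (m := m₁) ⟨fun r hr => absurd hr (by omega), h1b, h1c⟩
  -- One more round than there are values, so that the scratch register `2 * L` is erased as well.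
  obtain ⟨m₃, h3, h3a, h3b, h3c⟩ := exists_maps_forRange (n := L + 1)
    (f := fun r => .assign (L + r) (.const 0))
    (fun i m' => (∀ r < L, m' r = F r) ∧ (∀ r < i, m' (L + r) = 0) ∧
      ∀ r, 2 * L < r → m' r = 0) (by
      rintro i hi m' ⟨ha, hb, hc⟩
      refine ⟨_, maps_const _ _ _, ?_, ?_, ?_⟩
      · intro r hr
        rw [Function.update_of_ne (by omega), ha r hr]
      · intro r hr
        rcases Nat.lt_succ_iff_lt_or_eq.1 hr with hr | rfl
        · rw [Function.update_of_ne (by omega), hb r hr]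
        · rw [Function.update_self]
      · intro r hr
        rw [Function.update_of_ne (by omega), hc r hr])
    (m := m₂) ⟨h2a, fun r hr => absurd hr (by omega), h2c⟩
  have : m₃ = fun r => if r < L then F r else 0 := by
    funext r
    split_ifs with hr
    · exact h3a r hr
    · by_cases h : r ≤ 2 * L
      · have := h3b (r - L) (by omega)
        rwa [show L + (r - L) = r by omega] at this
      · exact h3c r (by omega)
  rw [← this]
  exact h1.seq (h2.seq h3)

end RealProgram

/-! ### Product measures -/

namespace MeasureTheory.Measure

theorem pi_map_comp_injective {I J : Type*} [Fintype I] [Fintype J] {β : I → Type*}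
    [∀ i, MeasurableSpace (β i)] (μ : ∀ i, Measure (β i)) [∀ i, IsProbabilityMeasure (μ i)]
    {g : J → I} (hg : Function.Injective g) :
    (Measure.pi μ).map (fun ω j => ω (g j)) = Measure.pi fun j => μ (g j) := by
  have h := (iIndepFun_pi (μ := μ) (X := fun i (x : β i) => x) fun _ => aemeasurable_id).precomp hg
  rw [iIndepFun_iff_map_fun_eq_pi_map fun j => (measurable_pi_apply _).aemeasurable] at h
  rw [h]
  congr 1
  funext j
  exact (measurePreserving_eval μ (g j)).map_eq

theorem pi_smul_eq {I : Type*} [Fintype I] {β : I → Type*} [∀ i, MeasurableSpace (β i)]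
    (c : I → ℝ≥0∞) (μ : ∀ i, Measure (β i)) [∀ i, IsFiniteMeasure (μ i)]
    [∀ i, IsFiniteMeasure (c i • μ i)] :
    Measure.pi (fun i => c i • μ i) = (∏ i, c i) • Measure.pi μ := by
  refine Measure.pi_eq fun s _ => ?_
  simp [Measure.pi_pi, Finset.prod_mul_distrib]

/-- `OuterMeasure.pi` is the largest outer measure bounded on boxes by the products, so comparing
boxes is enough. -/
theorem pi_le_pi {I : Type*} [Fintype I] {β : I → Type*} [∀ i, MeasurableSpace (β i)]
    {μ ν : ∀ i, Measure (β i)} [∀ i, SigmaFinite (μ i)] (h : ∀ i, μ i ≤ ν i) :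
    Measure.pi μ ≤ Measure.pi ν := by
  have h1 : (Measure.pi μ).toOuterMeasure ≤ OuterMeasure.pi fun i => (ν i).toOuterMeasure := by
    rw [OuterMeasure.le_pi]
    intro s _
    change Measure.pi μ (Set.univ.pi s) ≤ _
    rw [Measure.pi_pi]
    exact Finset.prod_le_prod' fun i _ => h i (s i)
  rw [Measure.le_iff]
  intro s hs
  rw [Measure.pi_def (μ := ν), toMeasure_apply _ _ hs]
  exact h1 s

theorem lintegral_pi_prod {I : Type*} [Fintype I] {β : I → Type*} [∀ i, MeasurableSpace (β i)]
    (μ : ∀ i, Measure (β i)) [∀ i, IsProbabilityMeasure (μ i)] {f : ∀ i, β i → ℝ≥0∞}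
    (hf : ∀ i, Measurable (f i)) :
    ∫⁻ ω, ∏ i, f i (ω i) ∂(Measure.pi μ) = ∏ i, ∫⁻ x, f i x ∂(μ i) := by
  refine (lintegral_prod_eq_prod_lintegral_of_indepFun Finset.univ
    (fun i (ω : ∀ i, β i) => f i (ω i)) (iIndepFun_pi fun i => (hf i).aemeasurable)
    fun i => (hf i).comp (measurable_pi_apply i)).trans ?_
  refine Finset.prod_congr rfl fun i _ => ?_
  exact (measurePreserving_eval μ i).lintegral_comp (hf i)

end MeasureTheory.Measure

/-- The law of a fair coin. -/
noncomputable def fairCoin : Measure Bool :=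
  (2⁻¹ : ℝ≥0∞) • Measure.dirac false + (2⁻¹ : ℝ≥0∞) • Measure.dirac true

instance : IsProbabilityMeasure fairCoin :=
  ⟨by simp [fairCoin, ENNReal.inv_two_add_inv_two]⟩

theorem lintegral_fairCoin (f : Bool → ℝ≥0∞) :
    ∫⁻ b, f b ∂fairCoin = 2⁻¹ * f false + 2⁻¹ * f true := by
  simp [fairCoin, lintegral_add_measure, lintegral_smul_measure]

/-- Independent fair coins. -/
noncomputable abbrev fairCoins (I : Type*) [Fintype I] : Measure (I → Bool) :=
  Measure.pi fun _ => fairCoin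

/-- A product measure with factors chosen by fair coins is on average the product of the averaged
factors. -/
theorem lintegral_fairCoins_pi {I : Type*} [Fintype I] {β : I → Type*}
    [∀ i, MeasurableSpace (β i)] (κ : ∀ i, Bool → Measure (β i)) [∀ i b, IsFiniteMeasure (κ i b)]
    {F : (∀ i, β i) → ℝ≥0∞} (hF : Measurable F) :
    ∫⁻ ξ, (∫⁻ y, F y ∂(Measure.pi fun i => κ i (ξ i))) ∂(fairCoins I) =
      ∫⁻ y, F y ∂(Measure.pi fun i =>
        (2⁻¹ : ℝ≥0∞) • κ i false + (2⁻¹ : ℝ≥0∞) • κ i true) := by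
  have : ∀ i, IsFiniteMeasure ((2⁻¹ : ℝ≥0∞) • κ i false + (2⁻¹ : ℝ≥0∞) • κ i true) := fun i => by
    have h1 : IsFiniteMeasure ((2⁻¹ : ℝ≥0∞) • κ i false) := Measure.smul_finite _ (by simp)
    have h2 : IsFiniteMeasure ((2⁻¹ : ℝ≥0∞) • κ i true) := Measure.smul_finite _ (by simp)
    infer_instance
  have hm : Measurable fun ξ : I → Bool => Measure.pi fun i => κ i (ξ i) := Measurable.of_discrete
  have : Measure.pi (fun i => (2⁻¹ : ℝ≥0∞) • κ i false + (2⁻¹ : ℝ≥0∞) • κ i true) =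
      (fairCoins I).bind fun ξ => Measure.pi fun i => κ i (ξ i) := by
    refine Measure.pi_eq fun s hs => ?_
    rw [Measure.bind_apply (MeasurableSet.univ_pi hs) hm.aemeasurable]
    simp_rw [Measure.pi_pi]
    rw [Measure.lintegral_pi_prod (f := fun i b => κ i b (s i)) _ fun i => Measurable.of_discrete]
    simp [lintegral_fairCoin]
  rw [this, Measure.lintegral_bind hm.aemeasurable hF.aemeasurable]

/-! ### Gaussian measures -/

open Matrix in
-- Rotation invariance of `stdGaussian`, carried over from Euclidean space: WᵀW = 1 makes W an
-- isometry, and equality of dimensions makes it an equivalence.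
theorem pi_gaussianReal_map_orthogonal {n : ℕ} {W : Matrix (Fin n) (Fin n) ℝ} (hW : Wᵀ * W = 1) :
    (Measure.pi fun _ : Fin n => gaussianReal 0 1).map (fun x => W *ᵥ x) =
      Measure.pi fun _ => gaussianReal 0 1 := by
  let T : EuclideanSpace ℝ (Fin n) →ₗᵢ[ℝ] EuclideanSpace ℝ (Fin n) :=
    ⟨W.toEuclideanLin, fun x => by
      rw [← sq_eq_sq₀ (norm_nonneg _) (norm_nonneg _), EuclideanSpace.real_norm_sq_eq,
        EuclideanSpace.real_norm_sq_eq]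
      have h : (W *ᵥ x.ofLp) ⬝ᵥ (W *ᵥ x.ofLp) = x.ofLp ⬝ᵥ x.ofLp := by
        rw [Matrix.dotProduct_mulVec, Matrix.vecMul_mulVec, hW, Matrix.vecMul_one]
      simpa [dotProduct, pow_two] using h⟩
  have h1 := stdGaussian_map (T.toLinearIsometryEquiv rfl)
  rw [← map_pi_eq_stdGaussian, Measure.map_map (by fun_prop) (by fun_prop)] at h1
  have h2 := congrArg (Measure.map (WithLp.ofLp (p := 2) (V := Fin n → ℝ))) h1
  rw [Measure.map_map (by fun_prop) ((LinearIsometryEquiv.continuous _).measurable.comp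
    (by fun_prop)), Measure.map_map (by fun_prop) (by fun_prop)] at h2
  have h3 : (WithLp.ofLp (p := 2) (V := Fin n → ℝ)) ∘ (WithLp.toLp 2) = id := rfl
  rw [h3, Measure.map_id] at h2
  exact h2

namespace SparseSpike

instance (n : ℕ) : IsProbabilityMeasure (gaussianMatrix n) := by
  unfold gaussianMatrix; infer_instance

theorem gaussianMatrix_eq_map_pi (n : ℕ) : gaussianMatrix n =
    (Measure.pi fun _ : Fin n × Fin n => gaussianReal 0 1).map fun ω i j => ω (i, j) := by
  have h : Measure.pi (fun _ : Fin n × Fin n => gaussianReal 0 1) =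
      (gaussianMatrix n).map fun Z p => Z p.1 p.2 := by
    refine Measure.pi_eq fun s hs => ?_
    rw [Measure.map_apply (by fun_prop) (MeasurableSet.univ_pi hs)]
    have : (fun (Z : Fin n → Fin n → ℝ) (p : Fin n × Fin n) => Z p.1 p.2) ⁻¹' Set.univ.pi s =
        Set.univ.pi fun i => Set.univ.pi fun j => s (i, j) := by
      ext Z; simp [Set.mem_pi]
    rw [this, gaussianMatrix, Measure.pi_pi]
    simp_rw [Measure.pi_pi]
    exact (Fintype.prod_prod_type fun p : Fin n × Fin n => gaussianReal 0 1 (s p)).symm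
  rw [h, Measure.map_map (by fun_prop) (by fun_prop)]
  exact Measure.map_id.symm

theorem gaussianMatrix_map_transpose (n : ℕ) :
    (gaussianMatrix n).map (fun Z i j => Z j i) = gaussianMatrix n := by
  conv_lhs => rw [gaussianMatrix_eq_map_pi, Measure.map_map (by fun_prop) (by fun_prop)]
  conv_rhs => rw [gaussianMatrix_eq_map_pi, ← Measure.pi_map_comp_injective
    (fun _ : Fin n × Fin n => gaussianReal 0 1) (g := Prod.swap) Prod.swap_injective,
    Measure.map_map (by fun_prop) (by fun_prop)]
  rfl

open Matrix in
theorem gaussianMatrix_map_rows {n : ℕ} {W : Matrix (Fin n) (Fin n) ℝ} (hW : Wᵀ * W = 1) :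
    (gaussianMatrix n).map (fun Z i => W *ᵥ Z i) = gaussianMatrix n := by
  have hm : Measurable fun x : Fin n → ℝ => W *ᵥ x :=
    (Continuous.matrix_mulVec continuous_const continuous_id).measurable
  have : ∀ _ : Fin n, SigmaFinite ((Measure.pi fun _ : Fin n => gaussianReal 0 1).map
      fun x => W *ᵥ x) := fun _ => by rw [pi_gaussianReal_map_orthogonal hW]; infer_instance
  unfold gaussianMatrix
  rw [Measure.pi_map_pi fun _ => hm.aemeasurable]
  simp_rw [pi_gaussianReal_map_orthogonal hW]

open Matrix in
-- Z ↦ W Z Wᵀ is the composite of two rotations of the rows and two transpositions, each preserving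
-- the law.
theorem gaussianMatrix_map_conj {n : ℕ} {W : Matrix (Fin n) (Fin n) ℝ} (hW : Wᵀ * W = 1) :
    (gaussianMatrix n).map (fun Z i j => ∑ p, ∑ q, W i p * W j q * Z p q) = gaussianMatrix n := by
  have hm : Measurable fun (Z : Fin n → Fin n → ℝ) i => W *ᵥ Z i := by
    unfold Matrix.mulVec dotProduct; fun_prop
  have ht : Measurable fun (Z : Fin n → Fin n → ℝ) i j => Z j i := by fun_prop
  have h : (fun (Z : Fin n → Fin n → ℝ) i j => ∑ p, ∑ q, W i p * W j q * Z p q) =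
      (fun Z i j => Z j i) ∘ (fun Z i => W *ᵥ Z i) ∘ (fun Z i j => Z j i) ∘
        fun Z i => W *ᵥ Z i := by
    funext Z i j
    simp only [Function.comp, Matrix.mulVec, dotProduct, Finset.mul_sum]
    exact Finset.sum_congr rfl fun p _ => Finset.sum_congr rfl fun q _ => by ring
  rw [h, ← Measure.map_map ht (hm.comp (ht.comp hm)), ← Measure.map_map hm (ht.comp hm),
    ← Measure.map_map ht hm, gaussianMatrix_map_rows hW, gaussianMatrix_map_transpose,
    gaussianMatrix_map_rows hW, gaussianMatrix_map_transpose]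

end SparseSpike

/-! ### Gaussian comparison and concentration -/

/-- The likelihood ratio exp(l x - l²/2) is at most exp(l T) for x ≤ T. -/
theorem gaussianReal_restrict_Iic_le {l T : ℝ} (hl : 0 ≤ l) :
    (gaussianReal l 1).restrict (Set.Iic T) ≤
      ENNReal.ofReal (Real.exp (l * T)) • gaussianReal 0 1 := by
  rw [gaussianReal_of_var_ne_zero _ one_ne_zero, gaussianReal_of_var_ne_zero _ one_ne_zero,
    restrict_withDensity measurableSet_Iic, ← withDensity_smul _ (measurable_gaussianPDF _ _),
    ← withDensity_indicator measurableSet_Iic]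
  refine withDensity_mono (ae_of_all _ fun x => ?_)
  by_cases hx : x ∈ Set.Iic T
  · rw [Set.indicator_of_mem hx, Pi.smul_apply, smul_eq_mul, gaussianPDF, gaussianPDF,
      ← ENNReal.ofReal_mul (Real.exp_pos _).le]
    refine ENNReal.ofReal_le_ofReal ?_
    rw [gaussianPDFReal, gaussianPDFReal, mul_left_comm, ← Real.exp_add]
    have hx' : x ≤ T := hx
    have : l * x ≤ l * T := mul_le_mul_of_nonneg_left hx' hl
    have : -(x - l) ^ 2 / (2 * ((1 : NNReal) : ℝ)) ≤
        l * T + -(x - 0) ^ 2 / (2 * ((1 : NNReal) : ℝ)) := by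
      rw [NNReal.coe_one]; nlinarith [sq_nonneg l]
    gcongr
  · rw [Set.indicator_of_notMem hx]; exact zero_le

/-- Chernoff's bound with parameter 1. The exponential rate suffices, because every threshold used
is a positive power of the dimension. -/
theorem gaussianReal_Ici_le (m T : ℝ) (v : NNReal) :
    gaussianReal m v (Set.Ici T) ≤ ENNReal.ofReal (Real.exp (-T + m + v / 2)) := by
  have h := measure_ge_le_exp_mul_mgf (μ := gaussianReal m v) (X := id) (t := 1) T zero_le_one
    (integrable_exp_mul_gaussianReal 1)
  rw [mgf_gaussianReal (Measure.map_id), ← Real.exp_add] at h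
  have h2 : Set.Ici T = {ω : ℝ | T ≤ id ω} := rfl
  rw [h2, ← ENNReal.ofReal_toReal (measure_ne_top (gaussianReal m v) {ω : ℝ | T ≤ id ω})]
  refine ENNReal.ofReal_le_ofReal (h.trans_eq ?_)
  congr 1; ring

/-- The sum of independent variables with mean `m` and variance `s` concentrates. -/
theorem measure_pi_sum_ge_le {I : Type*} [Fintype I] {Ω : Type*} [MeasurableSpace Ω]
    (μ : Measure Ω) [IsProbabilityMeasure μ] {X : Ω → ℝ} (hX : MemLp X 2 μ) {t : ℝ} (ht : 0 < t) :
    (Measure.pi fun _ : I => μ) {ω | t ≤ |∑ i, X (ω i) - Fintype.card I * ∫ x, X x ∂μ|} ≤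
      ENNReal.ofReal (Fintype.card I * Var[X; μ] / t ^ 2) := by
  have hmem : ∀ i : I, MemLp (fun ω : I → Ω => X (ω i)) 2 (Measure.pi fun _ : I => μ) := fun i =>
    hX.comp_measurePreserving (measurePreserving_eval (fun _ : I => μ) i)
  have h := meas_ge_le_variance_div_sq (memLp_finsetSum' Finset.univ fun i _ => hmem i) ht
  rw [variance_sum_pi fun _ => hX] at h
  have hint : ∫ ω : I → Ω, (∑ i, fun ω : I → Ω => X (ω i)) ω ∂(Measure.pi fun _ : I => μ) =
      Fintype.card I * ∫ x, X x ∂μ := by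
    simp only [Finset.sum_apply]
    rw [integral_finsetSum _ fun i _ => (hmem i).integrable (by norm_num)]
    have : ∀ i : I, ∫ ω : I → Ω, X (ω i) ∂(Measure.pi fun _ : I => μ) = ∫ x, X x ∂μ := fun i =>
      integral_comp_eval (μ := fun _ : I => μ) hX.aestronglyMeasurable
    simp [this]
  rw [hint] at h
  simpa using h

/-! ### Tests that look at the diagonal only -/

namespace SparseSpike

open RealProgram

theorem gaussianMatrix_map_diag (n : ℕ) :
    (gaussianMatrix n).map (fun Z i => Z i i) = Measure.pi fun _ => gaussianReal 0 1 := by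
  rw [gaussianMatrix_eq_map_pi, Measure.map_map (by fun_prop) (by fun_prop)]
  exact Measure.pi_map_comp_injective (fun _ : Fin n × Fin n => gaussianReal 0 1)
    (g := fun i => (i, i)) fun i j h => (Prod.mk.inj h).1

theorem measurable_symmetrize (n : ℕ) :
    Measurable fun (Z : Fin n → Fin n → ℝ) i j =>
      if i = j then Real.sqrt 2 * Z i i else if j < i then Z i j else Z j i := by
  rw [measurable_pi_iff]; intro i
  rw [measurable_pi_iff]; intro j
  split_ifs <;> fun_prop

theorem goe_map_diag (n : ℕ) :
    (goe n).map (fun Z i => Z i i) = Measure.pi fun _ => gaussianReal 0 2 := by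
  have h2 : (gaussianReal 0 1).map (fun x => Real.sqrt 2 * x) = gaussianReal 0 2 := by
    rw [gaussianReal_map_const_mul]
    congr 1
    · simp
    · ext; simp
  have : ∀ _ : Fin n, SigmaFinite ((gaussianReal 0 1).map fun x => Real.sqrt 2 * x) :=
    fun _ => by rw [h2]; infer_instance
  have h3 := Measure.pi_map_pi (ι := Fin n) (μ := fun _ => gaussianReal 0 1)
    (f := fun _ x => Real.sqrt 2 * x) fun _ => by fun_prop
  simp only [h2] at h3
  rw [← h3, ← gaussianMatrix_map_diag, goe, Measure.map_map (by fun_prop) (measurable_symmetrize n),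
    Measure.map_map (by fun_prop) (by fun_prop)]
  congr 1
  funext Z i
  simp

/-- For a deterministic test of the diagonal, only the law of the diagonal noise matters. This
treats both models together: the diagonal is i.i.d. with variance 1 or 2. -/
theorem error_le_of_diag {n : ℕ} {noise : Measure (Fin n → Fin n → ℝ)}
    {ν : Measure (Fin n → ℝ)} (hν : noise.map (fun Z i => Z i i) = ν) (k : ℕ) (μ : ℝ)
    {φ : Prog} {t : (Fin n → ℝ) → ℝ} (ht : Measurable t)
    (hφ : ∀ M, ∃ m', φ.Maps (encodeMatrix n M) m' ∧ m' 0 = t fun i => M i i) {a b : ℝ≥0∞}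
    (ha : ν {z | 0 < t z} ≤ a)
    (hb : ∀ v ∈ spikes n k, ν {z | ¬ 0 < t fun i => μ * (v i * v i) + z i} ≤ b) :
    error noise k μ φ ≤ a + b := by
  have hd : Measurable fun (Z : Fin n → Fin n → ℝ) i => Z i i := by fun_prop
  refine add_le_add ?_ (iSup₂_le fun v hv => ?_)
  · have h : ∀ M, φ.prOne (encodeMatrix n M) =
        ((fun (Z : Fin n → Fin n → ℝ) i => Z i i) ⁻¹' {z | 0 < t z}).indicator 1 M := fun M => by
      obtain ⟨m', h1, h2⟩ := hφ M
      rw [h1.prOne_eq, h2]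
      simp [Set.indicator]
    have hs : MeasurableSet {z | 0 < t z} := measurableSet_lt measurable_const ht
    simp_rw [h]
    rw [lintegral_indicator_one (hd hs), ← Measure.map_apply hd hs, hν]
    exact ha
  · have h : ∀ M, φ.prZero (encodeMatrix n M) =
        ((fun (Z : Fin n → Fin n → ℝ) i => Z i i) ⁻¹' {z | ¬ 0 < t z}).indicator 1 M := fun M => by
      obtain ⟨m', h1, h2⟩ := hφ M
      rw [h1.prZero_eq, h2]
      simp only [Set.indicator, Set.mem_preimage, Set.mem_ofPred_eq, Pi.one_apply]
      split_ifs <;> simp_all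
    have hs : MeasurableSet {z | ¬ 0 < t z} := (measurableSet_lt measurable_const ht).compl
    have ht2 : Measurable fun z : Fin n → ℝ => t fun i => μ * (v i * v i) + z i :=
      ht.comp (by fun_prop)
    have hs2 : MeasurableSet {z : Fin n → ℝ | ¬ 0 < t fun i => μ * (v i * v i) + z i} :=
      (measurableSet_lt measurable_const ht2).compl
    simp_rw [h]
    rw [lintegral_indicator_one (hd hs), spiked, Measure.map_apply (by fun_prop) (hd hs)]
    refine le_trans (le_of_eq ?_) (hb v hv)
    rw [← hν, Measure.map_apply hd hs2]
    rfl

/-- The register that holds the `i`-th diagonal entry. -/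
def diagReg (n i : ℕ) : ℕ := i + n * i

theorem diagReg_lt {n i : ℕ} (h : i < n) : diagReg n i < n * n := by
  unfold diagReg; nlinarith

theorem encodeMatrix_diagReg {n : ℕ} (M : Fin n → Fin n → ℝ) (i : Fin n) :
    encodeMatrix n M (diagReg n i) = M i i := encodeMatrix_apply M i i

/-- Compare the trace with `τ`. -/
noncomputable def traceTest (n : ℕ) (τ : ℝ) : Prog :=
  .statistic .mul (fun _ => 1) (diagReg n) (-τ) n (n * n)

/-- Look for a diagonal entry above `τ`. -/
noncomputable def maxTest (n : ℕ) (τ : ℝ) : Prog :=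
  .statistic .lt (fun _ => τ) (diagReg n) 0 n (n * n)

theorem polyTime_traceTest (N : ℕ → ℕ) (τ : ℕ → ℝ) : PolyTime N fun n => traceTest (N n) (τ n) := by
  refine ⟨3, fun n => ?_⟩
  have h : 3 + N n * 3 ≤ 3 * (N n + 1) ^ 3 := by
    nlinarith [sq_nonneg (N n), pow_pos (Nat.succ_pos (N n)) 2, Nat.zero_le (N n ^ 3)]
  exact ⟨(Prog.size_statistic_le ..).trans h, (Prog.steps_statistic_le ..).trans h⟩

theorem polyTime_maxTest (N : ℕ → ℕ) (τ : ℕ → ℝ) : PolyTime N fun n => maxTest (N n) (τ n) := by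
  refine ⟨3, fun n => ?_⟩
  have h : 3 + N n * 3 ≤ 3 * (N n + 1) ^ 3 := by
    nlinarith [sq_nonneg (N n), pow_pos (Nat.succ_pos (N n)) 2, Nat.zero_le (N n ^ 3)]
  exact ⟨(Prog.size_statistic_le ..).trans h, (Prog.steps_statistic_le ..).trans h⟩

/-- A unit spike adds exactly μ to the trace, so either error forces the noise trace to deviate by
μ/2; Chebyshev bounds both. -/
theorem error_traceTest_le {n : ℕ} {noise : Measure (Fin n → Fin n → ℝ)} {s : NNReal}
    (hnoise : noise.map (fun Z i => Z i i) = Measure.pi fun _ => gaussianReal 0 s)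
    (k : ℕ) {μ : ℝ} (hμ : 0 < μ) :
    error noise k μ (traceTest n (μ / 2)) ≤
      ENNReal.ofReal (4 * s * (n / μ ^ 2)) + ENNReal.ofReal (4 * s * (n / μ ^ 2)) := by
  have key := measure_pi_sum_ge_le (I := Fin n) (gaussianReal 0 s) (X := id)
    (memLp_id_gaussianReal 2) (half_pos hμ)
  rw [variance_id_gaussianReal, Fintype.card_fin,
    show (n : ℝ) * s / (μ / 2) ^ 2 = 4 * s * (n / μ ^ 2) by field_simp; ring] at key
  simp only [id, integral_id_gaussianReal, mul_zero, sub_zero] at key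
  refine error_le_of_diag hnoise k μ (t := fun z => -(μ / 2) + ∑ i, z i) (by fun_prop) ?_ ?_ ?_
  · intro M
    obtain ⟨m', h1, h2⟩ := Prog.maps_statistic Op.value_mul (fun _ => 1) (-(μ / 2))
      (ρ := diagReg n) (n := n) (L := n * n) (fun i hi => diagReg_lt hi) (encodeMatrix n M)
    refine ⟨m', h1, h2.trans ?_⟩
    rw [Finset.sum_range]
    simp [encodeMatrix_diagReg]
  · refine (measure_mono fun z hz => ?_).trans key
    have hz' : 0 < -(μ / 2) + ∑ i, z i := hz
    change μ / 2 ≤ |∑ i, z i|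
    exact le_trans (by linarith) (le_abs_self _)
  · intro v hv
    refine (measure_mono fun z hz => ?_).trans key
    have hz' : ¬ 0 < -(μ / 2) + ∑ i, (μ * (v i * v i) + z i) := hz
    change μ / 2 ≤ |∑ i, z i|
    have h1 : ∑ i, v i * v i = 1 := by simpa [pow_two] using hv.1
    rw [Finset.sum_add_distrib, ← Finset.mul_sum, h1] at hz'
    exact le_trans (by linarith) (neg_le_abs _)

theorem gaussianReal_Iic_neg_le (T : ℝ) (s : NNReal) :
    gaussianReal 0 s (Set.Iic (-T)) ≤ ENNReal.ofReal (Real.exp (-T + s / 2)) := by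
  have h := gaussianReal_Ici_le 0 T s
  have h2 : (gaussianReal 0 s).map (fun x => -x) = gaussianReal 0 s := by
    rw [gaussianReal_map_neg, neg_zero]
  rw [← h2, Measure.map_apply measurable_neg measurableSet_Ici] at h
  have h3 : (fun x : ℝ => -x) ⁻¹' Set.Ici T = Set.Iic (-T) := by
    ext x; simp
  rwa [h3, add_zero] at h

/-- With τ half of μ/k, a false alarm is handled by a union bound over the diagonal. For a miss, one
support index is enough: its shift is at least 2τ, so its noise must be at most -τ. -/
theorem error_maxTest_le {n : ℕ} {noise : Measure (Fin n → Fin n → ℝ)} {s : NNReal}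
    (hnoise : noise.map (fun Z i => Z i i) = Measure.pi fun _ => gaussianReal 0 s)
    {k : ℕ} (hk : 1 ≤ k) {μ : ℝ} (hμ : 0 < μ) :
    error noise k μ (maxTest n (μ / k / 2)) ≤
      n * ENNReal.ofReal (Real.exp (-(μ / k / 2) + s / 2)) +
        ENNReal.ofReal (Real.exp (-(μ / k / 2) + s / 2)) := by
  set τ := μ / k / 2 with hτ
  have hpos : ∀ z : Fin n → ℝ, 0 < ∑ i, (if τ < z i then (1 : ℝ) else 0) ↔ ∃ i, τ < z i := by
    intro z
    rw [Finset.sum_pos_iff_of_nonneg fun i _ => by split_ifs <;> simp]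
    refine ⟨fun ⟨i, _, h⟩ => ⟨i, ?_⟩, fun ⟨i, h⟩ => ⟨i, Finset.mem_univ _, by simp [h]⟩⟩
    by_contra h'
    simp [h'] at h
  refine error_le_of_diag hnoise k μ (t := fun z => ∑ i, if τ < z i then (1 : ℝ) else 0)
    ?_ ?_ ?_ ?_
  · refine Finset.measurable_fun_sum _ fun i _ => ?_
    exact Measurable.ite (measurableSet_lt measurable_const (measurable_pi_apply i))
      measurable_const measurable_const
  · intro M
    obtain ⟨m', h1, h2⟩ := Prog.maps_statistic Op.value_lt (fun _ => τ) 0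
      (w := fun x y => if x < y then 1 else 0) (ρ := diagReg n) (n := n) (L := n * n)
      (fun i hi => diagReg_lt hi) (encodeMatrix n M)
    refine ⟨m', h1, h2.trans ?_⟩
    rw [Finset.sum_range, zero_add]
    simp [encodeMatrix_diagReg]
  · simp_rw [hpos]
    have : {z : Fin n → ℝ | ∃ i, τ < z i} ⊆
        ⋃ i ∈ Finset.univ, (fun z : Fin n → ℝ => z i) ⁻¹' Set.Ici τ := by
      rintro z ⟨i, hi⟩
      simp only [Set.mem_iUnion]
      exact ⟨i, Finset.mem_univ _, hi.le⟩
    refine (measure_mono this).trans ((measure_biUnion_finset_le _ _).trans ?_)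
    refine (Finset.sum_le_card_nsmul _ _ (ENNReal.ofReal (Real.exp (-τ + s / 2))) ?_).trans ?_
    · intro i _
      rw [(measurePreserving_eval (fun _ : Fin n => gaussianReal 0 s) i).measure_preimage
        measurableSet_Ici.nullMeasurableSet]
      simpa using gaussianReal_Ici_le 0 τ s
    · simp
  · intro v hv
    obtain ⟨i, hi⟩ : ∃ i, v i ≠ 0 := by
      by_contra! h
      have := hv.1
      simp [h] at this
    have hk0 : (0 : ℝ) < k := by exact_mod_cast hk
    have h1 : 1 / (k : ℝ) ≤ v i * v i := by
      have h := hv.2.2.2 i hi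
      have h2 : (1 / Real.sqrt k) ^ 2 ≤ |v i| ^ 2 := by gcongr
      rwa [div_pow, one_pow, Real.sq_sqrt hk0.le, sq_abs, pow_two] at h2
    have h2 : 2 * τ ≤ μ * (v i * v i) := by
      calc 2 * τ = μ * (1 / k) := by rw [hτ]; ring
        _ ≤ _ := by gcongr
    simp_rw [hpos]
    have : {z : Fin n → ℝ | ¬ ∃ i, τ < μ * (v i * v i) + z i} ⊆
        (fun z : Fin n → ℝ => z i) ⁻¹' Set.Iic (-τ) := by
      intro z hz
      have hz' : ¬ ∃ i, τ < μ * (v i * v i) + z i := hz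
      push Not at hz'
      change z i ≤ -τ
      linarith [hz' i]
    refine (measure_mono this).trans ?_
    rw [(measurePreserving_eval (fun _ : Fin n => gaussianReal 0 s) i).measure_preimage
      measurableSet_Iic.nullMeasurableSet]
    exact gaussianReal_Iic_neg_le τ s

theorem tendsto_mul_exp_neg_rpow {δ c : ℝ} (hδ : 0 < δ) (hc : 0 < c) :
    Tendsto (fun x : ℝ => x * Real.exp (-c * x ^ δ)) atTop (𝓝 0) := by
  have h := (tendsto_rpow_mul_exp_neg_mul_atTop_nhds_zero (1 / δ) c hc).comp
    (tendsto_rpow_atTop hδ)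
  refine h.congr' ?_
  filter_upwards [eventually_ge_atTop 0] with x hx
  simp only [Function.comp]
  rw [← Real.rpow_mul hx, mul_one_div_cancel hδ.ne', Real.rpow_one]

/-! ### Success of the two tests in the regime -/

section Regime

variable {α β : ℝ} {N K : ℕ → ℕ} {μ : ℕ → ℝ}

theorem InRegime.tendsto_cast (h : InRegime α β N K μ) :
    Tendsto (fun n => (N n : ℝ)) atTop atTop := tendsto_natCast_atTop_atTop.comp h.dim_tendsto

theorem InRegime.cast_pos (h : InRegime α β N K μ) (n : ℕ) : (0 : ℝ) < K n := by
  exact_mod_cast h.sparsity_pos n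

theorem InRegime.tendsto_div_sq (h : InRegime α β N K μ) (hαβ : 1 / 2 + α < β) :
    Tendsto (fun n => (N n : ℝ) / μ n ^ 2) atTop (𝓝 0) := by
  -- Since μ = N^(β-α+o(1)), half of the gap gives μ ≥ N^(1/2+δ) eventually, hence N/μ² ≤ N^(-2δ).
  obtain ⟨δ, hδ, hδ'⟩ : ∃ δ, 0 < δ ∧ 1 / 2 + δ < β - α :=
    ⟨(β - α - 1 / 2) / 2, by linarith, by linarith⟩
  have h1 : Tendsto (fun n => Real.log (μ n) / Real.log (N n)) atTop (𝓝 (β - α)) := by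
    refine (h.sparsity_tendsto.sub h.signal_tendsto).congr fun n => ?_
    rw [Real.log_mul (h.cast_pos n).ne' (inv_ne_zero (h.signal_pos n).ne'), Real.log_inv]
    ring
  have h2 : Tendsto (fun n => (N n : ℝ) ^ (-(2 * δ))) atTop (𝓝 0) :=
    (tendsto_rpow_neg_atTop (by linarith)).comp h.tendsto_cast
  refine tendsto_of_tendsto_of_tendsto_of_le_of_le' tendsto_const_nhds h2
    (Eventually.of_forall fun n => by positivity) ?_
  filter_upwards [h1.eventually_const_lt hδ', h.tendsto_cast.eventually_gt_atTop 1] with n h3 h4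
  have hN : (0 : ℝ) < N n := by linarith
  have hl := Real.log_pos h4
  rw [lt_div_iff₀ hl] at h3
  have h5 : (N n : ℝ) ^ (1 / 2 + δ) ≤ μ n := by
    rw [Real.rpow_def_of_pos hN, ← Real.exp_log (h.signal_pos n)]
    exact Real.exp_le_exp.2 (by linarith)
  rw [div_le_iff₀ (pow_pos (h.signal_pos n) 2)]
  calc (N n : ℝ) = (N n : ℝ) ^ (-(2 * δ)) * ((N n : ℝ) ^ (1 / 2 + δ)) ^ 2 := by
        rw [← Real.rpow_natCast, ← Real.rpow_mul hN.le, ← Real.rpow_add hN]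
        norm_num
        rw [show -(2 * δ) + (1 / 2 + δ) * 2 = 1 by ring, Real.rpow_one]
    _ ≤ _ := by gcongr

/-- Here μ/K = N^(-α+o(1)) is eventually at least N^(-α/2), a positive power of N. -/
theorem InRegime.tendsto_mul_exp (h : InRegime α β N K μ) (hα : α < 0) :
    Tendsto (fun n => (N n : ℝ) * Real.exp (-(μ n / K n / 2))) atTop (𝓝 0) := by
  have h2 : Tendsto (fun n => (N n : ℝ) * Real.exp (-(1 / 2) * (N n : ℝ) ^ (-α / 2))) atTop (𝓝 0) :=
    (tendsto_mul_exp_neg_rpow (by linarith) (by norm_num)).comp h.tendsto_cast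
  refine tendsto_of_tendsto_of_tendsto_of_le_of_le' tendsto_const_nhds h2
    (Eventually.of_forall fun n => by positivity) ?_
  filter_upwards [h.signal_tendsto.eventually_lt_const (show α < α / 2 by linarith),
    h.tendsto_cast.eventually_gt_atTop 1] with n h3 h4
  have hN : (0 : ℝ) < N n := by linarith
  have hl := Real.log_pos h4
  rw [div_lt_iff₀ hl] at h3
  have h5 : (N n : ℝ) ^ (-α / 2) ≤ μ n / K n := by
    rw [Real.rpow_def_of_pos hN,
      ← Real.exp_log (div_pos (h.signal_pos n) (h.cast_pos n))]
    refine Real.exp_le_exp.2 ?_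
    have : μ n / K n = (K n * (μ n)⁻¹)⁻¹ := by rw [mul_inv, inv_inv]; ring
    rw [this, Real.log_inv]
    linarith
  gcongr
  linarith

theorem InRegime.exists_test (h : InRegime α β N K μ)
    (hαβ : (0 < α ∧ 1 / 2 + α < β) ∨ (β < 1 / 2 ∧ α < 0))
    {noise : ∀ n, Measure (Fin n → Fin n → ℝ)} {s : NNReal}
    (hnoise : ∀ n, (noise n).map (fun Z i => Z i i) = Measure.pi fun _ => gaussianReal 0 s) :
    ∃ φ : ℕ → Prog, PolyTime N φ ∧
      Tendsto (fun n => error (noise (N n)) (K n) (μ n) (φ n)) atTop (𝓝 0) := by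
  rcases hαβ with ⟨-, hαβ⟩ | ⟨-, hα⟩
  · refine ⟨_, polyTime_traceTest N fun n => μ n / 2, ?_⟩
    have h1 : Tendsto (fun n => ENNReal.ofReal (4 * s * ((N n : ℝ) / μ n ^ 2))) atTop (𝓝 0) := by
      have := ENNReal.tendsto_ofReal ((h.tendsto_div_sq hαβ).const_mul (4 * (s : ℝ)))
      rwa [mul_zero, ENNReal.ofReal_zero] at this
    have h2 := h1.add h1
    rw [add_zero] at h2
    exact tendsto_of_tendsto_of_tendsto_of_le_of_le tendsto_const_nhds h2 (fun _ => zero_le)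
      fun n => error_traceTest_le (hnoise _) _ (h.signal_pos n)
  · refine ⟨_, polyTime_maxTest N fun n => μ n / K n / 2, ?_⟩
    have h1 : Tendsto (fun n => ENNReal.ofReal
        ((N n : ℝ) * Real.exp (-(μ n / K n / 2)) * Real.exp (s / 2))) atTop (𝓝 0) := by
      have := ENNReal.tendsto_ofReal ((h.tendsto_mul_exp hα).mul_const (Real.exp (s / 2)))
      rwa [zero_mul, ENNReal.ofReal_zero] at this
    have h2 := h1.add h1
    rw [add_zero] at h2
    refine tendsto_of_tendsto_of_tendsto_of_le_of_le tendsto_const_nhds h2 (fun _ => zero_le)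
      fun n => (error_maxTest_le (hnoise _) (h.sparsity_pos n) (h.signal_pos n)).trans ?_
    have hN : (1 : ℝ≥0∞) ≤ N n := by
      exact_mod_cast (h.sparsity_pos n).trans (h.sparsity_le n)
    have h3 : ENNReal.ofReal ((N n : ℝ) * Real.exp (-(μ n / K n / 2)) * Real.exp (s / 2)) =
        N n * ENNReal.ofReal (Real.exp (-(μ n / K n / 2) + s / 2)) := by
      rw [mul_assoc, ← Real.exp_add, ENNReal.ofReal_mul (Nat.cast_nonneg _),
        ENNReal.ofReal_natCast]
    simp only [h3]
    gcongr
    exact le_mul_of_one_le_left zero_le hN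

end Regime

end SparseSpike

/-! ### Spreading sparse vectors by block Hadamard matrices -/

namespace SparseSpike

/-- An orthogonal matrix that is block diagonal with respect to the partition into the fibres of
`blk`, all of size `g`, and has constant modulus in each block. -/
structure IsBlockHadamard {N Q : ℕ} (g : ℕ) (blk : Fin N → Fin Q)
    (W : Matrix (Fin N) (Fin N) ℝ) : Prop where
  orthogonal : W.transpose * W = 1
  card_fiber : ∀ q, (Finset.univ.filter fun i => blk i = q).card = g
  eq_zero : ∀ i j, blk i ≠ blk j → W i j = 0
  eq_or : ∀ i j, blk i = blk j → W i j = 1 / Real.sqrt g ∨ W i j = -(1 / Real.sqrt g)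

/-- Indices are identified with `Fin Q × (Fin m → Bool)`; each block is the normalized character
table of (ℤ/2)^m. -/
theorem exists_isBlockHadamard (Q m : ℕ) :
    ∃ (blk : Fin (Q * 2 ^ m) → Fin Q) (W : Matrix _ _ ℝ), IsBlockHadamard (2 ^ m) blk W := by
  have hc : Fintype.card (Fin (Q * 2 ^ m)) = Fintype.card (Fin Q × (Fin m → Bool)) := by simp
  let e := Fintype.equivOfCardEq hc
  let χ : Bool → Bool → ℝ := fun a b => if a && b then -1 else 1
  have hχ : ∀ a b, χ a b = 1 ∨ χ a b = -1 := by intro a b; cases a <;> cases b <;> simp [χ]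
  have hprod : ∀ (x y : Fin m → Bool), ∏ t, χ (x t) (y t) = 1 ∨ ∏ t, χ (x t) (y t) = -1 := by
    intro x y
    refine Finset.prod_induction (fun t => χ (x t) (y t)) (fun r => r = 1 ∨ r = -1) ?_ (Or.inl rfl)
      fun t _ => hχ _ _
    rintro a b (rfl | rfl) (rfl | rfl) <;> simp
  have hpos : (0 : ℝ) < ((2 ^ m : ℕ) : ℝ) := by positivity
  refine ⟨fun i => (e i).1, Matrix.of fun i j => if (e i).1 = (e j).1 then
    1 / Real.sqrt ((2 ^ m : ℕ) : ℝ) * ∏ t, χ ((e i).2 t) ((e j).2 t) else 0, ?_, ?_, ?_, ?_⟩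
  · ext j j'
    rw [Matrix.mul_apply]
    simp only [Matrix.transpose_apply, Matrix.of_apply]
    rw [← e.symm.sum_comp, Fintype.sum_prod_type, Matrix.one_apply]
    simp only [Equiv.apply_symm_apply]
    by_cases h : (e j).1 = (e j').1
    · rw [Finset.sum_eq_single (e j).1 (fun q _ hq => by simp [hq]) (by simp)]
      simp only [h, if_true]
      have h1 : ∀ b : Fin m → Bool,
          1 / Real.sqrt ((2 ^ m : ℕ) : ℝ) * (∏ t, χ (b t) ((e j).2 t)) *
          (1 / Real.sqrt ((2 ^ m : ℕ) : ℝ) * ∏ t, χ (b t) ((e j').2 t)) =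
          1 / ((2 ^ m : ℕ) : ℝ) * ∏ t, χ (b t) ((e j).2 t) * χ (b t) ((e j').2 t) := by
        intro b
        have hs : 1 / ((2 ^ m : ℕ) : ℝ) =
            1 / Real.sqrt ((2 ^ m : ℕ) : ℝ) * (1 / Real.sqrt ((2 ^ m : ℕ) : ℝ)) := by
          rw [div_mul_div_comm, one_mul, Real.mul_self_sqrt hpos.le]
        rw [Finset.prod_mul_distrib, hs]
        ring
      -- The inner product of two characters factors over the coordinates; a coordinate where they
      -- differ contributes 0, any other 2.
      have h2 : ∑ b : Fin m → Bool, ∏ t, χ (b t) ((e j).2 t) * χ (b t) ((e j').2 t) =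
          ∏ t, ∑ c : Bool, χ c ((e j).2 t) * χ c ((e j').2 t) := by
        rw [Finset.prod_univ_sum, Fintype.piFinset_univ]
      have h3 : ∀ x y : Bool, ∑ c : Bool, χ c x * χ c y = if x = y then 2 else 0 := by
        intro x y; cases x <;> cases y <;> norm_num [χ]
      simp only [h1]
      rw [← Finset.mul_sum, h2]
      simp only [h3]
      by_cases hj : j = j'
      · subst hj; simp
      · have : ∃ t, (e j).2 t ≠ (e j').2 t := by
          by_contra! h'
          exact hj (e.injective (Prod.ext h (funext h')))
        obtain ⟨t, ht⟩ := this
        rw [Finset.prod_eq_zero (Finset.mem_univ t) (by simp [ht])]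
        simp [hj]
    · have hj : j ≠ j' := fun h' => h (by rw [h'])
      rw [if_neg hj]
      refine Finset.sum_eq_zero fun q _ => Finset.sum_eq_zero fun b _ => ?_
      by_cases h1 : q = (e j).1
      · have : q ≠ (e j').1 := fun h2 => h (h1 ▸ h2)
        simp [this]
      · simp [h1]
  · intro q
    have : (Finset.univ.filter fun i => (e i).1 = q) =
        Finset.univ.image fun b : Fin m → Bool => e.symm (q, b) := by
      ext i
      simp only [Finset.mem_filter, Finset.mem_univ, true_and, Finset.mem_image]
      refine ⟨fun h => ⟨(e i).2, by rw [← h]; simp⟩, ?_⟩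
      rintro ⟨b, rfl⟩; simp
    rw [this, Finset.card_image_of_injective]
    · simp
    · intro b c h; simpa using h
  · intro i j h; simp [h]
  · intro i j h
    simp only [Matrix.of_apply, h, if_true]
    rcases hprod (e i).2 (e j).2 with h' | h' <;> simp [h']

open Classical in
/-- The number of ordered pairs of distinct elements of `S` in the same block. -/
noncomputable def collisions {N Q : ℕ} (blk : Fin N → Fin Q) (S : Finset (Fin N)) : ℕ :=
  ∑ a ∈ S, ∑ b ∈ S, if a ≠ b ∧ blk a = blk b then 1 else 0

/-- The unit vector that is uniform on `S`, rotated by `W`. -/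
noncomputable def rotatedSpike {N : ℕ} (W : Matrix (Fin N) (Fin N) ℝ) (k : ℕ)
    (S : Finset (Fin N)) (i : Fin N) : ℝ := (∑ j ∈ S, W i j) / Real.sqrt k

theorem sum_sq_sum_orthogonal {N : ℕ} {W : Matrix (Fin N) (Fin N) ℝ} (hW : W.transpose * W = 1)
    (S : Finset (Fin N)) : ∑ i, (∑ j ∈ S, W i j) ^ 2 = S.card := by
  classical
  have h : ∀ a b, ∑ i, W i a * W i b = if a = b then 1 else 0 := fun a b => by
    have := congrFun (congrFun hW a) b
    rw [Matrix.mul_apply, Matrix.one_apply] at this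
    simpa using this
  simp_rw [pow_two, Finset.sum_mul_sum]
  rw [Finset.sum_comm]
  have h2 : ∀ a ∈ S, ∑ i, ∑ b ∈ S, W i a * W i b = 1 := fun a ha => by
    rw [Finset.sum_comm]; simp [h, ha]
  rw [Finset.sum_congr rfl h2]; simp

/-- Integrality is what bounds the entries from below: a nonzero row sum has modulus at least 1/√g,
even when signs partly cancel. -/
theorem IsBlockHadamard.exists_int {N Q g : ℕ} {blk : Fin N → Fin Q}
    {W : Matrix (Fin N) (Fin N) ℝ} (h : IsBlockHadamard g blk W) (S : Finset (Fin N)) (i : Fin N) :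
    ∃ z : ℤ, ∑ j ∈ S, W i j = z / Real.sqrt g := by
  have h1 : ∀ j, ∃ z : ℤ, W i j = z / Real.sqrt g := fun j => by
    by_cases hb : blk i = blk j
    · rcases h.eq_or i j hb with h' | h'
      · exact ⟨1, by rw [h']; simp⟩
      · exact ⟨-1, by rw [h']; push_cast; ring⟩
    · exact ⟨0, by rw [h.eq_zero i j hb]; simp⟩
  choose z hz using h1
  exact ⟨∑ j ∈ S, z j, by
    push_cast; rw [Finset.sum_div]; exact Finset.sum_congr rfl fun j _ => hz j⟩

/-- An index whose block contains exactly one point of S surely lies in the support, and the count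
of such indices is bounded below by the first two moments of the block occupancies. The upper bound
on the support follows from the unit norm and the lower bound on the entries. -/
theorem IsBlockHadamard.rotatedSpike_mem {N Q g k : ℕ} {blk : Fin N → Fin Q}
    {W : Matrix (Fin N) (Fin N) ℝ} (h : IsBlockHadamard g blk W) (hg : 0 < g) (hk : 0 < k)
    {S : Finset (Fin N)} (hS : S.card = k)
    (hcoll : (g * collisions blk S : ℝ) ≤ (k * g : ℕ) / Real.log (k * g : ℕ)) :
    rotatedSpike W k S ∈ spikes N (k * g) := by
  classical
  have hk0 : (0 : ℝ) < k := by exact_mod_cast hk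
  have hg0 : (0 : ℝ) < g := by exact_mod_cast hg
  have hnorm : ∑ i, rotatedSpike W k S i ^ 2 = 1 := by
    simp only [rotatedSpike, div_pow, Real.sq_sqrt hk0.le]
    rw [← Finset.sum_div, sum_sq_sum_orthogonal h.orthogonal, hS, div_self hk0.ne']
  have hlow : ∀ i, rotatedSpike W k S i ≠ 0 →
      1 / Real.sqrt (k * g : ℕ) ≤ |rotatedSpike W k S i| := by
    intro i hi
    obtain ⟨z, hz⟩ := h.exists_int S i
    rw [rotatedSpike, hz] at hi ⊢
    have hz0 : z ≠ 0 := by rintro rfl; simp at hi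
    have hz1 : (1 : ℝ) ≤ |(z : ℝ)| := by exact_mod_cast Int.one_le_abs hz0
    rw [div_div, abs_div, Nat.cast_mul, Real.sqrt_mul hk0.le, mul_comm (Real.sqrt k),
      abs_of_nonneg (by positivity : (0 : ℝ) ≤ Real.sqrt g * Real.sqrt k)]
    gcongr
  set supp := Finset.univ.filter fun i => rotatedSpike W k S i ≠ 0 with hsupp
  refine ⟨hnorm, ?_, ?_, hlow⟩
  · set c : Fin N → ℕ := fun i => (S.filter fun j => blk i = blk j).card with hc
    have hone : ∀ i, c i = 1 → i ∈ supp := by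
      intro i hi
      obtain ⟨j, hj⟩ := Finset.card_eq_one.1 hi
      have hjS : j ∈ S ∧ blk i = blk j := by
        have : j ∈ S.filter fun j => blk i = blk j := by rw [hj]; simp
        simpa using this
      have hsum : ∑ j ∈ S, W i j = W i j := by
        refine Finset.sum_eq_single_of_mem j hjS.1 fun b hb hbj => h.eq_zero i b fun hib => hbj ?_
        have : b ∈ S.filter fun j => blk i = blk j := by simp [hb, hib]
        rw [hj] at this; simpa using this
      rw [hsupp, Finset.mem_filter]
      refine ⟨Finset.mem_univ _, ?_⟩
      rw [rotatedSpike, hsum]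
      have hs : (0 : ℝ) < 1 / Real.sqrt g := by positivity
      refine div_ne_zero ?_ (Real.sqrt_pos.2 hk0).ne'
      rcases h.eq_or i j hjS.2 with h' | h' <;> rw [h']
      · exact hs.ne'
      · exact (neg_lt_zero.2 hs).ne
    have hfib : ∀ j, (Finset.univ.filter fun i => blk i = blk j).card = g := fun j =>
      h.card_fiber _
    have hc1 : ∑ i, (c i : ℝ) = k * g := by
      have : ∑ i, c i = ∑ j ∈ S, (Finset.univ.filter fun i => blk i = blk j).card := by
        simp only [hc, Finset.card_filter]
        exact Finset.sum_comm
      rw [← Nat.cast_sum, this]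
      simp [hfib, hS]
    have hc2 : ∑ i, (c i : ℝ) ^ 2 = g * (k + collisions blk S) := by
      have h1 : ∑ i, c i ^ 2 = ∑ a ∈ S, ∑ b ∈ S, if blk a = blk b then g else 0 := by
        simp only [hc, Finset.card_filter, pow_two, Finset.sum_mul_sum]
        rw [Finset.sum_comm]
        refine Finset.sum_congr rfl fun a _ => ?_
        rw [Finset.sum_comm]
        refine Finset.sum_congr rfl fun b _ => ?_
        split_ifs with hab
        · rw [← hfib a, Finset.card_filter]
          refine Finset.sum_congr rfl fun i _ => ?_
          rw [← hab]; split_ifs <;> rfl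
        · refine Finset.sum_eq_zero fun i _ => ?_
          split_ifs with hi hi' <;> try rfl
          exact absurd (hi.symm.trans hi') hab
      have h2 : ∀ a ∈ S, ∑ b ∈ S, (if blk a = blk b then g else 0) =
          g * (1 + ∑ b ∈ S, if a ≠ b ∧ blk a = blk b then 1 else 0) := by
        intro a ha
        rw [mul_add, mul_one, Finset.mul_sum]
        have : ∀ b, (if blk a = blk b then g else 0) = (if a = b then g else 0) +
            g * (if a ≠ b ∧ blk a = blk b then 1 else 0) := by
          intro b
          by_cases hab : a = b
          · subst hab; simp
          · simp [hab]
        simp_rw [this]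
        rw [Finset.sum_add_distrib, Finset.sum_ite_eq, if_pos ha]
      have h3 : ∑ i, c i ^ 2 = g * (k + collisions blk S) := by
        rw [h1, Finset.sum_congr rfl h2, ← Finset.mul_sum, Finset.sum_add_distrib]
        simp [hS, collisions]
      exact_mod_cast h3
    -- The quadratic 2c - c² is 1 at c = 1 and nonpositive at every other natural number. Its sum
    -- over the indices is kg - g · collisions.
    have hle : ∀ i, 2 * (c i : ℝ) - (c i : ℝ) ^ 2 ≤ if i ∈ supp then 1 else 0 := by
      intro i
      split_ifs with hi
      · nlinarith [sq_nonneg ((c i : ℝ) - 1)]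
      · have h1 : c i ≠ 1 := fun h' => hi (hone i h')
        rcases Nat.eq_zero_or_pos (c i) with h0 | h0
        · simp [h0]
        · have : (2 : ℝ) ≤ c i := by exact_mod_cast (by omega : 2 ≤ c i)
          nlinarith
    have hsum := Finset.sum_le_sum fun i (_ : i ∈ Finset.univ) => hle i
    rw [Finset.sum_sub_distrib, ← Finset.mul_sum, hc1, hc2] at hsum
    have hcard : (∑ i, if i ∈ supp then (1 : ℝ) else 0) = supp.card := by simp
    rw [hcard] at hsum
    have hsum' : ((k * g : ℕ) : ℝ) - g * collisions blk S ≤ supp.card := by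
      push_cast; linarith
    refine le_trans (by linarith) (le_trans hsum' ?_)
    rw [hsupp]
  · have hK : (0 : ℝ) < (k * g : ℕ) := by exact_mod_cast Nat.mul_pos hk hg
    have h1 : ∀ i ∈ supp, 1 / ((k * g : ℕ) : ℝ) ≤ rotatedSpike W k S i ^ 2 := by
      intro i hi
      have h2 := hlow i (Finset.mem_filter.1 hi).2
      have h3 : (1 / Real.sqrt (k * g : ℕ)) ^ 2 ≤ |rotatedSpike W k S i| ^ 2 := by gcongr
      rwa [div_pow, one_pow, Real.sq_sqrt hK.le, sq_abs] at h3
    have h2 := Finset.card_nsmul_le_sum supp _ _ h1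
    have h3 : ∑ i ∈ supp, rotatedSpike W k S i ^ 2 ≤ 1 := by
      rw [← hnorm]
      exact Finset.sum_le_univ_sum_of_nonneg fun i => sq_nonneg _
    have h4 := h2.trans h3
    rw [nsmul_eq_mul, mul_one_div, div_le_one hK] at h4
    refine le_trans (le_of_eq ?_) (Nat.cast_le.1 h4)
    rw [hsupp]

/-- A uniform k-set contains two given points with probability k(k-1)/(N(N-1)) ≤ k²/N². The form
without division avoids the degenerate cases. -/
theorem card_filter_mem_mem_mul_le {N k : ℕ} {a b : Fin N} (hab : a ≠ b) :
    ((Finset.univ.powersetCard k).filter fun S : Finset (Fin N) => a ∈ S ∧ b ∈ S).card * N ^ 2 ≤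
      N.choose k * k ^ 2 := by
  classical
  rcases Nat.lt_or_ge k 2 with hk | hk
  · have : ((Finset.univ.powersetCard k).filter fun S : Finset (Fin N) => a ∈ S ∧ b ∈ S) = ∅ := by
      refine Finset.filter_eq_empty_iff.2 fun S hS => ?_
      rintro ⟨ha, hb⟩
      have h1 : ({a, b} : Finset (Fin N)) ⊆ S := by
        intro x hx; simp at hx; rcases hx with rfl | rfl <;> assumption
      have h2 := Finset.card_le_card h1
      rw [Finset.card_pair hab, (Finset.mem_powersetCard.1 hS).2] at h2
      omega
    rw [this]; simp
  obtain ⟨k, rfl⟩ := Nat.exists_eq_add_of_le' hk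
  have hN : 2 ≤ N := by
    have := a.isLt; have := b.isLt
    have := Fin.val_ne_of_ne hab; omega
  obtain ⟨N, rfl⟩ := Nat.exists_eq_add_of_le' hN
  have hX : ((Finset.univ.powersetCard (k + 2)).filter
      fun S : Finset (Fin (N + 2)) => a ∈ S ∧ b ∈ S).card ≤ N.choose k := by
    have h1 : (Finset.powersetCard k ((Finset.univ : Finset (Fin (N + 2))) \ {a, b})).card =
        N.choose k := by
      rw [Finset.card_powersetCard, Finset.card_sdiff_of_subset (Finset.subset_univ _),
        Finset.card_pair hab]
      simp
    rw [← h1]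
    refine Finset.card_le_card_of_injOn (fun S => S \ {a, b}) ?_ ?_
    · intro S hS
      obtain ⟨h2, h3, h4⟩ : S.card = k + 2 ∧ a ∈ S ∧ b ∈ S := by
        simpa [Finset.mem_powersetCard] using hS
      have h5 : ({a, b} : Finset (Fin (N + 2))) ⊆ S := by
        intro x hx; simp at hx; rcases hx with rfl | rfl <;> assumption
      refine Finset.mem_coe.2 (Finset.mem_powersetCard.2 ?_)
      refine ⟨Finset.sdiff_subset_sdiff (Finset.subset_univ _) le_rfl, ?_⟩
      rw [Finset.card_sdiff_of_subset h5, Finset.card_pair hab, h2]; rfl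
    · intro S hS T hT hST
      have hS' : {a, b} ⊆ S := by
        have : a ∈ S ∧ b ∈ S := (Finset.mem_filter.1 hS).2
        intro x hx; simp at hx; rcases hx with rfl | rfl; exacts [this.1, this.2]
      have hT' : {a, b} ⊆ T := by
        have : a ∈ T ∧ b ∈ T := (Finset.mem_filter.1 hT).2
        intro x hx; simp at hx; rcases hx with rfl | rfl; exacts [this.1, this.2]
      rw [← Finset.sdiff_union_of_subset hS', ← Finset.sdiff_union_of_subset hT']
      simp only at hST
      rw [hST]
  refine (Nat.mul_le_mul_right _ hX).trans ?_
  have h1 := Nat.add_one_mul_choose_eq N k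
  have h2 := Nat.add_one_mul_choose_eq (N + 1) (k + 1)
  by_cases hkN : k ≤ N
  · have h3 : N.choose k * ((N + 2) * (N + 1)) = (N + 2).choose (k + 2) * ((k + 2) * (k + 1)) := by
      calc N.choose k * ((N + 2) * (N + 1)) = (N + 1 + 1) * ((N + 1) * N.choose k) := by ring
        _ = _ := by rw [h1, ← mul_assoc, h2]; ring
    refine Nat.le_of_mul_le_mul_right (c := N + 1) ?_ (Nat.succ_pos N)
    calc N.choose k * (N + 2) ^ 2 * (N + 1) = N.choose k * ((N + 2) * (N + 1)) * (N + 2) := by ring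
      _ = (N + 2).choose (k + 2) * (k + 2) * ((k + 1) * (N + 2)) := by rw [h3]; ring
      -- After cancellation this is (k+1)(N+2) ≤ (k+2)(N+1), which is k ≤ N.
      _ ≤ (N + 2).choose (k + 2) * (k + 2) * ((k + 2) * (N + 1)) := by
          refine Nat.mul_le_mul_left _ ?_; nlinarith
      _ = _ := by ring
  · rw [Nat.choose_eq_zero_of_lt (by omega)]; simp

/-- Expected number of collisions: at most N g ordered pairs share a block, and each is contained in
S with probability at most k²/N². -/
theorem sum_collisions_mul_le {N Q g : ℕ} {blk : Fin N → Fin Q}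
    (h : ∀ q, (Finset.univ.filter fun i => blk i = q).card = g) (k : ℕ) :
    (∑ S ∈ (Finset.univ : Finset (Fin N)).powersetCard k, collisions blk S) * N ≤
      g * k ^ 2 * N.choose k := by
  classical
  rcases Nat.eq_zero_or_pos N with rfl | hN
  · simp
  have h1 : ∑ S ∈ (Finset.univ : Finset (Fin N)).powersetCard k, collisions blk S =
      ∑ a, ∑ b, if a ≠ b ∧ blk a = blk b then ((Finset.univ.powersetCard k).filter
        fun S : Finset (Fin N) => a ∈ S ∧ b ∈ S).card else 0 := by
    have : ∀ S : Finset (Fin N), collisions blk S =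
        ∑ a, ∑ b, if a ≠ b ∧ blk a = blk b then (if a ∈ S ∧ b ∈ S then 1 else 0) else 0 := by
      intro S
      have h2 : ∀ a, (∑ b, if a ≠ b ∧ blk a = blk b then (if a ∈ S ∧ b ∈ S then 1 else 0) else 0) =
          if a ∈ S then ∑ b, if b ∈ S then (if a ≠ b ∧ blk a = blk b then 1 else 0) else 0
            else 0 := by
        intro a
        split_ifs with ha
        · refine Finset.sum_congr rfl fun b _ => ?_
          by_cases hb : b ∈ S <;> simp [ha, hb]
        · simp [ha]
      rw [Finset.sum_congr rfl fun a _ => h2 a, Finset.sum_ite_mem, Finset.univ_inter]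
      simp only [Finset.sum_ite_mem, Finset.univ_inter]
      rfl
    simp_rw [this]
    rw [Finset.sum_comm]
    refine Finset.sum_congr rfl fun a _ => ?_
    rw [Finset.sum_comm]
    refine Finset.sum_congr rfl fun b _ => ?_
    split_ifs
    · rw [Finset.card_filter]
    · simp
  refine Nat.le_of_mul_le_mul_right (c := N) ?_ hN
  have h2 : ∀ a b : Fin N, (if a ≠ b ∧ blk a = blk b then ((Finset.univ.powersetCard k).filter
        fun S : Finset (Fin N) => a ∈ S ∧ b ∈ S).card else 0) * N ^ 2 ≤
      (if blk b = blk a then 1 else 0) * (N.choose k * k ^ 2) := by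
    intro a b
    by_cases hab : a ≠ b ∧ blk a = blk b
    · rw [if_pos hab, if_pos hab.2.symm, one_mul]
      exact card_filter_mem_mem_mul_le hab.1
    · rw [if_neg hab]; simp
  calc _ = ∑ a, ∑ b, (if a ≠ b ∧ blk a = blk b then ((Finset.univ.powersetCard k).filter
        fun S : Finset (Fin N) => a ∈ S ∧ b ∈ S).card else 0) * N ^ 2 := by
        rw [h1, mul_assoc, ← pow_two, Finset.sum_mul]
        simp_rw [Finset.sum_mul]
    _ ≤ ∑ a : Fin N, ∑ b, (if blk b = blk a then 1 else 0) * (N.choose k * k ^ 2) :=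
        Finset.sum_le_sum fun a _ => Finset.sum_le_sum fun b _ => h2 a b
    _ = ∑ a : Fin N, g * (N.choose k * k ^ 2) := by
        refine Finset.sum_congr rfl fun a _ => ?_
        rw [← Finset.sum_mul, ← Finset.card_filter, h]
    _ = _ := by simp; ring

end SparseSpike

/-! ### Random graphs from fair coins -/

namespace PlantedClique

instance (n : ℕ) : MeasurableSingletonClass (SimpleGraph (Fin n)) :=
  ⟨fun G => by
    have : {G} = (SimpleGraph.edgeSet (V := Fin n)) ⁻¹' {G.edgeSet} := by
      ext H; simp
    rw [this]
    exact SimpleGraph.measurableEmbedding_edgeSet.measurable (measurableSet_singleton _)⟩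

/-- The density `1 / 2`. -/
noncomputable abbrev half : unitInterval := ⟨1 / 2, by norm_num, by norm_num⟩

/-- The graph with adjacency between `a < b` given by the bit at `(e a, e b)`. -/
def bitGraph {n N : ℕ} (e : Fin n ↪o Fin N) (ξ : Fin N × Fin N → Bool) : SimpleGraph (Fin n) where
  Adj a b := (a < b ∧ ξ (e a, e b) = true) ∨ (b < a ∧ ξ (e b, e a) = true)
  symm := ⟨fun a b h => h.symm⟩
  loopless := ⟨fun a h => by rcases h with h | h <;> exact lt_irrefl _ h.1⟩

theorem bitGraph_adj_of_lt {n N : ℕ} (e : Fin n ↪o Fin N) (ξ : Fin N × Fin N → Bool) {a b : Fin n}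
    (h : a < b) : (bitGraph e ξ).Adj a b ↔ ξ (e a, e b) = true := by
  simp [bitGraph, h, h.not_gt]

theorem measure_ext_of_singleton_const {X : Type*} [Fintype X] [MeasurableSpace X]
    [MeasurableSingletonClass X] {μ ν : Measure X} [IsProbabilityMeasure μ]
    [IsProbabilityMeasure ν] {c d : ℝ≥0∞} (hμ : ∀ x, μ {x} = c) (hν : ∀ x, ν {x} = d) : μ = ν := by
  have h : ∀ (ρ : Measure X) [IsProbabilityMeasure ρ] (a : ℝ≥0∞), (∀ x, ρ {x} = a) →
      Fintype.card X * a = 1 := by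
    intro ρ _ a ha
    rw [← measure_univ (μ := ρ), ← Finset.coe_univ, ← sum_measure_singleton]
    simp [ha]
  have h1 := h μ c hμ
  have h2 := h ν d hν
  refine Measure.ext_of_singleton fun x => ?_
  rw [hμ, hν]
  have hc : (Fintype.card X : ℝ≥0∞) ≠ 0 := by intro h0; rw [h0, zero_mul] at h1; simp at h1
  rw [← ENNReal.mul_right_inj hc (ENNReal.natCast_ne_top _), h1, h2]

/-- Both laws give all graphs the same mass, so they coincide and the two constants need not be
compared. Bits at sites that carry no edge are ignored; they leave room for the coins of all other
sites. -/
theorem map_bitGraph {n N : ℕ} (e : Fin n ↪o Fin N) :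
    (fairCoins (Fin N × Fin N)).map (bitGraph e) = SimpleGraph.binomialRandom (Fin n) half := by
  classical
  have : IsProbabilityMeasure ((fairCoins (Fin N × Fin N)).map (bitGraph e)) :=
    Measure.isProbabilityMeasure_map Measurable.of_discrete.aemeasurable
  refine measure_ext_of_singleton_const
    (c := ∏ p : Fin N × Fin N, if ∃ a b, a < b ∧ p = (e a, e b) then 2⁻¹ else 1)
    (d := 2⁻¹ ^ (n.choose 2)) (fun G => ?_) fun G => ?_
  · rw [Measure.map_apply Measurable.of_discrete (measurableSet_singleton _)]
    set t : Fin N × Fin N → Set Bool := fun p =>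
      {c | ∀ a b, a < b → p = (e a, e b) → (c = true ↔ G.Adj a b)} with ht
    have hbox : bitGraph e ⁻¹' {G} = Set.univ.pi t := by
      ext ξ
      simp only [Set.mem_preimage, Set.mem_singleton_iff, Set.mem_pi, Set.mem_univ, true_imp_iff]
      constructor
      · rintro rfl p a b hab rfl
        rw [bitGraph_adj_of_lt e ξ hab]
      · intro h
        ext a b
        rcases lt_trichotomy a b with hab | rfl | hab
        · rw [bitGraph_adj_of_lt e ξ hab]
          exact h (e a, e b) a b hab rfl
        · simp
        · rw [SimpleGraph.adj_comm, bitGraph_adj_of_lt e ξ hab, G.adj_comm]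
          exact h (e b, e a) b a hab rfl
    rw [hbox, Measure.pi_pi]
    refine Finset.prod_congr rfl fun p _ => ?_
    split_ifs with hp
    · obtain ⟨a, b, hab, rfl⟩ := hp
      have : t (e a, e b) = {decide (G.Adj a b)} := by
        ext c
        simp only [ht, Set.mem_ofPred_eq, Set.mem_singleton_iff]
        constructor
        · intro h
          have := h a b hab rfl
          cases c <;> simp_all
        · rintro rfl a' b' _ h
          simp only [Prod.mk.injEq, EmbeddingLike.apply_eq_iff_eq] at h
          rw [h.1, h.2]; simp
      rw [this, fairCoin]
      by_cases hG : G.Adj a b <;> simp [hG]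
    · have : t p = Set.univ := by
        ext c
        simp only [ht, Set.mem_ofPred_eq, Set.mem_univ, iff_true]
        exact fun a b hab h => absurd ⟨a, b, hab, h⟩ hp
      rw [this, measure_univ]
  · rw [SimpleGraph.binomialRandom_singleton]
    have h1 : unitInterval.toNNReal half = 2⁻¹ := by
      refine NNReal.eq ?_
      change (1 / 2 : ℝ) = _
      simp
    have h2 : unitInterval.toNNReal (unitInterval.symm half) = 2⁻¹ := by
      refine NNReal.eq ?_
      change 1 - (1 / 2 : ℝ) = _
      norm_num
    have hle : G.edgeSet.ncard ≤ (Nat.card (Fin n)).choose 2 := by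
      rw [← SimpleGraph.coe_edgeFinset, Set.ncard_coe_finset, Nat.card_eq_fintype_card]
      exact SimpleGraph.card_edgeFinset_le_card_choose_two
    rw [h1, h2, ← pow_add, Nat.add_sub_cancel' hle, Nat.card_eq_fintype_card, Fintype.card_fin]
    simp

theorem lintegral_binomialRandom_half {n N : ℕ} (e : Fin n ↪o Fin N)
    (F : SimpleGraph (Fin n) → ℝ≥0∞) :
    ∫⁻ G, F G ∂(SimpleGraph.binomialRandom (Fin n) half) =
      ∫⁻ ξ, F (bitGraph e ξ) ∂(fairCoins (Fin N × Fin N)) := by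
  rw [← map_bitGraph e, lintegral_map Measurable.of_discrete Measurable.of_discrete]

theorem lintegral_plantedLaw {n : ℕ} (k : ℕ) (p : unitInterval) (F : SimpleGraph (Fin n) → ℝ≥0∞) :
    ∫⁻ G, F G ∂(plantedLaw n k p) = ((n.choose k : ℝ≥0∞))⁻¹ *
      ∑ S ∈ (Finset.univ : Finset (Fin n)).powersetCard k,
        ∫⁻ G, F (G ⊔ cliqueOn S) ∂(SimpleGraph.binomialRandom (Fin n) p) := by
  rw [plantedLaw, lintegral_smul_measure, lintegral_finsetSum_measure, smul_eq_mul]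
  congr 1
  refine Finset.sum_congr rfl fun S _ => ?_
  rw [lintegral_map Measurable.of_discrete Measurable.of_discrete]

end PlantedClique

/-! ### From bits to Gaussian matrices -/

namespace SparseSpike

open PlantedClique

/-- The law of a pair of independent normal variables with mean `l`. -/
noncomputable def gaussianPair (l : ℝ) : Measure (ℝ × ℝ) :=
  (gaussianReal l 1).prod (gaussianReal l 1)

instance (l : ℝ) : IsProbabilityMeasure (gaussianPair l) := by
  unfold gaussianPair; infer_instance

theorem prod_le_prod {X Y : Type*} [MeasurableSpace X] [MeasurableSpace Y] {μ μ' : Measure X}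
    {ν ν' : Measure Y} [SFinite ν] [SFinite ν'] (h : μ ≤ μ') (h' : ν ≤ ν') :
    μ.prod ν ≤ μ'.prod ν' := by
  rw [Measure.le_iff]
  intro s hs
  rw [Measure.prod_apply hs, Measure.prod_apply hs]
  exact lintegral_mono' h fun x => h' _

/-- A truncation of `gaussianPair l` that can be simulated with a fair coin from
`gaussianPair 0`. -/
theorem exists_truncation {l T : ℝ} (hl : 0 ≤ l) (hT : Real.exp (l * T) ^ 2 ≤ 3 / 2)
    {q : ℝ≥0∞} (hq : q = gaussianReal l 1 (Set.Iic T)) (hq2 : 3 / 4 ≤ q ^ 2) :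
    ∃ κ : Bool → Measure (ℝ × ℝ), (∀ b, IsProbabilityMeasure (κ b)) ∧
      (2⁻¹ : ℝ≥0∞) • κ false + (2⁻¹ : ℝ≥0∞) • κ true = gaussianPair 0 ∧
      κ true ≤ (q ^ 2)⁻¹ • gaussianPair l := by
  have hq0 : q ^ 2 ≠ 0 := by
    intro h; rw [h] at hq2; simp at hq2
  have hqt : q ^ 2 ≠ ∞ := by rw [hq]; exact ENNReal.pow_ne_top (measure_ne_top _ _)
  set R := (gaussianReal l 1).restrict (Set.Iic T) with hR
  set ν := (q ^ 2)⁻¹ • R.prod R with hν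
  have huniv : R.prod R Set.univ = q ^ 2 := by
    rw [← Set.univ_prod_univ, Measure.prod_prod, hR, Measure.restrict_apply_univ, ← hq, pow_two]
  have hprob : IsProbabilityMeasure ν :=
    ⟨by rw [hν, Measure.smul_apply, huniv, smul_eq_mul, ENNReal.inv_mul_cancel hq0 hqt]⟩
  -- The factor 2 is that of the fair coin: this bound makes twice the null law minus ν a measure,
  -- which becomes the law for the bit `false`.
  have h2 : ν ≤ (2 : ℝ≥0∞) • gaussianPair 0 := by
    have h3 : R.prod R ≤ ENNReal.ofReal (Real.exp (l * T) ^ 2) • gaussianPair 0 := by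
      have := gaussianReal_restrict_Iic_le (T := T) hl
      have hf : IsFiniteMeasure (ENNReal.ofReal (Real.exp (l * T)) • gaussianReal 0 1) :=
        Measure.smul_finite _ ENNReal.ofReal_ne_top
      refine (prod_le_prod this this).trans (le_of_eq ?_)
      rw [Measure.prod_smul_left, Measure.prod_smul_right, smul_smul,
        ← ENNReal.ofReal_mul (Real.exp_pos _).le, ← pow_two, gaussianPair]
    have h4 : (q ^ 2)⁻¹ * ENNReal.ofReal (Real.exp (l * T) ^ 2) ≤ 2 := by
      rw [mul_comm, ← div_eq_mul_inv]
      refine ENNReal.div_le_of_le_mul ?_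
      calc ENNReal.ofReal (Real.exp (l * T) ^ 2) ≤ ENNReal.ofReal (3 / 2) :=
            ENNReal.ofReal_le_ofReal hT
        _ = 2 * (3 / 4) := by
            rw [ENNReal.ofReal_div_of_pos (by norm_num)]
            have : (3 / 4 : ℝ≥0∞) = ENNReal.ofReal (3 / 4) := by
              rw [ENNReal.ofReal_div_of_pos (by norm_num)]; simp
            rw [this, show (2 : ℝ≥0∞) = ENNReal.ofReal 2 by simp,
              ← ENNReal.ofReal_mul (by norm_num),
              ← ENNReal.ofReal_div_of_pos (by norm_num)]
            norm_num
        _ ≤ _ := by gcongr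
    rw [Measure.le_iff] at h3 ⊢
    intro s hs
    simp only [hν, Measure.smul_apply, smul_eq_mul] at h3 ⊢
    calc _ ≤ (q ^ 2)⁻¹ * (ENNReal.ofReal (Real.exp (l * T) ^ 2) * gaussianPair 0 s) := by
          gcongr; exact h3 s hs
      _ ≤ _ := by rw [← mul_assoc]; gcongr
  have hf2 : IsFiniteMeasure ((2 : ℝ≥0∞) • gaussianPair 0) :=
    Measure.smul_finite _ (by simp)
  have hsub := Measure.sub_add_cancel_of_le h2
  -- The average of the two laws is the null law by construction, with no approximation under the
  -- null hypothesis.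
  refine ⟨fun b => if b then ν else (2 : ℝ≥0∞) • gaussianPair 0 - ν, ?_, ?_, ?_⟩
  · intro b
    cases b
    · refine ⟨?_⟩
      have := congrArg (fun m => m Set.univ) hsub
      simp only [Measure.add_apply, measure_univ, Measure.smul_apply, smul_eq_mul, mul_one] at this
      simp only [Bool.false_eq_true, if_false]
      have h5 : (2 : ℝ≥0∞) = 1 + 1 := by norm_num
      rw [h5] at this
      exact (ENNReal.add_left_inj ENNReal.one_ne_top).1 (by rw [h5]; exact this)
    · simpa using hprob
  · simp only [Bool.false_eq_true, if_false, if_true]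
    rw [← smul_add, hsub, smul_smul, ENNReal.inv_mul_cancel (by simp) (by simp), one_smul]
  · simp only [if_true, hν]
    rw [Measure.le_iff]
    intro s _
    simp only [Measure.smul_apply, smul_eq_mul]
    have hle : R.prod R ≤ gaussianPair l :=
      prod_le_prod Measure.restrict_le_self Measure.restrict_le_self
    gcongr

/-- The matrix with the entries `(p, q)` and `(q, p)`, `p ≤ q`, read off the pair at `(p, q)`. -/
def assemble {N : ℕ} (y : Fin N × Fin N → ℝ × ℝ) (p q : Fin N) : ℝ :=
  if p ≤ q then (y (p, q)).1 else (y (q, p)).2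

theorem measurable_assemble {N : ℕ} : Measurable (assemble (N := N)) := by
  rw [measurable_pi_iff]; intro p
  rw [measurable_pi_iff]; intro q
  unfold assemble
  split_ifs <;> fun_prop

/-- Every matrix entry reads its own coordinate of the pairs, so a box of matrices pulls back to a
box of pairs. Pairs below the diagonal and the second halves on the diagonal stay unread. -/
theorem map_assemble (N : ℕ) :
    (Measure.pi fun _ : Fin N × Fin N => gaussianPair 0).map assemble = gaussianMatrix N := by
  have h : Measure.pi (fun _ : Fin N × Fin N => gaussianReal 0 1) =
      (Measure.pi fun _ : Fin N × Fin N => gaussianPair 0).map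
        fun y p => assemble y p.1 p.2 := by
    have hm : Measurable fun (y : Fin N × Fin N → ℝ × ℝ) (p : Fin N × Fin N) =>
        assemble y p.1 p.2 := by
      rw [measurable_pi_iff]; intro p
      exact (measurable_pi_apply p.2).comp ((measurable_pi_apply p.1).comp measurable_assemble)
    refine Measure.pi_eq fun s hs => ?_
    rw [Measure.map_apply hm (MeasurableSet.univ_pi hs)]
    have hbox : (fun (y : Fin N × Fin N → ℝ × ℝ) (p : Fin N × Fin N) => assemble y p.1 p.2) ⁻¹'
        Set.univ.pi s = Set.univ.pi fun p => (if p.1 ≤ p.2 then s p else Set.univ) ×ˢ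
          (if p.1 < p.2 then s p.swap else Set.univ) := by
      ext y
      simp only [Set.mem_preimage, Set.mem_pi, Set.mem_univ, true_imp_iff, Set.mem_prod]
      constructor
      · intro h p
        refine ⟨?_, ?_⟩
        · split_ifs with hp
          · have := h p; rwa [assemble, if_pos hp] at this
          · trivial
        · split_ifs with hp
          · have := h p.swap
            rwa [assemble, if_neg (by simpa using hp)] at this
          · trivial
      · intro h p
        unfold assemble
        split_ifs with hp
        · have := (h p).1; rwa [if_pos hp] at this
        · have := (h p.swap).2
          rwa [if_pos (by simpa using hp)] at this
    rw [hbox, Measure.pi_pi]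
    have hone : ∀ p : Fin N × Fin N, gaussianPair 0 ((if p.1 ≤ p.2 then s p else Set.univ) ×ˢ
          (if p.1 < p.2 then s p.swap else Set.univ)) =
        (if p.1 ≤ p.2 then gaussianReal 0 1 (s p) else 1) *
          (if p.1 < p.2 then gaussianReal 0 1 (s p.swap) else 1) := by
      intro p
      rw [gaussianPair, Measure.prod_prod]
      congr 1 <;> split_ifs <;> simp
    simp_rw [hone]
    rw [Finset.prod_mul_distrib, ← (Equiv.prodComm (Fin N) (Fin N)).prod_comp
      (fun p : Fin N × Fin N => if p.1 < p.2 then gaussianReal 0 1 (s p.swap) else 1),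
      ← Finset.prod_mul_distrib]
    refine Finset.prod_congr rfl fun p _ => ?_
    by_cases hp : p.1 ≤ p.2
    · simp [hp]
    · simp [hp, not_le.1 hp]
  rw [gaussianMatrix_eq_map_pi, h, Measure.map_map (by fun_prop)]
  · rfl
  · rw [measurable_pi_iff]; intro p
    exact (measurable_pi_apply p.2).comp ((measurable_pi_apply p.1).comp measurable_assemble)

/-- Conjugation by `W`. -/
def conj {N : ℕ} (W : Matrix (Fin N) (Fin N) ℝ) (Z : Fin N → Fin N → ℝ) (i j : Fin N) : ℝ :=
  ∑ p, ∑ q, W i p * W j q * Z p q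

theorem measurable_conj {N : ℕ} (W : Matrix (Fin N) (Fin N) ℝ) : Measurable (conj W) := by
  unfold conj; fun_prop

open Classical in
/-- The pairs `p ≤ q` in `S`. -/
noncomputable def pairsIn {N : ℕ} (S : Finset (Fin N)) : Finset (Fin N × Fin N) :=
  (S ×ˢ S).filter fun p => p.1 ≤ p.2

theorem mem_pairsIn {N : ℕ} {S : Finset (Fin N)} {p : Fin N × Fin N} :
    p ∈ pairsIn S ↔ (p.1 ∈ S ∧ p.2 ∈ S) ∧ p.1 ≤ p.2 := by
  simp [pairsIn]

open Classical in
/-- The rotated planted law is a spiked Gaussian matrix. -/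
theorem map_conj_assemble_planted {N k : ℕ} {W : Matrix (Fin N) (Fin N) ℝ}
    (hW : W.transpose * W = 1) (hk : 0 < k) (l : ℝ) (S : Finset (Fin N)) :
    (Measure.pi fun p => if p ∈ pairsIn S then gaussianPair l else gaussianPair 0).map
      (fun y => conj W (assemble y)) =
      spiked (gaussianMatrix N) (l * k) (rotatedSpike W k S) := by
  have hshift : (gaussianPair 0).map (fun y => (y.1 + l, y.2 + l)) = gaussianPair l := by
    have h1 := gaussianReal_map_add_const (μ := 0) (v := 1) l
    rw [zero_add] at h1
    rw [gaussianPair, gaussianPair, ← h1, Measure.map_prod_map _ _ (by fun_prop) (by fun_prop)]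
    rfl
  -- Shifting both halves of the pairs p ≤ q inside S shifts all entries of S × S, the diagonal
  -- included.
  let sh : Fin N × Fin N → ℝ × ℝ → ℝ × ℝ := fun p y =>
    if p ∈ pairsIn S then (y.1 + l, y.2 + l) else y
  have hsh : ∀ p, Measurable (sh p) := fun p => by
    by_cases hp : p ∈ pairsIn S
    · simp only [sh, hp, if_true]; fun_prop
    · simp only [sh, hp, if_false]; fun_prop
  have hone : ∀ p, (gaussianPair 0).map (sh p) =
      if p ∈ pairsIn S then gaussianPair l else gaussianPair 0 := fun p => by
    by_cases hp : p ∈ pairsIn S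
    · simp only [sh, hp, if_true]; exact hshift
    · simp only [sh, hp, if_false]; exact Measure.map_id
  have hsf : ∀ p, SigmaFinite ((gaussianPair 0).map (sh p)) := fun p => by
    rw [hone p]; split_ifs <;> infer_instance
  have hm : Measurable fun y : Fin N × Fin N → ℝ × ℝ => fun p => sh p (y p) := by fun_prop
  have hca : Measurable fun y : Fin N × Fin N → ℝ × ℝ => conj W (assemble y) :=
    (measurable_conj W).comp measurable_assemble
  have hpi := Measure.pi_map_pi (μ := fun _ : Fin N × Fin N => gaussianPair 0) (f := sh)
    fun p => (hsh p).aemeasurable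
  simp_rw [hone] at hpi
  have hconj : (gaussianMatrix N).map (conj W) = gaussianMatrix N := gaussianMatrix_map_conj hW
  rw [← hpi, Measure.map_map hca hm, spiked]
  conv_rhs => rw [← hconj, ← map_assemble, Measure.map_map (measurable_conj W) measurable_assemble,
    Measure.map_map (by fun_prop) ((measurable_conj W).comp measurable_assemble)]
  congr 1
  funext y i j
  have hk0 : (0 : ℝ) < k := by exact_mod_cast hk
  have hentry : ∀ p q, assemble (fun p => sh p (y p)) p q =
      l * ((if p ∈ S then 1 else 0) * (if q ∈ S then 1 else 0)) + assemble y p q := by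
    intro p q
    unfold assemble
    by_cases hpq : p ≤ q
    · simp only [hpq, if_true, sh, mem_pairsIn, and_true]
      by_cases hp : p ∈ S <;> by_cases hq : q ∈ S <;> simp [hp, hq, add_comm]
    · have hqp : q ≤ p := (not_le.1 hpq).le
      simp only [hpq, if_false, sh, mem_pairsIn, hqp, and_true]
      by_cases hp : p ∈ S <;> by_cases hq : q ∈ S <;> simp [hp, hq, add_comm]
  change conj W (assemble fun p => sh p (y p)) i j =
    l * k * (rotatedSpike W k S i * rotatedSpike W k S j) + conj W (assemble y) i j
  simp only [conj, hentry, mul_add, Finset.sum_add_distrib]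
  congr 1
  have h1 : l * k * (rotatedSpike W k S i * rotatedSpike W k S j) =
      l * ((∑ p ∈ S, W i p) * ∑ q ∈ S, W j q) := by
    have h2 : Real.sqrt k * Real.sqrt k = k := Real.mul_self_sqrt hk0.le
    have h3 : Real.sqrt k ≠ 0 := (Real.sqrt_pos.2 hk0).ne'
    unfold rotatedSpike
    rw [div_mul_div_comm, h2]
    field_simp
  rw [h1, Finset.sum_mul_sum, Finset.mul_sum, ← Finset.sum_subset (Finset.subset_univ S)]
  · refine Finset.sum_congr rfl fun p hp => ?_
    rw [Finset.mul_sum, ← Finset.sum_subset (Finset.subset_univ S)]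
    · refine Finset.sum_congr rfl fun q hq => ?_
      simp only [hp, hq, if_true]; ring
    · intro q _ hq; simp [hq]
  · intro p _ hp; simp [hp]

end SparseSpike

/-! ### Fixing the randomness of the reduction -/

namespace SparseSpike

open PlantedClique

section Sites

variable {N : ℕ} (κ : Bool → Measure (ℝ × ℝ)) (B : Finset (Fin N))

open Classical in
/-- The law of the pair at the site `p`, given the bit `c` of an edge of the graph placed on `B`:
diagonal sites behave like edges to a vertex with neighbourhood `B`. -/
noncomputable def siteLaw (p : Fin N × Fin N) (c : Bool) : Measure (ℝ × ℝ) :=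
  if p.1 = p.2 then κ (decide (p.1 ∈ B))
  else if p.1 < p.2 ∧ p.1 ∈ B ∧ p.2 ∈ B then κ c else gaussianPair 0

open Classical in
/-- The average of `siteLaw` over a fair bit. -/
noncomputable def nullSite (p : Fin N × Fin N) : Measure (ℝ × ℝ) :=
  if p.1 = p.2 then κ (decide (p.1 ∈ B)) else gaussianPair 0

open Classical in
/-- The average of `siteLaw` with a clique planted on `S`. -/
noncomputable def plantedSite (S : Finset (Fin N)) (p : Fin N × Fin N) : Measure (ℝ × ℝ) :=
  if p ∈ pairsIn S then κ true else nullSite κ B p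

variable {κ} [hκ : ∀ b, IsProbabilityMeasure (κ b)]

instance (p : Fin N × Fin N) (c : Bool) : IsProbabilityMeasure (siteLaw κ B p c) := by
  unfold siteLaw; split_ifs <;> infer_instance

/-- The inclusion of the vertices of the graph placed on `B`. -/
noncomputable abbrev vertexEmb : Fin B.card ↪o Fin N := B.orderEmbOfFin rfl

open Classical in
/-- The bit of `G`, placed on `B`, at the site `p`. -/
noncomputable def adjBit (G : SimpleGraph (Fin B.card)) (p : Fin N × Fin N) : Bool :=
  decide ((G.map (vertexEmb B).toEmbedding).Adj p.1 p.2)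

theorem adjBit_vertexEmb (G : SimpleGraph (Fin B.card)) (a b : Fin B.card) :
    adjBit B G (vertexEmb B a, vertexEmb B b) = true ↔ G.Adj a b := by
  classical
  rw [adjBit, decide_eq_true_iff]
  exact SimpleGraph.map_adj_apply (f := (vertexEmb B).toEmbedding)

/-- Choose the pairs from a table according to the bits of `G`. -/
noncomputable def selectPairs (ω : (Fin N × Fin N) × Bool → ℝ × ℝ)
    (G : SimpleGraph (Fin B.card)) (p : Fin N × Fin N) : ℝ × ℝ := ω (p, adjBit B G p)

variable (κ) in
/-- The law of the table. -/
noncomputable def tableLaw : Measure ((Fin N × Fin N) × Bool → ℝ × ℝ) :=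
  Measure.pi fun x => siteLaw κ B x.1 x.2

instance : IsProbabilityMeasure (tableLaw κ B) := by unfold tableLaw; infer_instance

/-- For a fixed graph one coordinate of the table is read per site. The choice is injective, so the
selected pairs stay independent. -/
theorem lintegral_selectPairs {F : (Fin N × Fin N → ℝ × ℝ) → ℝ≥0∞} (hF : Measurable F)
    (G : SimpleGraph (Fin B.card)) :
    ∫⁻ ω, F (selectPairs B ω G) ∂(tableLaw κ B) =
      ∫⁻ y, F y ∂(Measure.pi fun p => siteLaw κ B p (adjBit B G p)) := by
  rw [← Measure.pi_map_comp_injective (fun x : (Fin N × Fin N) × Bool => siteLaw κ B x.1 x.2)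
    (g := fun p => (p, adjBit B G p)) fun p q h => (Prod.mk.inj h).1,
    lintegral_map hF (by fun_prop)]
  rfl

theorem exists_vertexEmb {p : Fin N × Fin N} (h : p.1 < p.2 ∧ p.1 ∈ B ∧ p.2 ∈ B) :
    ∃ a b, a < b ∧ p = (vertexEmb B a, vertexEmb B b) := by
  obtain ⟨h1, h2, h3⟩ := h
  rw [← Finset.mem_coe, ← Finset.range_orderEmbOfFin B rfl] at h2 h3
  obtain ⟨a, ha⟩ := h2
  obtain ⟨b, hb⟩ := h3
  refine ⟨a, b, ?_, Prod.ext ha.symm hb.symm⟩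
  rw [← ha, ← hb] at h1
  exact (vertexEmb B).lt_iff_lt.1 h1

/-- The edges are fair coins, so averaging over the graph mixes the two laws at each site inside B
into the standard pair, independently across sites. Only the diagonal still remembers B. -/
theorem lintegral_null_selectPairs (hfair : (2⁻¹ : ℝ≥0∞) • κ false + (2⁻¹ : ℝ≥0∞) • κ true =
    gaussianPair 0) {F : (Fin N × Fin N → ℝ × ℝ) → ℝ≥0∞} (hF : Measurable F) :
    ∫⁻ G, ∫⁻ ω, F (selectPairs B ω G) ∂(tableLaw κ B)
        ∂(SimpleGraph.binomialRandom (Fin B.card) half) =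
      ∫⁻ y, F y ∂(Measure.pi fun p => nullSite κ B p) := by
  have h1 : ∀ ξ, (fun p => siteLaw κ B p (adjBit B (bitGraph (vertexEmb B) ξ) p)) =
      fun p => siteLaw κ B p (ξ p) := by
    intro ξ
    funext p
    unfold siteLaw
    split_ifs with hp hp2 <;> try rfl
    obtain ⟨a, b, hab, rfl⟩ := exists_vertexEmb B hp2
    congr 1
    rw [Bool.eq_iff_iff, adjBit_vertexEmb, bitGraph_adj_of_lt _ _ hab]
  simp_rw [lintegral_selectPairs B hF]
  rw [lintegral_binomialRandom_half (vertexEmb B)]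
  simp_rw [h1]
  rw [lintegral_fairCoins_pi (fun p c => siteLaw κ B p c) hF]
  congr 2
  funext p
  unfold siteLaw nullSite
  split_ifs
  · rw [← add_smul, ENNReal.inv_two_add_inv_two, one_smul]
  · exact hfair
  · rw [← add_smul, ENNReal.inv_two_add_inv_two, one_smul]

/-- The clique sets to `true` all bits between distinct points of S, and the diagonal bits of S are
`true` because S lies in B. All other sites behave as in the null case. -/
theorem lintegral_planted_selectPairs (hfair : (2⁻¹ : ℝ≥0∞) • κ false + (2⁻¹ : ℝ≥0∞) • κ true =
    gaussianPair 0) {F : (Fin N × Fin N → ℝ × ℝ) → ℝ≥0∞} (hF : Measurable F)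
    (S : Finset (Fin B.card)) :
    ∫⁻ G, ∫⁻ ω, F (selectPairs B ω (G ⊔ cliqueOn S)) ∂(tableLaw κ B)
        ∂(SimpleGraph.binomialRandom (Fin B.card) half) =
      ∫⁻ y, F y ∂(Measure.pi fun p => plantedSite κ B (S.map (vertexEmb B).toEmbedding) p) := by
  classical
  set S' := S.map (vertexEmb B).toEmbedding with hS'
  have hSB : ∀ i ∈ S', i ∈ B := by
    intro i hi
    obtain ⟨a, _, rfl⟩ := Finset.mem_map.1 hi
    exact Finset.orderEmbOfFin_mem B rfl a
  have hmem : ∀ a, vertexEmb B a ∈ S' ↔ a ∈ S := fun a =>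
    Finset.mem_map' (vertexEmb B).toEmbedding
  have h1 : ∀ ξ, (fun p => siteLaw κ B p (adjBit B (bitGraph (vertexEmb B) ξ ⊔ cliqueOn S) p)) =
      fun p => if p ∈ pairsIn S' then κ true else siteLaw κ B p (ξ p) := by
    intro ξ
    funext p
    by_cases hd : p.1 = p.2
    · have : p ∈ pairsIn S' ↔ p.1 ∈ S' := by rw [mem_pairsIn, ← hd]; simp
      by_cases hp : p ∈ pairsIn S'
      · have h2 : p.2 ∈ B := hd ▸ hSB _ (this.1 hp)
        simp [siteLaw, hd, hp, h2]
      · simp [siteLaw, hd, hp]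
    by_cases hB : p.1 < p.2 ∧ p.1 ∈ B ∧ p.2 ∈ B
    · simp only [siteLaw, hd, if_false, hB, and_self, if_true]
      obtain ⟨a, b, hab, rfl⟩ := exists_vertexEmb B hB
      have hadj : adjBit B (bitGraph (vertexEmb B) ξ ⊔ cliqueOn S) (vertexEmb B a, vertexEmb B b) =
          (ξ (vertexEmb B a, vertexEmb B b) || decide (a ∈ S ∧ b ∈ S)) := by
        rw [Bool.eq_iff_iff, adjBit_vertexEmb, SimpleGraph.sup_adj, bitGraph_adj_of_lt _ _ hab]
        simp only [cliqueOn, SimpleGraph.fromRel_adj, Bool.or_eq_true, decide_eq_true_iff]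
        have := hab.ne
        tauto
      have hpair : (vertexEmb B a, vertexEmb B b) ∈ pairsIn S' ↔ a ∈ S ∧ b ∈ S := by
        rw [mem_pairsIn, hmem, hmem]
        exact and_iff_left hB.1.le
      rw [hadj]
      by_cases hc : a ∈ S ∧ b ∈ S
      · rw [if_pos (hpair.2 hc)]; simp [hc]
      · rw [if_neg fun h => hc (hpair.1 h)]; simp [hc]
    · have : p ∉ pairsIn S' := by
        rw [mem_pairsIn]
        rintro ⟨⟨h2, h3⟩, h4⟩
        exact hB ⟨lt_of_le_of_ne h4 hd, hSB _ h2, hSB _ h3⟩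
      simp only [siteLaw, hd, if_false, hB, this]
  simp_rw [lintegral_selectPairs B hF]
  rw [lintegral_binomialRandom_half (vertexEmb B)]
  simp_rw [h1]
  have : ∀ p b, IsFiniteMeasure (if p ∈ pairsIn S' then κ true else siteLaw κ B p b) := by
    intro p b; split_ifs <;> infer_instance
  rw [lintegral_fairCoins_pi (fun p c => if p ∈ pairsIn S' then κ true else siteLaw κ B p c) hF]
  congr 2
  funext p
  unfold plantedSite siteLaw nullSite
  split_ifs
  · rw [← add_smul, ENNReal.inv_two_add_inv_two, one_smul]
  · rw [← add_smul, ENNReal.inv_two_add_inv_two, one_smul]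
  · exact hfair
  · rw [← add_smul, ENNReal.inv_two_add_inv_two, one_smul]

theorem measurable_selectPairs (G : SimpleGraph (Fin B.card)) :
    Measurable fun ω => selectPairs B ω G := by
  unfold selectPairs; fun_prop

/-- Some fixed table is as good as a random one. -/
theorem exists_table (hfair : (2⁻¹ : ℝ≥0∞) • κ false + (2⁻¹ : ℝ≥0∞) • κ true = gaussianPair 0)
    {F₁ F₀ : (Fin N × Fin N → ℝ × ℝ) → ℝ≥0∞} (hF₁ : Measurable F₁) (hF₀ : Measurable F₀) (k : ℕ) :
    ∃ ω, ∫⁻ G, F₁ (selectPairs B ω G) ∂(SimpleGraph.binomialRandom (Fin B.card) half) +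
        ∫⁻ G, F₀ (selectPairs B ω G) ∂(plantedLaw B.card k half) ≤
      ∫⁻ y, F₁ y ∂(Measure.pi fun p => nullSite κ B p) +
        ((B.card.choose k : ℝ≥0∞))⁻¹ * ∑ S ∈ B.powersetCard k,
          ∫⁻ y, F₀ y ∂(Measure.pi fun p => plantedSite κ B S p) := by
  have hm : ∀ {F : (Fin N × Fin N → ℝ × ℝ) → ℝ≥0∞}, Measurable F →
      ∀ (T : SimpleGraph (Fin B.card) → SimpleGraph (Fin B.card)),
      Measurable fun x : SimpleGraph (Fin B.card) × ((Fin N × Fin N) × Bool → ℝ × ℝ) =>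
        F (selectPairs B x.2 (T x.1)) := fun hF T =>
    measurable_from_prod_countable_right fun G => hF.comp (measurable_selectPairs B (T G))
  have hm' : ∀ {F : (Fin N × Fin N → ℝ × ℝ) → ℝ≥0∞}, Measurable F →
      ∀ (T : SimpleGraph (Fin B.card) → SimpleGraph (Fin B.card)),
      Measurable fun ω => ∫⁻ G, F (selectPairs B ω (T G))
        ∂(SimpleGraph.binomialRandom (Fin B.card) half) := fun hF T =>
    Measurable.lintegral_prod_left (hm hF T)
  have hB : (Finset.univ : Finset (Fin B.card)).map (vertexEmb B).toEmbedding = B := by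
    simp
  have htot : ∫⁻ ω, (∫⁻ G, F₁ (selectPairs B ω G)
        ∂(SimpleGraph.binomialRandom (Fin B.card) half) +
        ∫⁻ G, F₀ (selectPairs B ω G) ∂(plantedLaw B.card k half)) ∂(tableLaw κ B) =
      ∫⁻ y, F₁ y ∂(Measure.pi fun p => nullSite κ B p) +
        ((B.card.choose k : ℝ≥0∞))⁻¹ * ∑ S ∈ B.powersetCard k,
          ∫⁻ y, F₀ y ∂(Measure.pi fun p => plantedSite κ B S p) := by
    have hm₁ : Measurable fun ω => ∫⁻ G, F₁ (selectPairs B ω G)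
        ∂(SimpleGraph.binomialRandom (Fin B.card) half) := hm' hF₁ id
    rw [lintegral_add_left hm₁]
    congr 1
    · refine Eq.trans ?_ (lintegral_null_selectPairs B hfair hF₁)
      exact (lintegral_lintegral_swap (hm hF₁ id).aemeasurable).symm
    · simp_rw [lintegral_plantedLaw]
      rw [lintegral_const_mul _ (Finset.measurable_fun_sum _ fun S _ => hm' hF₀ (· ⊔ cliqueOn S)),
        lintegral_finsetSum _ fun S _ => hm' hF₀ (· ⊔ cliqueOn S)]
      congr 1
      conv_rhs => rw [← hB]
      rw [Finset.powersetCard_map, Finset.sum_map]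
      refine Finset.sum_congr rfl fun S _ => ?_
      rw [hB]
      refine Eq.trans ?_ (lintegral_planted_selectPairs B hfair hF₀ S)
      exact (lintegral_lintegral_swap (hm hF₀ (· ⊔ cliqueOn S)).aemeasurable).symm
  -- `exists_le_lintegral` provides a table below the mean; when the mean is infinite, any table
  -- serves.
  by_cases htop : ∫⁻ ω, (∫⁻ G, F₁ (selectPairs B ω G)
        ∂(SimpleGraph.binomialRandom (Fin B.card) half) +
        ∫⁻ G, F₀ (selectPairs B ω G) ∂(plantedLaw B.card k half)) ∂(tableLaw κ B) = ∞
  · rw [← htot, htop]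
    exact ⟨0, le_top⟩
  · rw [← htot]
    exact exists_le_lintegral (by
      refine ((hm' hF₁ id).add ?_).aemeasurable
      simp_rw [lintegral_plantedLaw]
      exact (Finset.measurable_fun_sum _ fun S _ => hm' hF₀ (· ⊔ cliqueOn S)).const_mul _)

end Sites

end SparseSpike

/-! ### Averaging over the neighbourhood -/

namespace SparseSpike

open PlantedClique

/-- The set of vertices selected by the diagonal bits. -/
def diagSet {N : ℕ} (ξ : Fin N × Fin N → Bool) : Finset (Fin N) :=
  Finset.univ.filter fun i => ξ (i, i) = true

theorem mem_diagSet {N : ℕ} {ξ : Fin N × Fin N → Bool} {i : Fin N} :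
    i ∈ diagSet ξ ↔ ξ (i, i) = true := by simp [diagSet]

theorem nullSite_diagSet {N : ℕ} (κ : Bool → Measure (ℝ × ℝ)) (ξ : Fin N × Fin N → Bool)
    (p : Fin N × Fin N) :
    nullSite κ (diagSet ξ) p = if p.1 = p.2 then κ (ξ p) else gaussianPair 0 := by
  classical
  unfold nullSite
  split_ifs with hp
  · congr 1
    obtain ⟨i, j⟩ := p
    obtain rfl : i = j := hp
    rw [Bool.eq_iff_iff, decide_eq_true_iff, mem_diagSet]
  · rfl

section Average

variable {N : ℕ} {κ : Bool → Measure (ℝ × ℝ)} [hκ : ∀ b, IsProbabilityMeasure (κ b)]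
  {F : (Fin N × Fin N → ℝ × ℝ) → ℝ≥0∞}

/-- A uniformly random B makes the diagonal bits independent and fair, which removes the last trace
of the graph under the null hypothesis. -/
theorem lintegral_nullSite_diagSet (hfair : (2⁻¹ : ℝ≥0∞) • κ false + (2⁻¹ : ℝ≥0∞) • κ true =
    gaussianPair 0) (hF : Measurable F) :
    ∫⁻ ξ, ∫⁻ y, F y ∂(Measure.pi fun p => nullSite κ (diagSet ξ) p) ∂(fairCoins (Fin N × Fin N)) =
      ∫⁻ y, F y ∂(Measure.pi fun _ => gaussianPair 0) := by
  have : ∀ (p : Fin N × Fin N) b, IsFiniteMeasure (if p.1 = p.2 then κ b else gaussianPair 0) := by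
    intro p b; split_ifs <;> infer_instance
  simp_rw [nullSite_diagSet]
  rw [lintegral_fairCoins_pi (fun p c => if p.1 = p.2 then κ c else gaussianPair 0) hF]
  congr 2
  funext p
  split_ifs
  · exact hfair
  · rw [← add_smul, ENNReal.inv_two_add_inv_two, one_smul]

open Classical in
-- The event S ⊆ B fixes the diagonal bits of S, which costs 2^(-|S|); the remaining diagonal bits
-- are still fair and average out.
theorem lintegral_plantedSite_diagSet_le
    (hfair : (2⁻¹ : ℝ≥0∞) • κ false + (2⁻¹ : ℝ≥0∞) • κ true = gaussianPair 0) (hF : Measurable F)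
    (S : Finset (Fin N)) :
    ∫⁻ ξ, (if S ⊆ diagSet ξ then ∫⁻ y, F y ∂(Measure.pi fun p => plantedSite κ (diagSet ξ) S p)
        else 0) ∂(fairCoins (Fin N × Fin N)) ≤
      2⁻¹ ^ S.card * ∫⁻ y, F y ∂(Measure.pi fun p =>
        if p ∈ pairsIn S then κ true else gaussianPair 0) := by
  -- The zero measure at a diagonal site of S with bit `false` encodes the indicator of S ⊆ B as a
  -- product over sites, so the average can again be taken site by site.
  set τ : Fin N × Fin N → Bool → Measure (ℝ × ℝ) := fun p c =>
    if p ∈ pairsIn S then (if p.1 = p.2 then (if c then κ true else 0) else κ true)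
    else if p.1 = p.2 then κ c else gaussianPair 0 with hτ
  have hτf : ∀ p c, IsFiniteMeasure (τ p c) := by
    intro p c; simp only [hτ]; split_ifs <;> infer_instance
  have h1 : ∀ ξ, S ⊆ diagSet ξ →
      (fun p => plantedSite κ (diagSet ξ) S p) = fun p => τ p (ξ p) := by
    intro ξ hS
    funext p
    simp only [plantedSite, nullSite_diagSet, hτ]
    split_ifs with h2 h3 h4 <;> try rfl
    have h5 := mem_diagSet.1 (hS (mem_pairsIn.1 h2).1.1)
    obtain ⟨i, j⟩ := p
    obtain rfl : i = j := h3
    exact absurd h5 h4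
  have h2 : ∀ ξ, (if S ⊆ diagSet ξ then
      ∫⁻ y, F y ∂(Measure.pi fun p => plantedSite κ (diagSet ξ) S p) else 0) ≤
      ∫⁻ y, F y ∂(Measure.pi fun p => τ p (ξ p)) := by
    intro ξ
    split_ifs with hS
    · rw [h1 ξ hS]
    · exact zero_le
  refine (lintegral_mono h2).trans ?_
  rw [lintegral_fairCoins_pi τ hF]
  have h3 : (fun p => (2⁻¹ : ℝ≥0∞) • τ p false + (2⁻¹ : ℝ≥0∞) • τ p true) = fun p =>
      (if p ∈ pairsIn S ∧ p.1 = p.2 then (2⁻¹ : ℝ≥0∞) else 1) •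
        (if p ∈ pairsIn S then κ true else gaussianPair 0) := by
    funext p
    simp only [hτ]
    by_cases hp : p ∈ pairsIn S <;> by_cases hd : p.1 = p.2 <;> simp [hp, hd, hfair, ← add_smul,
      ENNReal.inv_two_add_inv_two]
  have hf1 : ∀ p, IsFiniteMeasure (if p ∈ pairsIn S then κ true else gaussianPair 0) := by
    intro p; split_ifs <;> infer_instance
  have hf2 : ∀ p : Fin N × Fin N,
      IsFiniteMeasure ((if p ∈ pairsIn S ∧ p.1 = p.2 then (2⁻¹ : ℝ≥0∞) else 1) •
        (if p ∈ pairsIn S then κ true else gaussianPair 0)) := by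
    intro p
    refine Measure.smul_finite _ ?_
    split_ifs <;> simp
  rw [h3, Measure.pi_smul_eq, lintegral_smul_measure, smul_eq_mul, Finset.prod_ite,
    Finset.prod_const, Finset.prod_const_one, mul_one]
  have hcard : (Finset.univ.filter fun p : Fin N × Fin N => p ∈ pairsIn S ∧ p.1 = p.2).card =
      S.card := by
    have himg : (Finset.univ.filter fun p : Fin N × Fin N => p ∈ pairsIn S ∧ p.1 = p.2) =
        S.image fun i => (i, i) := by
      ext ⟨i, j⟩
      simp only [Finset.mem_filter, Finset.mem_univ, true_and, mem_pairsIn, Finset.mem_image,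
        Prod.mk.injEq]
      constructor
      · rintro ⟨⟨⟨hi, _⟩, _⟩, rfl⟩
        exact ⟨i, hi, rfl, rfl⟩
      · rintro ⟨a, ha, rfl, rfl⟩
        exact ⟨⟨⟨ha, ha⟩, le_rfl⟩, rfl⟩
    rw [himg, Finset.card_image_of_injective _ fun i j h => (Prod.mk.inj h).1]
  rw [hcard]

open Classical in
-- Each of the at most |S|² planted pairs costs one factor c.
theorem lintegral_planted_le {l : ℝ} {c : ℝ≥0∞} (hc1 : 1 ≤ c) (hc : c ≠ ∞)
    (hle : κ true ≤ c • gaussianPair l) (S : Finset (Fin N)) :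
    ∫⁻ y, F y ∂(Measure.pi fun p => if p ∈ pairsIn S then κ true else gaussianPair 0) ≤
      c ^ (S.card ^ 2) * ∫⁻ y, F y ∂(Measure.pi fun p =>
        if p ∈ pairsIn S then gaussianPair l else gaussianPair 0) := by
  have hf0 : ∀ p, IsFiniteMeasure (if p ∈ pairsIn S then κ true else gaussianPair 0) := by
    intro p; split_ifs <;> infer_instance
  have hf1 : ∀ p, IsFiniteMeasure (if p ∈ pairsIn S then gaussianPair l else gaussianPair 0) := by
    intro p; split_ifs <;> infer_instance
  have hf2 : ∀ p : Fin N × Fin N, IsFiniteMeasure ((if p ∈ pairsIn S then c else 1) •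
        (if p ∈ pairsIn S then gaussianPair l else gaussianPair 0)) := by
    intro p
    refine Measure.smul_finite _ ?_
    split_ifs <;> simp [hc]
  have h1 : Measure.pi (fun p => if p ∈ pairsIn S then κ true else gaussianPair 0) ≤
      Measure.pi fun p => (if p ∈ pairsIn S then c else 1) •
        (if p ∈ pairsIn S then gaussianPair l else gaussianPair 0) := by
    refine Measure.pi_le_pi fun p => ?_
    split_ifs
    · exact hle
    · rw [one_smul]
  refine (lintegral_mono' h1 le_rfl).trans ?_
  rw [Measure.pi_smul_eq, lintegral_smul_measure, smul_eq_mul, Finset.prod_ite,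
    Finset.prod_const, Finset.prod_const_one, mul_one]
  refine mul_le_mul_left (pow_le_pow_right₀ hc1 ?_) _
  · rw [Finset.filter_mem_eq_inter, Finset.univ_inter, pow_two, ← Finset.card_product]
    exact Finset.card_filter_le _ _

end Average

open Classical in
/-- The proportion of sets that do not give a spike. -/
noncomputable def badFraction {N : ℕ} (W : Matrix (Fin N) (Fin N) ℝ) (k K : ℕ) : ℝ≥0∞ :=
  ((N.choose k : ℝ≥0∞))⁻¹ *
    ((Finset.univ.powersetCard k).filter fun S => rotatedSpike W k S ∉ spikes N K).card

/-- The matrix computed from a graph by the table `ω`. -/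
noncomputable def tableMatrix {N : ℕ} (W : Matrix (Fin N) (Fin N) ℝ) (B : Finset (Fin N))
    (ω : (Fin N × Fin N) × Bool → ℝ × ℝ) (G : SimpleGraph (Fin B.card)) : Fin N → Fin N → ℝ :=
  conj W (assemble (selectPairs B ω G))

open Classical in
/-- A test of spiked matrices gives a test of planted cliques. -/
theorem exists_tableMatrix {N k K b₀ : ℕ} {W : Matrix (Fin N) (Fin N) ℝ}
    (hW : W.transpose * W = 1) (hk : 0 < k) (hkN : k ≤ N)
    {κ : Bool → Measure (ℝ × ℝ)} (hκ : ∀ b, IsProbabilityMeasure (κ b))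
    (hfair : (2⁻¹ : ℝ≥0∞) • κ false + (2⁻¹ : ℝ≥0∞) • κ true = gaussianPair 0)
    {l : ℝ} {c : ℝ≥0∞} (hc1 : 1 ≤ c) (hc : c ≠ ∞) (hle : κ true ≤ c • gaussianPair l)
    {P : ℝ≥0∞} (hP : P = fairCoins (Fin N × Fin N) {ξ | b₀ ≤ (diagSet ξ).card}) (hP0 : P ≠ 0)
    {f₁ f₀ : (Fin N → Fin N → ℝ) → ℝ≥0∞} (hf₁ : Measurable f₁) (hf₀ : Measurable f₀)
    (hf₀1 : ∀ M, f₀ M ≤ 1) :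
    ∃ B : Finset (Fin N), b₀ ≤ B.card ∧ ∃ ω,
      P * (∫⁻ G, f₁ (tableMatrix W B ω G) ∂(SimpleGraph.binomialRandom (Fin B.card) half) +
        ∫⁻ G, f₀ (tableMatrix W B ω G) ∂(plantedLaw B.card k half)) ≤
      ∫⁻ M, f₁ M ∂(gaussianMatrix N) +
        ((b₀.choose k : ℝ≥0∞)⁻¹ * 2⁻¹ ^ k * N.choose k) * c ^ (k ^ 2) *
        ((⨆ v ∈ spikes N K, ∫⁻ M, f₀ M ∂(spiked (gaussianMatrix N) (l * k) v)) +
          badFraction W k K) := by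
  have hca : Measurable fun y : Fin N × Fin N → ℝ × ℝ => conj W (assemble y) :=
    (measurable_conj W).comp measurable_assemble
  set F₁ : (Fin N × Fin N → ℝ × ℝ) → ℝ≥0∞ := fun y => f₁ (conj W (assemble y)) with hF₁
  set F₀ : (Fin N × Fin N → ℝ × ℝ) → ℝ≥0∞ := fun y => f₀ (conj W (assemble y)) with hF₀
  have hF₁m : Measurable F₁ := hf₁.comp hca
  have hF₀m : Measurable F₀ := hf₀.comp hca
  set A₁ : Finset (Fin N) → ℝ≥0∞ := fun B => ∫⁻ y, F₁ y ∂(Measure.pi fun p => nullSite κ B p)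
    with hA₁
  set A₀ : Finset (Fin N) → Finset (Fin N) → ℝ≥0∞ := fun B S =>
    ∫⁻ y, F₀ y ∂(Measure.pi fun p => plantedSite κ B S p) with hA₀
  set I₀ := ⨆ v ∈ spikes N K, ∫⁻ M, f₀ M ∂(spiked (gaussianMatrix N) (l * k) v) with hI₀
  set w : (Fin N × Fin N → Bool) → ℝ≥0∞ := fun ξ => A₁ (diagSet ξ) +
    (((diagSet ξ).card.choose k : ℝ≥0∞))⁻¹ * ∑ S ∈ (diagSet ξ).powersetCard k, A₀ (diagSet ξ) S
    with hw
  -- Among the sets with at least b₀ elements, one does no worse than their conditional average;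
  -- this is the source of the factor P.
  obtain ⟨ξ, hξ, hwξ⟩ := exists_le_setLAverage (μ := fairCoins (Fin N × Fin N)) (f := w)
    (s := {ξ | b₀ ≤ (diagSet ξ).card}) (by rw [← hP]; exact hP0) (measure_ne_top _ _)
    Measurable.of_discrete.aemeasurable
  obtain ⟨ω, hω⟩ := exists_table (diagSet ξ) hfair hF₁m hF₀m k
  refine ⟨diagSet ξ, hξ, ω, ?_⟩
  refine (mul_le_mul_right (hω.trans hwξ) P).trans ?_
  rw [setLAverage_eq, ← hP, ENNReal.mul_div_cancel hP0 (by rw [hP]; exact measure_ne_top _ _)]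
  -- Both dependences on B are removed: the normalization is bounded through b₀, and the sum runs
  -- over all k-sets with an indicator. The average over B can then be taken for each S separately.
  have hstep : ∀ ξ, b₀ ≤ (diagSet ξ).card → w ξ ≤ A₁ (diagSet ξ) + (b₀.choose k : ℝ≥0∞)⁻¹ *
      ∑ S ∈ (Finset.univ : Finset (Fin N)).powersetCard k,
        if S ⊆ diagSet ξ then A₀ (diagSet ξ) S else 0 := by
    intro ξ hξ
    have h1 : ∑ S ∈ (diagSet ξ).powersetCard k, A₀ (diagSet ξ) S =
        ∑ S ∈ (Finset.univ : Finset (Fin N)).powersetCard k,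
          if S ⊆ diagSet ξ then A₀ (diagSet ξ) S else 0 := by
      rw [← Finset.sum_filter]
      refine Finset.sum_congr ?_ fun _ _ => rfl
      ext S
      simp only [Finset.mem_powersetCard, Finset.mem_filter, Finset.subset_univ, true_and]
      tauto
    simp only [hw]
    rw [h1]
    gcongr
  refine (setLIntegral_mono Measurable.of_discrete fun ξ hξ => hstep ξ hξ).trans ?_
  refine (setLIntegral_le_lintegral _ _).trans ?_
  rw [lintegral_add_left Measurable.of_discrete]
  refine add_le_add (le_of_eq ?_) ?_
  · rw [lintegral_nullSite_diagSet hfair hF₁m, ← map_assemble, hF₁]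
    have hconj : (gaussianMatrix N).map (conj W) = gaussianMatrix N := gaussianMatrix_map_conj hW
    rw [← map_assemble, Measure.map_map (measurable_conj W) measurable_assemble] at hconj
    rw [← hconj, lintegral_map hf₁ ((measurable_conj W).comp measurable_assemble)]
    rfl
  · rw [lintegral_const_mul _ Measurable.of_discrete,
      lintegral_finsetSum _ fun S _ => Measurable.of_discrete]
    have hone : ∀ S ∈ (Finset.univ : Finset (Fin N)).powersetCard k,
        ∫⁻ ξ, (if S ⊆ diagSet ξ then A₀ (diagSet ξ) S else 0) ∂(fairCoins (Fin N × Fin N)) ≤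
          2⁻¹ ^ k * c ^ (k ^ 2) * (I₀ + if rotatedSpike W k S ∉ spikes N K then 1 else 0) := by
      intro S hS
      have hSk : S.card = k := (Finset.mem_powersetCard.1 hS).2
      refine (lintegral_plantedSite_diagSet_le hfair hF₀m S).trans ?_
      rw [hSk, mul_assoc]
      gcongr
      refine (lintegral_planted_le hc1 hc hle S).trans ?_
      rw [hSk]
      gcongr
      have h2 := map_conj_assemble_planted hW hk l S
      have h3 : ∫⁻ y, F₀ y ∂(Measure.pi fun p =>
          if p ∈ pairsIn S then gaussianPair l else gaussianPair 0) =
          ∫⁻ M, f₀ M ∂(spiked (gaussianMatrix N) (l * k) (rotatedSpike W k S)) := by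
        rw [← h2, lintegral_map hf₀ hca]
      rw [h3]
      split_ifs with hbad
      · rw [add_zero]
        exact le_iSup₂ (f := fun v _ => ∫⁻ M, f₀ M ∂(spiked (gaussianMatrix N) (l * k) v))
          (rotatedSpike W k S) hbad
      · refine le_trans ?_ le_add_self
        have hadd : ∀ a : Fin N → Fin N → ℝ,
            Measurable fun (Z : Fin N → Fin N → ℝ) i j => a i j + Z i j := fun a => by fun_prop
        have : IsProbabilityMeasure (spiked (gaussianMatrix N) (l * k) (rotatedSpike W k S)) :=
          Measure.isProbabilityMeasure_map (hadd _).aemeasurable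
        exact (lintegral_mono hf₀1).trans (by simp)
    refine (mul_le_mul_right (Finset.sum_le_sum hone) _).trans (le_of_eq ?_)
    rw [← Finset.mul_sum, Finset.sum_add_distrib, Finset.sum_const, Finset.card_powersetCard,
      Finset.card_univ, Fintype.card_fin, nsmul_eq_mul, ← Finset.sum_filter, Finset.sum_const,
      nsmul_eq_mul, mul_one]
    have hN0 : (N.choose k : ℝ≥0∞) ≠ 0 := by
      exact_mod_cast (Nat.choose_pos hkN).ne'
    have h4 : (((Finset.univ.powersetCard k).filter
        fun S => rotatedSpike W k S ∉ spikes N K).card : ℝ≥0∞) =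
        N.choose k * badFraction W k K := by
      rw [badFraction, ← mul_assoc, ENNReal.mul_inv_cancel hN0 (ENNReal.natCast_ne_top _), one_mul]
    rw [h4, ← mul_add]
    ring

end SparseSpike

/-! ### The reduction as a program -/

namespace SparseSpike

open PlantedClique RealProgram

open Classical in
/-- A function of a graph that is affine in the entries of the adjacency matrix. -/
def IsAffine {n : ℕ} (f : SimpleGraph (Fin n) → ℝ) : Prop :=
  ∃ (d : ℝ) (c : Fin n → Fin n → ℝ), ∀ G : SimpleGraph (Fin n),
    f G = d + ∑ a, ∑ b, c a b * (if G.Adj a b then 1 else 0)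

section Affine

variable {n : ℕ}

theorem IsAffine.const (x : ℝ) : IsAffine fun _ : SimpleGraph (Fin n) => x :=
  ⟨x, 0, fun G => by simp⟩

theorem IsAffine.add {f g : SimpleGraph (Fin n) → ℝ} (hf : IsAffine f) (hg : IsAffine g) :
    IsAffine fun G => f G + g G := by
  obtain ⟨d, c, h⟩ := hf
  obtain ⟨d', c', h'⟩ := hg
  refine ⟨d + d', fun a b => c a b + c' a b, fun G => ?_⟩
  simp only [h, h', add_mul, Finset.sum_add_distrib]
  ring

theorem IsAffine.const_mul {f : SimpleGraph (Fin n) → ℝ} (hf : IsAffine f) (x : ℝ) :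
    IsAffine fun G => x * f G := by
  obtain ⟨d, c, h⟩ := hf
  refine ⟨x * d, fun a b => x * c a b, fun G => ?_⟩
  simp only [h, mul_add, Finset.mul_sum, mul_assoc]

theorem IsAffine.sum {ι : Type*} (s : Finset ι) {f : ι → SimpleGraph (Fin n) → ℝ}
    (hf : ∀ i ∈ s, IsAffine (f i)) : IsAffine fun G => ∑ i ∈ s, f i G := by
  classical
  induction s using Finset.induction_on with
  | empty => simpa using IsAffine.const 0
  | insert i s hi ih =>
    simp only [Finset.sum_insert hi]
    exact (hf i (by simp)).add (ih fun j hj => hf j (by simp [hj]))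

open Classical in
theorem IsAffine.adj (a b : Fin n) (x y : ℝ) :
    IsAffine fun G : SimpleGraph (Fin n) => if G.Adj a b then x else y := by
  refine ⟨y, fun a' b' => if a' = a ∧ b' = b then x - y else 0, fun G => ?_⟩
  rw [Finset.sum_eq_single a, Finset.sum_eq_single b]
  · by_cases h : G.Adj a b <;> simp [h]
  · intro b' _ hb; simp [hb]
  · simp
  · intro a' _ ha; simp [ha]
  · simp

/-- Any function of a single bit is affine in it, and sites outside the image of the vertices always
carry the bit `false`. -/
theorem isAffine_apply_adjBit {N : ℕ} (B : Finset (Fin N)) (u : Bool → ℝ) (p : Fin N × Fin N) :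
    IsAffine fun G => u (adjBit B G p) := by
  classical
  by_cases hp : ∃ a b, p = (vertexEmb B a, vertexEmb B b)
  · obtain ⟨a, b, rfl⟩ := hp
    have : (fun G => u (adjBit B G (vertexEmb B a, vertexEmb B b))) =
        fun G => if G.Adj a b then u true else u false := by
      funext G
      split_ifs with h
      · rw [(adjBit_vertexEmb B G a b).2 h]
      · rw [Bool.eq_false_iff.2 (mt (adjBit_vertexEmb B G a b).1 h)]
    rw [this]
    exact IsAffine.adj a b _ _
  · have : (fun G => u (adjBit B G p)) = fun _ => u false := by
      funext G
      congr 1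
      rw [adjBit, decide_eq_false_iff_not, SimpleGraph.map_adj]
      rintro ⟨a, b, _, ha, hb⟩
      exact hp ⟨a, b, Prod.ext ha.symm hb.symm⟩
    rw [this]
    exact IsAffine.const _

theorem isAffine_tableMatrix {N : ℕ} (W : Matrix (Fin N) (Fin N) ℝ) (B : Finset (Fin N))
    (ω : (Fin N × Fin N) × Bool → ℝ × ℝ) (i j : Fin N) :
    IsAffine fun G => tableMatrix W B ω G i j := by
  unfold tableMatrix conj
  refine IsAffine.sum _ fun p _ => IsAffine.sum _ fun q _ => IsAffine.const_mul ?_ _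
  unfold assemble selectPairs
  split_ifs
  · exact isAffine_apply_adjBit B (fun b => (ω ((p, q), b)).1) (p, q)
  · exact isAffine_apply_adjBit B (fun b => (ω ((q, p), b)).2) (q, p)

/-- The table and W enter only through the real constants of the program; no randomness is used at
run time. -/
theorem exists_prog_of_isAffine {N : ℕ} (hn : n ≤ N)
    {F : SimpleGraph (Fin n) → Fin N → Fin N → ℝ} (hF : ∀ i j, IsAffine fun G => F G i j) :
    ∃ P : Prog, P.size ≤ 4 + N * N * (4 + n * n * 3) ∧ P.steps ≤ 4 + N * N * (4 + n * n * 3) ∧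
      ∀ G, P.Maps (encodeGraph n G) (encodeMatrix N (F G)) := by
  classical
  choose d c h using hF
  simp only at h
  let d' : ℕ → ℝ := fun r => if hr : r < N * N then
    d (Fin.divNat ⟨r, hr⟩) (Fin.modNat ⟨r, hr⟩) else 0
  let c' : ℕ → ℕ → ℝ := fun r s => if hr : r < N * N then if hs : s < n * n then
    c (Fin.divNat ⟨r, hr⟩) (Fin.modNat ⟨r, hr⟩) (Fin.divNat ⟨s, hs⟩) (Fin.modNat ⟨s, hs⟩)
    else 0 else 0
  refine ⟨.affine c' d' (n * n) (N * N), Prog.size_affine_le _ _ _ _, Prog.steps_affine_le _ _ _ _,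
    fun G => ?_⟩
  have hL : n * n ≤ N * N := Nat.mul_le_mul hn hn
  have := Prog.maps_affine c' d' hL (m := encodeGraph n G)
    fun r hr => encodeMatrix_of_le _ (hL.trans hr)
  convert this using 1
  funext r
  unfold encodeMatrix
  split_ifs with hr
  · rw [h]
    simp only [d', hr, dite_true]
    congr 1
    rw [Finset.sum_range, ← finProdFinEquiv.sum_comp, Fintype.sum_prod_type]
    refine Finset.sum_congr rfl fun a _ => Finset.sum_congr rfl fun b _ => ?_
    have h1 := finProdFinEquiv.symm_apply_apply (a, b)
    rw [finProdFinEquiv_symm_apply] at h1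
    simp only [Prod.mk.injEq] at h1
    simp only [c', hr, dite_true, Fin.is_lt, Fin.eta, h1.1, h1.2, encodeGraph, encodeMatrix_apply]
  · rfl

end Affine

/-! ### Symmetrization -/

/-- The rescaled symmetric part. -/
noncomputable def symmPart {N : ℕ} (Z : Fin N → Fin N → ℝ) (i j : Fin N) : ℝ :=
  (1 / Real.sqrt 2) * (Z i j + Z j i)

theorem measurable_symmPart {N : ℕ} : Measurable (symmPart (N := N)) := by
  unfold symmPart; fun_prop

theorem isAffine_symmPart {n N : ℕ} {F : SimpleGraph (Fin n) → Fin N → Fin N → ℝ}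
    (hF : ∀ i j, IsAffine fun G => F G i j) (i j : Fin N) :
    IsAffine fun G => symmPart (F G) i j := ((hF i j).add (hF j i)).const_mul _

theorem gaussianPair_map_add :
    (gaussianPair 0).map (fun y => (1 / Real.sqrt 2) * (y.1 + y.2)) = gaussianReal 0 1 := by
  have h1 : (gaussianPair 0).map (fun y => y.1 + y.2) = gaussianReal 0 2 := by
    have := gaussianReal_conv_gaussianReal (m₁ := 0) (m₂ := 0) (v₁ := 1) (v₂ := 1)
    rw [add_zero, one_add_one_eq_two] at this
    exact this
  have h2 : (fun y : ℝ × ℝ => (1 / Real.sqrt 2) * (y.1 + y.2)) =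
      (fun x => (1 / Real.sqrt 2) * x) ∘ fun y => y.1 + y.2 := rfl
  rw [h2, ← Measure.map_map (by fun_prop) (by fun_prop), h1, gaussianReal_map_const_mul]
  congr 1
  · simp
  · ext; simp

/-- Normalized sums of independent pairs are standard normal off the diagonal, while a diagonal
entry becomes 2/√2 = √2 times itself. -/
theorem gaussianMatrix_map_symmPart (N : ℕ) : (gaussianMatrix N).map symmPart = goe N := by
  have hX : ∀ p : Fin N × Fin N, (gaussianPair 0).map (fun y : ℝ × ℝ =>
      if p.1 = p.2 then y.1 else (1 / Real.sqrt 2) * (y.1 + y.2)) = gaussianReal 0 1 := by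
    intro p
    split_ifs
    · exact Measure.fst_prod
    · exact gaussianPair_map_add
  have hXm : ∀ p : Fin N × Fin N, Measurable fun y : ℝ × ℝ =>
      if p.1 = p.2 then y.1 else (1 / Real.sqrt 2) * (y.1 + y.2) := by
    intro p; split_ifs <;> fun_prop
  have hsf : ∀ p : Fin N × Fin N, SigmaFinite ((gaussianPair 0).map fun y : ℝ × ℝ =>
      if p.1 = p.2 then y.1 else (1 / Real.sqrt 2) * (y.1 + y.2)) := fun p => by
    rw [hX]; infer_instance
  have hpi := Measure.pi_map_pi (μ := fun _ : Fin N × Fin N => gaussianPair 0)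
    (f := fun p y => if p.1 = p.2 then y.1 else (1 / Real.sqrt 2) * (y.1 + y.2))
    fun p => (hXm p).aemeasurable
  simp_rw [hX] at hpi
  have hm : Measurable fun (y : Fin N × Fin N → ℝ × ℝ) (p : Fin N × Fin N) =>
      if p.1 = p.2 then (y p).1 else (1 / Real.sqrt 2) * ((y p).1 + (y p).2) := by
    rw [measurable_pi_iff]; intro p
    exact (hXm p).comp (measurable_pi_apply p)
  -- `goe` reads the entries below the diagonal and the pairs are stored above it, hence a
  -- transposition first.
  rw [goe, ← gaussianMatrix_map_transpose, Measure.map_map (measurable_symmetrize N) (by fun_prop),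
    gaussianMatrix_map_transpose]
  conv_lhs => rw [← map_assemble, Measure.map_map measurable_symmPart measurable_assemble]
  conv_rhs => rw [gaussianMatrix_eq_map_pi, ← hpi, Measure.map_map
    ((measurable_symmetrize N).comp (by fun_prop)) (by fun_prop), Measure.map_map
    (((measurable_symmetrize N).comp (by fun_prop)).comp (by fun_prop)) hm]
  congr 1
  funext y i j
  have h2 : 1 / Real.sqrt 2 * 2 = Real.sqrt 2 := by
    rw [one_div_mul_eq_div, Real.div_sqrt]
  simp only [Function.comp, symmPart, assemble]
  rcases lt_trichotomy i j with hij | rfl | hij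
  · simp [hij.le, hij.ne, hij.not_ge, hij.not_gt]
  · simp only [le_refl, if_true]
    rw [← two_mul, ← mul_assoc, h2]
  · simp [hij.le, hij.ne, hij.ne', hij.not_ge, hij, add_comm]

/-- The spike is symmetric, so it is doubled and divided by √2, while the noise becomes GOE. -/
theorem spiked_map_symmPart {N : ℕ} (μ : ℝ) (v : Fin N → ℝ) :
    (spiked (gaussianMatrix N) (μ / 2) v).map symmPart = spiked (goe N) (μ / Real.sqrt 2) v := by
  have hadd : ∀ a : Fin N → Fin N → ℝ,
      Measurable fun (Z : Fin N → Fin N → ℝ) i j => a i j + Z i j := fun a => by fun_prop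
  rw [spiked, spiked, ← gaussianMatrix_map_symmPart, Measure.map_map measurable_symmPart (hadd _),
    Measure.map_map (hadd _) measurable_symmPart]
  congr 1
  funext Z i j
  simp only [Function.comp, symmPart]
  ring

end SparseSpike

/-! ### Estimates for fixed dimension -/

namespace SparseSpike

open PlantedClique RealProgram

/-- Markov's inequality: a bad set has at least k / log K collisions, and the mean number is at most
g k² / N. -/
theorem badFraction_le {N Q g k : ℕ} {blk : Fin N → Fin Q} {W : Matrix (Fin N) (Fin N) ℝ}
    (h : IsBlockHadamard g blk W) (hg : 0 < g) (hk : 0 < k) (hkN : k ≤ N) (hK : 1 < k * g) :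
    badFraction W k (k * g) ≤
      ENNReal.ofReal ((k * g : ℕ) * Real.log (k * g : ℕ) / N) := by
  classical
  set bad := (Finset.univ.powersetCard k).filter
    fun S : Finset (Fin N) => rotatedSpike W k S ∉ spikes N (k * g) with hbad
  have hl : 0 < Real.log (k * g : ℕ) := Real.log_pos (by exact_mod_cast hK)
  have hk0 : (0 : ℝ) < k := by exact_mod_cast hk
  have hg0 : (0 : ℝ) < g := by exact_mod_cast hg
  have hN0 : (0 : ℝ) < N := by exact_mod_cast hk.trans_le hkN
  have hC0 : (0 : ℝ) < N.choose k := by exact_mod_cast Nat.choose_pos hkN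
  have h1 : ∀ S ∈ bad, (k : ℝ) ≤ collisions blk S * Real.log (k * g : ℕ) := by
    intro S hS
    obtain ⟨h2, h3⟩ := Finset.mem_filter.1 hS
    by_contra! h4
    refine h3 (h.rotatedSpike_mem hg hk (Finset.mem_powersetCard.1 h2).2 ?_)
    rw [le_div_iff₀ hl]
    push_cast at h4 ⊢
    nlinarith
  have h2 : (bad.card : ℝ) * k ≤
      (∑ S ∈ (Finset.univ : Finset (Fin N)).powersetCard k, (collisions blk S : ℝ)) *
        Real.log (k * g : ℕ) := by
    rw [← nsmul_eq_mul, Finset.sum_mul]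
    refine (Finset.card_nsmul_le_sum bad _ _ h1).trans ?_
    exact Finset.sum_le_sum_of_subset_of_nonneg (Finset.filter_subset _ _)
      fun S _ _ => by positivity
  have h3 : (∑ S ∈ (Finset.univ : Finset (Fin N)).powersetCard k, (collisions blk S : ℝ)) * N ≤
      g * k ^ 2 * N.choose k := by
    exact_mod_cast sum_collisions_mul_le h.card_fiber k
  have h4 : (bad.card : ℝ) / N.choose k ≤ (k * g : ℕ) * Real.log (k * g : ℕ) / N := by
    rw [div_le_div_iff₀ hC0 hN0]
    refine le_of_mul_le_mul_right ?_ hk0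
    push_cast at h2 ⊢
    calc (bad.card : ℝ) * N * k = (bad.card * k) * N := by ring
      _ ≤ _ := mul_le_mul_of_nonneg_right h2 hN0.le
      _ = (∑ S ∈ (Finset.univ : Finset (Fin N)).powersetCard k, (collisions blk S : ℝ)) * N *
          Real.log (k * g) := by ring
      _ ≤ _ := mul_le_mul_of_nonneg_right h3 (by exact_mod_cast hl.le)
      _ = _ := by ring
  refine le_trans (le_of_eq ?_) (ENNReal.ofReal_le_ofReal h4)
  rw [badFraction, ENNReal.ofReal_div_of_pos hC0, ENNReal.ofReal_natCast, ENNReal.ofReal_natCast,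
    mul_comm, div_eq_mul_inv]

/-- Chebyshev for the size of B, with the variance of a coin bounded by 1. -/
theorem le_fairCoins_diagSet {N t : ℕ} (ht : 0 < t) :
    ENNReal.ofReal (1 - N / (t : ℝ) ^ 2) ≤
      fairCoins (Fin N × Fin N) {ξ | N / 2 - t ≤ (diagSet ξ).card} := by
  have ht0 : (0 : ℝ) < t := by exact_mod_cast ht
  let X : Bool → ℝ := fun b => if b then 1 else 0
  have hX : MemLp X 2 fairCoin :=
    MemLp.of_bound Measurable.of_discrete.aestronglyMeasurable 1
      (ae_of_all _ fun b => by cases b <;> simp [X])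
  have hint : ∀ f : Bool → ℝ, ∫ b, f b ∂fairCoin = (f false + f true) / 2 := by
    intro f
    have h1 : Integrable f ((2⁻¹ : ℝ≥0∞) • Measure.dirac false) :=
      (integrable_dirac (by simp)).smul_measure (by simp)
    have h2 : Integrable f ((2⁻¹ : ℝ≥0∞) • Measure.dirac true) :=
      (integrable_dirac (by simp)).smul_measure (by simp)
    rw [fairCoin, integral_add_measure h1 h2, integral_smul_measure, integral_smul_measure,
      integral_dirac, integral_dirac]
    simp
    ring
  have hvar : Var[X; fairCoin] ≤ 1 := by
    refine (variance_le_expectation_sq hX.aestronglyMeasurable).trans ?_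
    rw [hint]; simp [X]; norm_num
  have key := measure_pi_sum_ge_le (I := Fin N) fairCoin hX ht0
  rw [hint, Fintype.card_fin] at key
  have hmean : (X false + X true) / 2 = 1 / 2 := by simp [X]
  rw [hmean] at key
  have hle : (fairCoins (Fin N × Fin N)) {ξ | N / 2 - t ≤ (diagSet ξ).card}ᶜ ≤
      ENNReal.ofReal (N / (t : ℝ) ^ 2) := by
    have hmap := Measure.pi_map_comp_injective (fun _ : Fin N × Fin N => fairCoin)
      (g := fun i : Fin N => (i, i)) fun i j h => (Prod.mk.inj h).1
    have hsub : ({ξ : Fin N × Fin N → Bool | N / 2 - t ≤ (diagSet ξ).card}ᶜ : Set _) ⊆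
        (fun (ξ : Fin N × Fin N → Bool) i => ξ (i, i)) ⁻¹'
          {ω | (t : ℝ) ≤ |∑ i, X (ω i) - N * (1 / 2)|} := by
      intro ξ hξ
      have hξ' : (diagSet ξ).card < N / 2 - t := not_le.1 hξ
      have hsum : ∑ i, X (ξ (i, i)) = (diagSet ξ).card := by
        simp [X, diagSet]
      change (t : ℝ) ≤ |∑ i, X (ξ (i, i)) - N * (1 / 2)|
      have h1 : (diagSet ξ).card + t ≤ N / 2 := by omega
      have h2 : ((diagSet ξ).card : ℝ) + t ≤ N / 2 := by
        refine le_trans (by exact_mod_cast h1) (Nat.cast_div_le (m := N) (n := 2))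
      rw [hsum]
      refine le_trans ?_ (neg_le_abs _)
      linarith
    refine (measure_mono hsub).trans ?_
    rw [← Measure.map_apply Measurable.of_discrete (Set.toFinite _).measurableSet, hmap]
    refine key.trans (ENNReal.ofReal_le_ofReal ?_)
    gcongr
    exact mul_le_of_le_one_right (Nat.cast_nonneg _) hvar
  rw [prob_compl_eq_one_sub (Set.toFinite _).measurableSet, tsub_le_iff_right] at hle
  rw [ENNReal.ofReal_sub _ (by positivity), ENNReal.ofReal_one, tsub_le_iff_left]
  exact hle

/-- With b = N/2 - t, the ratio is at most (N / (2(b+1-k)))^k ≤ (1 - 2(t+k)/N)^(-k), and Bernoulli's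
inequality bounds this. So k-sets of B, weighted by the chance to lie in B, count almost like k-sets
of all N indices. -/
theorem choose_ratio_le {N t k : ℕ} (h : 2 * k * (t + k) < N) (hk : 0 < k) :
    (((N / 2 - t).choose k : ℕ) : ℝ≥0∞)⁻¹ * 2⁻¹ ^ k * N.choose k ≤
      ENNReal.ofReal (1 / (1 - 2 * k * (t + k) / N)) := by
  have h0 : 2 * (t + k) < N := lt_of_le_of_lt (by nlinarith) h
  have hb : k ≤ N / 2 - t := by omega
  set b := N / 2 - t with hbdef
  have hN0 : (0 : ℝ) < N := by exact_mod_cast (by omega : 0 < N)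
  have hf : (0 : ℝ) < k.factorial := by exact_mod_cast k.factorial_pos
  have hx0 : (0 : ℝ) < 1 - 2 * k * (t + k) / N := by
    rw [sub_pos, div_lt_one hN0]; exact_mod_cast h
  have h1 : (N.choose k : ℝ) ≤ (N : ℝ) ^ k / k.factorial := Nat.choose_le_pow_div k N
  have h2 : ((b + 1 - k : ℕ) : ℝ) ^ k / k.factorial ≤ (b.choose k : ℝ) := Nat.pow_le_choose k b
  have h3 : (N : ℝ) * (1 - 2 * (t + k) / N) ≤ 2 * ((b + 1 - k : ℕ) : ℝ) := by
    have : N ≤ 2 * (b + 1 - k) + 2 * (t + k) := by omega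
    have h4 : (N : ℝ) ≤ 2 * ((b + 1 - k : ℕ) : ℝ) + 2 * (t + k) := by exact_mod_cast this
    rw [mul_sub, mul_one, mul_div_cancel₀ _ hN0.ne']
    linarith
  have hx1 : 2 * ((t : ℝ) + k) / N ≤ 1 := by
    rw [div_le_one hN0]; exact_mod_cast h0.le
  have h5 : 1 - 2 * k * (t + k) / N ≤ (1 - 2 * ((t : ℝ) + k) / N) ^ k := by
    have := one_add_mul_le_pow (a := -(2 * ((t : ℝ) + k) / N)) (by linarith) k
    calc _ = 1 + (k : ℝ) * -(2 * ((t : ℝ) + k) / N) := by ring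
      _ ≤ _ := this
      _ = _ := by ring
  have h6 : (N.choose k : ℝ) * (1 - 2 * k * (t + k) / N) ≤ 2 ^ k * b.choose k := by
    calc _ ≤ (N : ℝ) ^ k / k.factorial * (1 - 2 * ((t : ℝ) + k) / N) ^ k := by gcongr
      _ = ((N : ℝ) * (1 - 2 * (t + k) / N)) ^ k / k.factorial := by rw [mul_pow]; ring
      _ ≤ (2 * ((b + 1 - k : ℕ) : ℝ)) ^ k / k.factorial := by
          gcongr
      _ = 2 ^ k * (((b + 1 - k : ℕ) : ℝ) ^ k / k.factorial) := by rw [mul_pow]; ring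
      _ ≤ _ := by gcongr
  have hbc : (0 : ℝ) < b.choose k := by exact_mod_cast Nat.choose_pos hb
  have h7 : ((b.choose k : ℝ))⁻¹ * 2⁻¹ ^ k * N.choose k ≤ 1 / (1 - 2 * k * (t + k) / N) := by
    rw [le_div_iff₀ hx0, inv_pow, ← mul_inv, mul_assoc, inv_mul_le_iff₀ (by positivity), mul_one,
      mul_comm (b.choose k : ℝ)]
    exact h6
  refine le_trans (le_of_eq ?_) (ENNReal.ofReal_le_ofReal h7)
  rw [ENNReal.ofReal_mul (by positivity), ENNReal.ofReal_mul (by positivity),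
    ENNReal.ofReal_inv_of_pos hbc, ENNReal.ofReal_natCast, ENNReal.ofReal_natCast,
    ENNReal.ofReal_pow (by norm_num), ENNReal.ofReal_inv_of_pos (by norm_num), ENNReal.ofReal_ofNat]

theorem one_sub_le_gaussianReal_Iic {l T : ℝ} (hl : l ≤ 1) :
    ENNReal.ofReal (1 - Real.exp (-T + 3 / 2)) ≤ gaussianReal l 1 (Set.Iic T) := by
  have h1 := gaussianReal_Ici_le l T 1
  have h2 : gaussianReal l 1 (Set.Iic T)ᶜ ≤ ENNReal.ofReal (Real.exp (-T + 3 / 2)) := by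
    refine (measure_mono ?_).trans (h1.trans (ENNReal.ofReal_le_ofReal (Real.exp_le_exp.2 ?_)))
    · intro x hx
      have hx' : ¬ x ≤ T := hx
      exact (not_le.1 hx').le
    · rw [NNReal.coe_one]; linarith
  rw [prob_compl_eq_one_sub measurableSet_Iic, tsub_le_iff_right] at h2
  rw [ENNReal.ofReal_sub _ (Real.exp_pos _).le, ENNReal.ofReal_one, tsub_le_iff_left]
  exact h2

/-- Bernoulli's inequality: truncating all k² pairs costs a factor close to 1 once the tail ε is
small compared with k^(-2). -/
theorem inv_pow_le_ofReal {q : ℝ≥0∞} {ε : ℝ} (hε : 0 ≤ ε) (k : ℕ) (hq : ENNReal.ofReal (1 - ε) ≤ q)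
    (h : 2 * (k : ℝ) ^ 2 * ε < 1) (hk : 0 < k) :
    ((q ^ 2)⁻¹) ^ (k ^ 2) ≤ ENNReal.ofReal (1 / (1 - 2 * (k : ℝ) ^ 2 * ε)) := by
  have hk1 : (1 : ℝ) ≤ k := by exact_mod_cast hk
  have hε1 : ε ≤ 1 := by
    nlinarith [mul_nonneg (sq_nonneg (k : ℝ)) hε,
      mul_le_mul_of_nonneg_right (one_le_pow₀ hk1 (n := 2)) hε]
  rw [← ENNReal.inv_pow, ← pow_mul, one_div, ENNReal.ofReal_inv_of_pos (by linarith)]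
  refine ENNReal.inv_le_inv.2 ?_
  calc ENNReal.ofReal (1 - 2 * (k : ℝ) ^ 2 * ε) ≤ ENNReal.ofReal ((1 - ε) ^ (2 * k ^ 2)) := by
        refine ENNReal.ofReal_le_ofReal ?_
        have := one_add_mul_le_pow (a := -ε) (by linarith) (2 * k ^ 2)
        push_cast at this
        calc _ = 1 + 2 * (k : ℝ) ^ 2 * -ε := by ring
          _ ≤ _ := this
          _ = _ := by ring
    _ = ENNReal.ofReal (1 - ε) ^ (2 * k ^ 2) := ENNReal.ofReal_pow (by linarith) _
    _ ≤ _ := by gcongr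

/-- The core inequality for fixed dimension with explicit error terms. -/
theorem exists_tableMatrix_le {N Q m k t : ℕ} (hN : N = Q * 2 ^ m) (hNpos : 0 < N) (hk : 0 < k)
    (hK : 1 < k * 2 ^ m) (ht : 0 < t) {ε T a b d e : ℝ}
    (ha : (N : ℝ) / t ^ 2 = a) (ha1 : a < 1)
    (hb : 2 * (k : ℝ) * (t + k) / N = b) (hb1 : b < 1)
    (hε : ε = Real.exp (-T + 3 / 2)) (hε4 : ε ≤ 1 / 8)
    (hd : 2 * (k : ℝ) ^ 2 * ε = d) (hd1 : d < 1)
    (he : (k * 2 ^ m : ℕ) * Real.log (k * 2 ^ m : ℕ) / N = e)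
    {l : ℝ} (hl0 : 0 ≤ l) (hl1 : l ≤ 1) (hT : Real.exp (l * T) ^ 2 ≤ 3 / 2)
    {f₁ f₀ : (Fin N → Fin N → ℝ) → ℝ≥0∞} (hf₁ : Measurable f₁) (hf₀ : Measurable f₀)
    (hf₀1 : ∀ M, f₀ M ≤ 1) :
    ∃ (W : Matrix (Fin N) (Fin N) ℝ) (B : Finset (Fin N)), N / 2 - t ≤ B.card ∧ ∃ ω,
      ∫⁻ G, f₁ (tableMatrix W B ω G) ∂(SimpleGraph.binomialRandom (Fin B.card) half) +
        ∫⁻ G, f₀ (tableMatrix W B ω G) ∂(plantedLaw B.card k half) ≤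
      ENNReal.ofReal (1 / (1 - a) * (1 / (1 - b) * (1 / (1 - d)))) *
        (∫⁻ M, f₁ M ∂(gaussianMatrix N) +
          (⨆ v ∈ spikes N (k * 2 ^ m), ∫⁻ M, f₀ M ∂(spiked (gaussianMatrix N) (l * k) v)) +
          ENNReal.ofReal e) := by
  have hN0 : (0 : ℝ) < N := by exact_mod_cast hNpos
  have hε0 : 0 ≤ ε := by rw [hε]; exact (Real.exp_pos _).le
  have hb' : 2 * k * (t + k) < N := by
    rw [← hb, div_lt_one hN0] at hb1; exact_mod_cast hb1
  have hkN : k ≤ N := by nlinarith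
  have hb0 : 0 ≤ b := by rw [← hb]; positivity
  have hd0 : 0 ≤ d := by rw [← hd]; positivity
  subst hN
  obtain ⟨blk, W, hW⟩ := exists_isBlockHadamard Q m
  set q := gaussianReal l 1 (Set.Iic T) with hq
  have hqε : ENNReal.ofReal (1 - ε) ≤ q := by
    rw [hε]; exact one_sub_le_gaussianReal_Iic hl1
  have hq2 : 3 / 4 ≤ q ^ 2 := by
    calc (3 / 4 : ℝ≥0∞) = ENNReal.ofReal (3 / 4) := by
          rw [ENNReal.ofReal_div_of_pos (by norm_num)]; simp
      _ ≤ ENNReal.ofReal ((1 - ε) ^ 2) := ENNReal.ofReal_le_ofReal (by nlinarith)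
      _ = ENNReal.ofReal (1 - ε) ^ 2 := ENNReal.ofReal_pow (by linarith) _
      _ ≤ _ := by gcongr
  obtain ⟨κ, hκ, hfair, hle⟩ := exists_truncation hl0 hT hq hq2
  have hq1 : q ≤ 1 := prob_le_one
  have hc1 : 1 ≤ (q ^ 2)⁻¹ := ENNReal.one_le_inv.2 (pow_le_one₀ zero_le hq1)
  have hc : (q ^ 2)⁻¹ ≠ ∞ := by
    intro h
    rw [ENNReal.inv_eq_top] at h
    rw [h] at hq2
    simp at hq2
  have hP := le_fairCoins_diagSet (N := Q * 2 ^ m) ht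
  rw [ha] at hP
  have hP0 : fairCoins (Fin (Q * 2 ^ m) × Fin (Q * 2 ^ m))
      {ξ | Q * 2 ^ m / 2 - t ≤ (diagSet ξ).card} ≠ 0 :=
    (lt_of_lt_of_le (ENNReal.ofReal_pos.2 (by linarith)) hP).ne'
  obtain ⟨B, hB, ω, hω⟩ := exists_tableMatrix (K := k * 2 ^ m) hW.orthogonal hk hkN hκ hfair hc1 hc
    hle rfl hP0 hf₁ hf₀ hf₀1
  refine ⟨W, B, hB, ω, ?_⟩
  have hr := choose_ratio_le hb' hk
  rw [hb] at hr
  have hcq := inv_pow_le_ofReal hε0 k hqε (by rw [hd]; exact hd1) hk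
  rw [hd] at hcq
  have hbad := badFraction_le hW (by positivity) hk hkN hK
  rw [he] at hbad
  set I₁ := ∫⁻ M, f₁ M ∂(gaussianMatrix (Q * 2 ^ m))
  set I₀ := ⨆ v ∈ spikes (Q * 2 ^ m) (k * 2 ^ m),
    ∫⁻ M, f₀ M ∂(spiked (gaussianMatrix (Q * 2 ^ m)) (l * k) v)
  set E := ∫⁻ G, f₁ (tableMatrix W B ω G) ∂(SimpleGraph.binomialRandom (Fin B.card) half) +
        ∫⁻ G, f₀ (tableMatrix W B ω G) ∂(plantedLaw B.card k half)
  set R := ENNReal.ofReal (1 / (1 - b) * (1 / (1 - d))) with hR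
  -- This allows the null term, which carries no loss, to be placed under the same factor as the
  -- planted term.
  have hR1 : 1 ≤ R := by
    rw [hR, ENNReal.one_le_ofReal, div_mul_div_comm, one_mul,
      one_le_div (mul_pos (by linarith) (by linarith))]
    nlinarith
  have h1 : ENNReal.ofReal (1 - a) * E ≤ R * (I₁ + I₀ + ENNReal.ofReal e) := by
    calc _ ≤ _ := mul_le_mul_left hP E
      _ ≤ _ := hω
      _ ≤ I₁ + ENNReal.ofReal (1 / (1 - b)) * ENNReal.ofReal (1 / (1 - d)) *
          (I₀ + ENNReal.ofReal e) := by gcongr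
      _ = I₁ + R * (I₀ + ENNReal.ofReal e) := by
          rw [← ENNReal.ofReal_mul (by rw [one_div_nonneg]; linarith)]
      _ ≤ R * I₁ + R * (I₀ + ENNReal.ofReal e) := by
          gcongr; exact le_mul_of_one_le_left zero_le hR1
      _ = _ := by ring
  have h2 : ENNReal.ofReal (1 / (1 - a)) * ENNReal.ofReal (1 - a) = 1 := by
    rw [← ENNReal.ofReal_mul (by rw [one_div_nonneg]; linarith), one_div,
      inv_mul_cancel₀ (by linarith), ENNReal.ofReal_one]
  rw [ENNReal.ofReal_mul (by rw [one_div_nonneg]; linarith), ← hR, mul_assoc]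
  calc E = ENNReal.ofReal (1 / (1 - a)) * (ENNReal.ofReal (1 - a) * E) := by
        rw [← mul_assoc, h2, one_mul]
    _ ≤ _ := by gcongr

end SparseSpike

/-! ### The planted clique conjecture along a subsequence -/

namespace PlantedClique

open RealProgram

/-- Off the subsequence the trivial program and k = 1 are inserted; they respect both hypotheses of
the conjecture. Restricting the conclusion to a subsequence can only raise the lower limit. -/
theorem Conjecture.one_le_liminf {p : unitInterval} (h : Conjecture p) {s : ℕ → ℕ}
    (hs : StrictMono s) {A : ℕ → Prog} (hA : PolyTime s A) {k : ℕ → ℕ} (hk : ∀ n, 0 < k n)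
    {ρ : ℝ} (hρ0 : 0 ≤ ρ) (hρ : ρ < 1 / 2) (hkρ : ∀ᶠ n in atTop, Real.logb (s n) (k n) ≤ ρ) :
    1 ≤ liminf (fun n => error (s n) (k n) p (A n)) atTop := by
  classical
  set A' : ℕ → Prog := Function.extend s A fun _ => .skip
  set k' : ℕ → ℕ := Function.extend s k fun _ => 1
  have hA' : ∀ n, A' (s n) = A n := hs.injective.extend_apply A _
  have hk' : ∀ n, k' (s n) = k n := hs.injective.extend_apply k _
  have hA'' : ∀ j, (¬ ∃ n, s n = j) → A' j = .skip := fun j => Function.extend_apply' A _ j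
  have hk'' : ∀ j, (¬ ∃ n, s n = j) → k' j = 1 := fun j => Function.extend_apply' k _ j
  obtain ⟨C, hC⟩ := hA
  have hpoly : PolyTime (fun n => n) A' := by
    refine ⟨C + 1, fun j => ?_⟩
    have h1 : C * (j + 1) ^ C ≤ (C + 1) * (j + 1) ^ (C + 1) :=
      Nat.mul_le_mul C.le_succ (Nat.pow_le_pow_right j.succ_pos C.le_succ)
    by_cases hj : ∃ n, s n = j
    · obtain ⟨n, rfl⟩ := hj
      rw [hA']
      exact ⟨(hC n).1.trans h1, (hC n).2.trans h1⟩
    · rw [hA'' j hj]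
      have : 1 ≤ (C + 1) * (j + 1) ^ (C + 1) := Nat.mul_pos C.succ_pos (by positivity)
      exact ⟨this, this⟩
  have hpos : ∀ j, 0 < k' j := by
    intro j
    by_cases hj : ∃ n, s n = j
    · obtain ⟨n, rfl⟩ := hj
      rw [hk']; exact hk n
    · rw [hk'' j hj]; exact one_pos
  have hlim : limsup (fun n : ℕ => ((Real.logb n (k' n) : ℝ) : EReal)) atTop <
      ((1 / 2 : ℝ) : EReal) := by
    refine lt_of_le_of_lt ?_ (EReal.coe_lt_coe_iff.2 hρ)
    obtain ⟨n₀, hn₀⟩ := eventually_atTop.1 hkρ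
    refine limsup_le_of_le (by isBoundedDefault) (eventually_atTop.2 ⟨s n₀, fun j hj => ?_⟩)
    rw [EReal.coe_le_coe_iff]
    by_cases hj' : ∃ n, s n = j
    · obtain ⟨n, rfl⟩ := hj'
      rw [hk']
      exact hn₀ n (hs.le_iff_le.1 hj)
    · rw [hk'' j hj']
      simpa using hρ0
  have key := h A' hpoly k' hpos hlim
  refine key.trans ?_
  have h1 : (fun n => error (s n) (k n) p (A n)) =
      (fun j => error j (k' j) p (A' j)) ∘ s := by
    funext n
    simp only [Function.comp_apply, hA', hk']
  rw [h1, Filter.liminf_comp]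
  exact liminf_le_liminf_of_le hs.tendsto_atTop

end PlantedClique

/-! ### The reduction from planted clique in the limit -/

/-- If q were infinitely often below some a < 1, then p would be infinitely often below a number
between a and 1. -/
theorem ENNReal.one_le_liminf_of_le {p q c e : ℕ → ℝ≥0∞} (hc : Tendsto c atTop (𝓝 1))
    (he : Tendsto e atTop (𝓝 0)) (h : ∀ᶠ n in atTop, p n ≤ c n * (q n + e n))
    (hp : 1 ≤ liminf p atTop) : 1 ≤ liminf q atTop := by
  by_contra! hq
  obtain ⟨a, ha, ha1⟩ := exists_between hq
  obtain ⟨a', ha', ha1'⟩ := exists_between ha1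
  have h1 : Tendsto (fun n => c n * (a + e n)) atTop (𝓝 (1 * (a + 0))) :=
    ENNReal.Tendsto.mul hc (by simp) (tendsto_const_nhds.add he) (by simp)
  rw [one_mul, add_zero] at h1
  have h2 : ∃ᶠ n in atTop, q n < a := frequently_lt_of_liminf_lt (by isBoundedDefault) ha
  have h3 : ∀ᶠ n in atTop, a' < p n :=
    eventually_lt_of_lt_liminf (lt_of_lt_of_le ha1' hp) (by isBoundedDefault)
  obtain ⟨n, hn2, hn3, hn1, hn⟩ :=
    (h2.and_eventually (h3.and ((h1.eventually_lt_const ha').and h))).exists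
  refine absurd hn3 (not_lt.2 ?_)
  calc p n ≤ c n * (q n + e n) := hn
    _ ≤ c n * (a + e n) := by gcongr
    _ ≤ a' := hn1.le

namespace SparseSpike

open PlantedClique RealProgram

theorem polyTime_seq_of_le {N s : ℕ → ℕ} (hNs : ∀ n, N n ≤ 8 * s n) {P φ : ℕ → Prog}
    (hP : ∀ n, (P n).size ≤ 4 + N n * N n * (4 + s n * s n * 3) ∧
      (P n).steps ≤ 4 + N n * N n * (4 + s n * s n * 3))
    (hφ : PolyTime N φ) : PolyTime s fun n => .seq (P n) (φ n) := by
  obtain ⟨C, hC⟩ := hφ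
  refine ⟨456 + C * 8 ^ C + C, fun n => ?_⟩
  have hy : 1 ≤ s n + 1 := Nat.le_add_left _ _
  have h1 : 4 + N n * N n * (4 + s n * s n * 3) + C * (N n + 1) ^ C ≤
      (456 + C * 8 ^ C + C) * (s n + 1) ^ (456 + C * 8 ^ C + C) := by
    set y := s n + 1 with hydef
    have hN1 : N n ≤ 8 * y := (hNs n).trans (by omega)
    have hN2 : N n + 1 ≤ 8 * y := by have := hNs n; omega
    have hsy : s n ≤ y := by omega
    have hy2 : 1 ≤ y ^ 2 := Nat.one_le_pow _ _ hy
    have hy4 : y ^ 2 ≤ y ^ 4 := Nat.pow_le_pow_right hy (by norm_num)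
    have e1 : N n * N n * (4 + s n * s n * 3) ≤ 448 * y ^ 4 := by
      calc _ ≤ 8 * y * (8 * y) * (4 + y * y * 3) := by gcongr
        _ = 256 * y ^ 2 + 192 * y ^ 4 := by ring
        _ ≤ _ := by omega
    have e2 : C * (N n + 1) ^ C ≤ C * 8 ^ C * y ^ C := by
      calc _ ≤ C * (8 * y) ^ C := by gcongr
        _ = _ := by rw [mul_pow, mul_assoc]
    have e3 : y ^ 4 ≤ y ^ (456 + C * 8 ^ C + C) := Nat.pow_le_pow_right hy (by omega)
    have e4 : y ^ C ≤ y ^ (456 + C * 8 ^ C + C) := Nat.pow_le_pow_right hy (by omega)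
    set Y := y ^ (456 + C * 8 ^ C + C)
    have e5 : C * 8 ^ C * y ^ C ≤ C * 8 ^ C * Y := Nat.mul_le_mul_left _ e4
    have e6 : 0 ≤ C * Y := Nat.zero_le _
    calc _ ≤ 4 * Y + 448 * Y + C * 8 ^ C * Y := by omega
      _ ≤ _ := by nlinarith
  exact ⟨(Nat.add_le_add (hP n).1 (hC n).1).trans h1, (Nat.add_le_add (hP n).2 (hC n).2).trans h1⟩

/-- The map `D n` is a preprocessing absorbed into the reduction, so that the argument covers both
models: it is the identity for the first and symmetrization for the second. -/
theorem one_le_liminf_of_conjecture (hpc : Conjecture half) {N Q m k t : ℕ → ℕ} {T l : ℕ → ℝ}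
    (hN : ∀ n, N n = Q n * 2 ^ m n) (hNpos : ∀ n, 0 < N n) (hgrow : ∀ n, 16 * N n ≤ N (n + 1))
    (hk : ∀ n, 0 < k n) (hK : ∀ᶠ n in atTop, 1 < k n * 2 ^ m n)
    (ht : ∀ᶠ n in atTop, 0 < t n) (htN : ∀ᶠ n in atTop, 4 * t n ≤ N n)
    {ρ : ℝ} (hρ0 : 0 ≤ ρ) (hρ : ρ < 1 / 2)
    (hkρ : ∀ᶠ n in atTop, Real.log (k n) ≤ ρ * Real.log (N n / 8))
    (ha : Tendsto (fun n => (N n : ℝ) / (t n : ℝ) ^ 2) atTop (𝓝 0))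
    (hb : Tendsto (fun n => 2 * (k n : ℝ) * (t n + k n) / N n) atTop (𝓝 0))
    (hd : Tendsto (fun n => 2 * (k n : ℝ) ^ 2 * Real.exp (-T n + 3 / 2)) atTop (𝓝 0))
    (he : Tendsto (fun n => (k n * 2 ^ m n : ℕ) * Real.log (k n * 2 ^ m n : ℕ) / N n) atTop (𝓝 0))
    (hl0 : ∀ n, 0 ≤ l n) (hl1 : ∀ n, l n ≤ 1) (hT : ∀ n, Real.exp (l n * T n) ^ 2 ≤ 3 / 2)
    {D : ∀ n, (Fin (N n) → Fin (N n) → ℝ) → Fin (N n) → Fin (N n) → ℝ}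
    (hD : ∀ n, Measurable (D n))
    (hDaff : ∀ n s, ∀ F : SimpleGraph (Fin s) → Fin (N n) → Fin (N n) → ℝ,
      (∀ i j, IsAffine fun G => F G i j) → ∀ i j, IsAffine fun G => D n (F G) i j)
    {φ : ℕ → Prog} (hφ : PolyTime N φ) :
    1 ≤ liminf (fun n => ∫⁻ M, (φ n).prOne (encodeMatrix (N n) (D n M)) ∂(gaussianMatrix (N n)) +
      ⨆ v ∈ spikes (N n) (k n * 2 ^ m n), ∫⁻ M, (φ n).prZero (encodeMatrix (N n) (D n M))
        ∂(spiked (gaussianMatrix (N n)) (l n * k n) v)) atTop := by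
  set a : ℕ → ℝ := fun n => (N n : ℝ) / (t n : ℝ) ^ 2
  set b : ℕ → ℝ := fun n => 2 * (k n : ℝ) * (t n + k n) / N n
  set d : ℕ → ℝ := fun n => 2 * (k n : ℝ) ^ 2 * Real.exp (-T n + 3 / 2)
  set e : ℕ → ℝ := fun n => (k n * 2 ^ m n : ℕ) * Real.log (k n * 2 ^ m n : ℕ) / N n
  set q : ℕ → ℝ≥0∞ := fun n =>
    ∫⁻ M, (φ n).prOne (encodeMatrix (N n) (D n M)) ∂(gaussianMatrix (N n)) +
      ⨆ v ∈ spikes (N n) (k n * 2 ^ m n), ∫⁻ M, (φ n).prZero (encodeMatrix (N n) (D n M))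
        ∂(spiked (gaussianMatrix (N n)) (l n * k n) v) with hq
  have hN16 : ∀ n, 16 ≤ N (n + 1) := fun n => by have := hgrow n; have := hNpos n; omega
  have hev : ∀ᶠ n in atTop, 16 ≤ N n :=
    eventually_atTop.2 ⟨1, fun n hn => by
      obtain ⟨j, rfl⟩ := Nat.exists_eq_add_of_le' hn; exact hN16 j⟩
  have hall := hK.and <| ht.and <| htN.and <| hkρ.and <| hev.and <|
    (ha.eventually_lt_const one_pos).and <| (hb.eventually_lt_const one_pos).and
      (hd.eventually_lt_const (show (0 : ℝ) < 1 / 8 by norm_num))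
  -- Dropping finitely many indices makes all estimates hold from the start, so that the sequence of
  -- graph sizes is strictly increasing throughout.
  obtain ⟨n₀, hn₀⟩ := eventually_atTop.1 hall
  have hstep : ∀ n, ∃ (s : ℕ) (P : Prog), N (n + n₀) ≤ 8 * s ∧ s ≤ N (n + n₀) ∧
      (P.size ≤ 4 + N (n + n₀) * N (n + n₀) * (4 + s * s * 3) ∧
        P.steps ≤ 4 + N (n + n₀) * N (n + n₀) * (4 + s * s * 3)) ∧
      PlantedClique.error s (k (n + n₀)) half (.seq P (φ (n + n₀))) ≤
        ENNReal.ofReal (1 / (1 - a (n + n₀)) * (1 / (1 - b (n + n₀)) * (1 / (1 - d (n + n₀))))) *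
          (q (n + n₀) + ENNReal.ofReal (e (n + n₀))) := by
    intro n
    obtain ⟨h1, h2, h3, -, h4, h5, h6, h7⟩ := hn₀ (n + n₀) (Nat.le_add_left _ _)
    generalize n + n₀ = j at *
    have hkj : (1 : ℝ) ≤ k j := by exact_mod_cast hk j
    have hε : Real.exp (-T j + 3 / 2) ≤ 1 / 8 := by
      refine le_trans ?_ h7.le
      exact le_mul_of_one_le_left (Real.exp_pos _).le (by nlinarith)
    obtain ⟨W, B, hB, ω, hle⟩ := exists_tableMatrix_le (hN j) (hNpos j) (hk j) h1 h2 (a := a j)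
      (b := b j) (d := d j) (e := e j) rfl h5 rfl h6 rfl hε rfl (h7.trans (by norm_num)) rfl
      (hl0 j) (hl1 j) (hT j)
      (f₁ := fun M => (φ j).prOne (encodeMatrix (N j) (D j M)))
      (f₀ := fun M => (φ j).prZero (encodeMatrix (N j) (D j M)))
      ((φ j).measurable_prOne.comp ((measurable_encodeMatrix _).comp (hD j)))
      ((φ j).measurable_prZero.comp ((measurable_encodeMatrix _).comp (hD j)))
      (fun M => (φ j).prZero_le_one _)
    have hBN : B.card ≤ N j := by simpa using B.card_le_univ
    obtain ⟨P, hP1, hP2, hP⟩ := exists_prog_of_isAffine hBN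
      (hDaff j B.card (tableMatrix W B ω) (isAffine_tableMatrix W B ω))
    refine ⟨B.card, P, by omega, hBN, ⟨hP1, hP2⟩, ?_⟩
    unfold PlantedClique.error
    simp only [(hP _).prOne_seq, (hP _).prZero_seq]
    exact hle
  choose s P hs1 hs2 hPs hle using hstep
  -- Graph sizes lie between N/8 and N, so growth of N by a factor 16 separates consecutive ones.
  have hmono : StrictMono s := by
    refine strictMono_nat_of_lt_succ fun n => ?_
    have h1 := hs2 n
    have h2 := hs1 (n + 1)
    have h3 := hgrow (n + n₀)
    have h4 := hNpos (n + n₀)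
    rw [show n + 1 + n₀ = n + n₀ + 1 by ring] at h2
    omega
  have hφ' : PolyTime (fun n => N (n + n₀)) fun n => φ (n + n₀) := by
    obtain ⟨C, hC⟩ := hφ
    exact ⟨C, fun n => hC _⟩
  have hpcs := hpc.one_le_liminf hmono (polyTime_seq_of_le hs1 hPs hφ')
    (k := fun n => k (n + n₀)) (fun n => hk _) hρ0 hρ (Eventually.of_forall fun n => by
      obtain ⟨-, -, -, h4, h5, -⟩ := hn₀ (n + n₀) (Nat.le_add_left _ _)
      have h16 : (16 : ℝ) ≤ N (n + n₀) := by exact_mod_cast h5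
      have h8 : (N (n + n₀) : ℝ) ≤ 8 * s n := by exact_mod_cast hs1 n
      rw [Real.logb, div_le_iff₀ (Real.log_pos (by linarith))]
      refine h4.trans (mul_le_mul_of_nonneg_left (Real.log_le_log ?_ ?_) hρ0) <;> linarith)
  have hc : Tendsto (fun n => 1 / (1 - a n) * (1 / (1 - b n) * (1 / (1 - d n)))) atTop (𝓝 1) := by
    have h1 : ∀ {x : ℕ → ℝ}, Tendsto x atTop (𝓝 0) →
        Tendsto (fun n => 1 / (1 - x n)) atTop (𝓝 1) := fun {x} hx => by
      simpa [one_div] using (hx.const_sub 1).inv₀ (by norm_num)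
    simpa using (h1 ha).mul ((h1 hb).mul (h1 hd))
  have hc' := ENNReal.tendsto_ofReal hc
  have he' := ENNReal.tendsto_ofReal he
  rw [ENNReal.ofReal_one] at hc'
  rw [ENNReal.ofReal_zero] at he'
  have hsh := tendsto_add_atTop_nat n₀
  rw [← liminf_nat_add q n₀]
  exact ENNReal.one_le_liminf_of_le (hc'.comp hsh) (he'.comp hsh) (Eventually.of_forall hle) hpcs

end SparseSpike

/-! ### Choice of the hard instances -/

namespace SparseSpike

open PlantedClique RealProgram

theorem two_pow_floor_le {c : ℝ} (hc : 0 ≤ c) (n : ℕ) :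
    (2 : ℝ) ^ ⌊c * (4 * n)⌋₊ ≤ ((16 : ℝ) ^ n) ^ c := by
  have h1 : ((16 : ℝ) ^ n) ^ c = (2 : ℝ) ^ (c * (4 * n)) := by
    rw [show (16 : ℝ) = 2 ^ 4 by norm_num, ← pow_mul, ← Real.rpow_natCast,
      ← Real.rpow_mul (by norm_num)]
    push_cast
    ring_nf
  rw [h1, ← Real.rpow_natCast]
  exact Real.rpow_le_rpow_of_exponent_le (by norm_num) (Nat.floor_le (by positivity))

theorem tendsto_floor_div {c : ℝ} (hc : 0 ≤ c) :
    Tendsto (fun n : ℕ => (⌊c * (4 * n)⌋₊ : ℝ) / (4 * n)) atTop (𝓝 c) :=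
  (tendsto_nat_floor_mul_div_atTop hc).comp
    (tendsto_natCast_atTop_atTop.const_mul_atTop (by norm_num))

theorem log_sixteen_pow (n : ℕ) : Real.log ((16 : ℝ) ^ n) = 4 * n * Real.log 2 := by
  rw [Real.log_pow, show (16 : ℝ) = 2 ^ 4 by norm_num, Real.log_pow]
  push_cast
  ring

theorem tendsto_sixteen_pow : Tendsto (fun n : ℕ => (16 : ℝ) ^ n) atTop atTop :=
  tendsto_pow_atTop_atTop_of_one_lt (by norm_num)

theorem half_le_floor {x : ℝ} (hx : 1 ≤ x) : x / 2 ≤ ⌊x⌋₊ := by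
  have h1 := Nat.lt_floor_add_one x
  have h2 : (1 : ℝ) ≤ ⌊x⌋₊ := by exact_mod_cast Nat.one_le_floor_iff _ |>.2 hx
  linarith

theorem tendsto_div_floor_sq {η : ℝ} (hη : 1 / 2 < η) :
    Tendsto (fun n : ℕ => (16 : ℝ) ^ n / (⌊((16 : ℝ) ^ n) ^ η⌋₊ : ℝ) ^ 2) atTop (𝓝 0) := by
  have h1 := ((tendsto_rpow_neg_atTop (y := 2 * η - 1) (by linarith)).comp
    tendsto_sixteen_pow).const_mul 4
  rw [mul_zero] at h1
  refine squeeze_zero (fun n => by positivity) (fun n => ?_) h1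
  have hx : (1 : ℝ) ≤ 16 ^ n := one_le_pow₀ (by norm_num)
  simp only [Function.comp_apply]
  set x : ℝ := 16 ^ n
  have hx0 : 0 < x := by linarith
  have h2 := half_le_floor (Real.one_le_rpow hx (by linarith : 0 ≤ η))
  have h3 : 0 < x ^ η := Real.rpow_pos_of_pos hx0 _
  calc x / (⌊x ^ η⌋₊ : ℝ) ^ 2 ≤ x / (x ^ η / 2) ^ 2 := by gcongr
    _ = 4 * (x ^ (1 : ℝ) / (x ^ η * x ^ η)) := by rw [Real.rpow_one]; field_simp; norm_num
    _ = _ := by rw [← Real.rpow_add hx0, ← Real.rpow_sub hx0]; ring_nf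

theorem tendsto_clique_mul_div {κ η : ℝ} (hκ0 : 0 ≤ κ) (hκ : κ < 1 / 2) (hη : κ + η < 1) :
    Tendsto (fun n : ℕ => 2 * (2 : ℝ) ^ ⌊κ * (4 * n)⌋₊ *
      (⌊((16 : ℝ) ^ n) ^ η⌋₊ + (2 : ℝ) ^ ⌊κ * (4 * n)⌋₊) / 16 ^ n) atTop (𝓝 0) := by
  have h1 := ((tendsto_rpow_neg_atTop (y := 1 - (κ + η)) (by linarith)).comp
    tendsto_sixteen_pow).const_mul 2
  have h2 := ((tendsto_rpow_neg_atTop (y := 1 - (κ + κ)) (by linarith)).comp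
    tendsto_sixteen_pow).const_mul 2
  have h3 := h1.add h2
  rw [mul_zero, add_zero] at h3
  refine squeeze_zero (fun n => by positivity) (fun n => ?_) h3
  have h4 := two_pow_floor_le hκ0 n
  have hx0 : (0 : ℝ) < 16 ^ n := by positivity
  simp only [Function.comp_apply]
  set x : ℝ := 16 ^ n
  have h5 : (⌊x ^ η⌋₊ : ℝ) ≤ x ^ η := Nat.floor_le (by positivity)
  calc _ ≤ 2 * x ^ κ * (x ^ η + x ^ κ) / x := by gcongr
    _ = 2 * (x ^ κ * x ^ η / x ^ (1 : ℝ)) + 2 * (x ^ κ * x ^ κ / x ^ (1 : ℝ)) := by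
        rw [Real.rpow_one]; ring
    _ = _ := by
        rw [← Real.rpow_add hx0, ← Real.rpow_add hx0, ← Real.rpow_sub hx0, ← Real.rpow_sub hx0,
          neg_sub, neg_sub]

theorem eventually_four_mul_floor_le {η : ℝ} (hη : η < 1) :
    ∀ᶠ n : ℕ in atTop, 4 * ⌊((16 : ℝ) ^ n) ^ η⌋₊ ≤ 16 ^ n := by
  have h1 := (tendsto_rpow_neg_atTop (y := 1 - η) (by linarith)).comp tendsto_sixteen_pow
  filter_upwards [h1.eventually_le_const (show (0 : ℝ) < 1 / 4 by norm_num)] with n hn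
  have hx0 : (0 : ℝ) < 16 ^ n := by positivity
  simp only [Function.comp_apply] at hn
  suffices h : (4 : ℝ) * ⌊((16 : ℝ) ^ n) ^ η⌋₊ ≤ 16 ^ n by exact_mod_cast h
  set x : ℝ := 16 ^ n
  have h5 : (⌊x ^ η⌋₊ : ℝ) ≤ x ^ η := Nat.floor_le (by positivity)
  have h6 : x ^ η = x ^ (-(1 - η)) * x := by
    rw [← Real.rpow_add_one hx0.ne']; ring_nf
  nlinarith

theorem tendsto_clique_sq_mul_exp {κ θ c : ℝ} (hκ0 : 0 ≤ κ) (hκ : κ < 1 / 2) (hθ : 0 < θ)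
    (hc : 0 < c) :
    Tendsto (fun n : ℕ => 2 * ((2 : ℝ) ^ ⌊κ * (4 * n)⌋₊) ^ 2 *
      Real.exp (-(c * ((16 : ℝ) ^ n) ^ θ) + 3 / 2)) atTop (𝓝 0) := by
  have h1 := ((tendsto_mul_exp_neg_rpow hθ hc).comp
    tendsto_sixteen_pow).const_mul (2 * Real.exp (3 / 2))
  rw [mul_zero] at h1
  refine squeeze_zero (fun n => by positivity) (fun n => ?_) h1
  have h4 := two_pow_floor_le hκ0 n
  have hx : (1 : ℝ) ≤ 16 ^ n := one_le_pow₀ (by norm_num)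
  simp only [Function.comp_apply]
  set x : ℝ := 16 ^ n
  have hx0 : 0 < x := by linarith
  have h5 : (x ^ κ) ^ 2 ≤ x := by
    rw [sq, ← Real.rpow_add hx0]
    exact (Real.rpow_le_rpow_of_exponent_le hx (by linarith)).trans_eq (Real.rpow_one x)
  calc _ ≤ 2 * (x ^ κ) ^ 2 * Real.exp (-(c * x ^ θ) + 3 / 2) := by gcongr
    _ ≤ 2 * x * Real.exp (-(c * x ^ θ) + 3 / 2) := by gcongr
    _ = _ := by rw [Real.exp_add, neg_mul]; ring

theorem tendsto_sparsity_mul_log_div {κ γ : ℝ} (hκ : 0 ≤ κ) (hγ : 0 ≤ γ) (h : κ + γ < 1) :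
    Tendsto (fun n : ℕ => ((2 : ℝ) ^ ⌊κ * (4 * n)⌋₊ * 2 ^ ⌊γ * (4 * n)⌋₊) *
      Real.log ((2 : ℝ) ^ ⌊κ * (4 * n)⌋₊ * 2 ^ ⌊γ * (4 * n)⌋₊) / 16 ^ n) atTop (𝓝 0) := by
  have h1 := (isLittleO_log_rpow_atTop (r := 1 - (κ + γ)) (by linarith)).tendsto_div_nhds_zero.comp
    tendsto_sixteen_pow
  have hK1 : ∀ n : ℕ, (1 : ℝ) ≤ 2 ^ ⌊κ * (4 * n)⌋₊ * 2 ^ ⌊γ * (4 * n)⌋₊ := fun n => by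
    rw [← pow_add]; exact one_le_pow₀ (by norm_num)
  refine squeeze_zero (fun n => ?_) (fun n => ?_) h1
  · have := Real.log_nonneg (hK1 n)
    positivity
  have h2 := mul_le_mul (two_pow_floor_le hκ n) (two_pow_floor_le hγ n) (by positivity)
    (by positivity)
  have hx : (1 : ℝ) ≤ 16 ^ n := one_le_pow₀ (by norm_num)
  have h3 := hK1 n
  simp only [Function.comp_apply]
  set x : ℝ := 16 ^ n
  set y : ℝ := 2 ^ ⌊κ * (4 * n)⌋₊ * 2 ^ ⌊γ * (4 * n)⌋₊
  have hx0 : 0 < x := by linarith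
  rw [← Real.rpow_add hx0] at h2
  have h4 : x ^ (κ + γ) ≤ x :=
    (Real.rpow_le_rpow_of_exponent_le hx h.le).trans_eq (Real.rpow_one x)
  have h5 : Real.log y ≤ Real.log x := Real.log_le_log (by linarith) (h2.trans h4)
  have h6 := Real.log_nonneg hx
  have h7 := Real.log_nonneg h3
  calc y * Real.log y / x ≤ x ^ (κ + γ) * Real.log x / x := by gcongr
    _ = _ := by
      rw [Real.rpow_sub hx0, Real.rpow_one]
      field_simp

theorem eventually_log_clique_le {κ ρ : ℝ} (hκ0 : 0 ≤ κ) (hκ : κ < ρ) :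
    ∀ᶠ n : ℕ in atTop, Real.log ((2 : ℝ) ^ ⌊κ * (4 * n)⌋₊) ≤ ρ * Real.log ((16 : ℝ) ^ n / 8) := by
  filter_upwards [tendsto_natCast_atTop_atTop.eventually_ge_atTop (3 * ρ / (4 * (ρ - κ)))]
    with n hn
  have h1 : Real.log ((16 : ℝ) ^ n / 8) = (4 * n - 3) * Real.log 2 := by
    rw [Real.log_div (by positivity) (by norm_num), log_sixteen_pow,
      show (8 : ℝ) = 2 ^ 3 by norm_num, Real.log_pow]
    push_cast
    ring
  have h2 : (⌊κ * (4 * n)⌋₊ : ℝ) ≤ κ * (4 * n) := Nat.floor_le (by positivity)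
  rw [div_le_iff₀ (by linarith)] at hn
  rw [h1, Real.log_pow, ← mul_assoc ρ]
  have h3 : (0 : ℝ) ≤ Real.log 2 := Real.log_nonneg (by norm_num)
  exact mul_le_mul_of_nonneg_right (by linarith) h3

/-- Up to rounding, k = N^κ, g = N^γ and μ = N^(-θ) k, so K/μ = g N^θ. Powers of 2 let the block
size divide N = 16^n, and the base 16 gives the growth that the subsequence argument needs. -/
theorem inRegime_of_exponents {κ γ θ : ℝ} (hκ : 0 ≤ κ) (hγ : 0 ≤ γ) (h : κ + γ ≤ 1) :
    InRegime (γ + θ) (κ + γ) (fun n => 16 ^ n)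
      (fun n => 2 ^ ⌊κ * (4 * n)⌋₊ * 2 ^ ⌊γ * (4 * n)⌋₊)
      (fun n => ((16 : ℝ) ^ n) ^ (-θ) * 2 ^ ⌊κ * (4 * n)⌋₊) where
  dim_tendsto := tendsto_pow_atTop_atTop_of_one_lt (by norm_num)
  sparsity_pos n := Nat.mul_pos (by positivity) (by positivity)
  sparsity_le n := by
    have h2 := mul_le_mul (two_pow_floor_le hκ n) (two_pow_floor_le hγ n) (by positivity)
      (by positivity)
    rw [← Real.rpow_add (by positivity)] at h2
    have h4 := (Real.rpow_le_rpow_of_exponent_le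
      (one_le_pow₀ (by norm_num : (1 : ℝ) ≤ 16)) h).trans_eq
      (Real.rpow_one ((16 : ℝ) ^ n))
    exact_mod_cast h2.trans h4
  signal_pos n := by positivity
  signal_tendsto := by
    have h1 := (tendsto_floor_div hγ).add_const θ
    refine h1.congr' ?_
    filter_upwards [eventually_gt_atTop 0] with n hn
    have hn0 : (0 : ℝ) < n := by exact_mod_cast hn
    have hl : Real.log 2 ≠ 0 := (Real.log_pos (by norm_num)).ne'
    push_cast
    set x : ℝ := 16 ^ n with hx
    have hx0 : 0 < x := by positivity
    have h2 : (2 : ℝ) ^ ⌊κ * (4 * n)⌋₊ * 2 ^ ⌊γ * (4 * n)⌋₊ *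
        (x ^ (-θ) * 2 ^ ⌊κ * (4 * n)⌋₊)⁻¹ = 2 ^ ⌊γ * (4 * n)⌋₊ * x ^ θ := by
      rw [Real.rpow_neg hx0.le]; field_simp
    rw [h2, Real.log_mul (by positivity) (by positivity), Real.log_pow, Real.log_rpow hx0, hx,
      log_sixteen_pow]
    field_simp
  sparsity_tendsto := by
    refine ((tendsto_floor_div hκ).add (tendsto_floor_div hγ)).congr fun n => ?_
    have hl : Real.log 2 ≠ 0 := (Real.log_pos (by norm_num)).ne'
    push_cast
    rw [← pow_add, Real.log_pow, log_sixteen_pow, mul_div_mul_right _ _ hl]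
    push_cast
    rw [add_div]

theorem exists_hard_instances {α β : ℝ} (hα : 0 < α) (hβ0 : 0 < β) (hβ1 : β < 1)
    (hαβ : β < 1 / 2 + α) :
    ∃ (N K : ℕ → ℕ) (μ : ℕ → ℝ), InRegime α β N K μ ∧
      (Conjecture half → ∀ φ : ℕ → Prog, PolyTime N φ →
        1 ≤ liminf (fun n => srosError (N n) (K n) (μ n) (φ n)) atTop ∧
        1 ≤ liminf (fun n => sswError (N n) (K n) (μ n / Real.sqrt 2) (φ n)) atTop) := by
  -- The four constraints say, in order: l tends to 0 polynomially, κ > 0, γ > 0, and κ < 1/2.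
  obtain ⟨θ, hθ1, hθ2⟩ : ∃ θ, max 0 (α - β) < θ ∧ θ < min α (1 / 2 + α - β) :=
    exists_between (max_lt (lt_min hα (by linarith)) (lt_min (by linarith) (by linarith)))
  obtain ⟨hθ0, hθβ⟩ := max_lt_iff.1 hθ1
  obtain ⟨hθα, hθ3⟩ := lt_min_iff.1 hθ2
  obtain ⟨κ, hκ⟩ : ∃ κ, κ = β - α + θ := ⟨_, rfl⟩
  obtain ⟨γ, hγ⟩ : ∃ γ, γ = α - θ := ⟨_, rfl⟩
  obtain rfl : α = γ + θ := by linarith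
  obtain rfl : β = κ + γ := by linarith
  have hκ0 : 0 < κ := by linarith
  have hκ1 : κ < 1 / 2 := by linarith
  have hγ0 : 0 < γ := by linarith
  refine ⟨_, _, _, inRegime_of_exponents hκ0.le hγ0.le hβ1.le, fun hpc φ hφ => ?_⟩
  -- Chosen so that the truncation level T = c N^θ satisfies exp(N^(-θ) T)² = 3/2.
  obtain ⟨c, hc⟩ : ∃ c, c = Real.log (3 / 2) / 2 := ⟨_, rfl⟩
  have hc0 : 0 < c := by rw [hc]; exact half_pos (Real.log_pos (by norm_num))
  have hx : ∀ n : ℕ, (1 : ℝ) ≤ 16 ^ n := fun n => one_le_pow₀ (by norm_num)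
  have hN : ∀ n : ℕ, 16 ^ n = 2 ^ (4 * n - ⌊γ * (4 * n)⌋₊) * 2 ^ ⌊γ * (4 * n)⌋₊ := by
    intro n
    have h1 : ⌊γ * (4 * n)⌋₊ ≤ 4 * n := by
      refine Nat.floor_le_of_le ?_
      push_cast
      exact mul_le_of_le_one_left (by positivity) (by linarith)
    rw [← pow_add, Nat.sub_add_cancel h1, pow_mul]
    norm_num
  have key : ∀ l : ℕ → ℝ, (∀ n, 0 ≤ l n) → (∀ n, l n ≤ ((16 : ℝ) ^ n) ^ (-θ)) →
      ∀ D : ∀ n, (Fin (16 ^ n) → Fin (16 ^ n) → ℝ) → Fin (16 ^ n) → Fin (16 ^ n) → ℝ,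
      (∀ n, Measurable (D n)) → (∀ n s, ∀ F : SimpleGraph (Fin s) → Fin (16 ^ n) → Fin (16 ^ n) → ℝ,
        (∀ i j, IsAffine fun G => F G i j) → ∀ i j, IsAffine fun G => D n (F G) i j) →
      1 ≤ liminf (fun n => ∫⁻ M, (φ n).prOne (encodeMatrix (16 ^ n) (D n M))
          ∂(gaussianMatrix (16 ^ n)) +
        ⨆ v ∈ spikes (16 ^ n) (2 ^ ⌊κ * (4 * n)⌋₊ * 2 ^ ⌊γ * (4 * n)⌋₊),
          ∫⁻ M, (φ n).prZero (encodeMatrix (16 ^ n) (D n M))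
            ∂(spiked (gaussianMatrix (16 ^ n)) (l n * (2 ^ ⌊κ * (4 * n)⌋₊ : ℕ)) v)) atTop := by
    intro l hl0 hl D hD hDaff
    refine one_le_liminf_of_conjecture hpc (N := fun n => 16 ^ n)
      -- The exponent of t is the midpoint of 1/2 and 1 - κ: t must exceed √N for |B| to
      -- concentrate, while k t must be o(N). The exponent ρ is likewise the midpoint of κ and 1/2.
      (t := fun n => ⌊((16 : ℝ) ^ n) ^ (3 / 4 - κ / 2)⌋₊) (T := fun n => c * ((16 : ℝ) ^ n) ^ θ)
      (k := fun n => 2 ^ ⌊κ * (4 * n)⌋₊) (ρ := (κ + 1 / 2) / 2)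
      hN (fun n => by positivity) (fun n => (pow_succ' 16 n).ge) (fun n => by positivity) ?_ ?_
      (eventually_four_mul_floor_le (by linarith)) (by linarith) (by linarith) ?_ ?_ ?_ ?_ ?_ hl0
      (fun n => (hl n).trans (Real.rpow_le_one_of_one_le_of_nonpos (hx n) (by linarith)))
      ?_ hD hDaff hφ
    · filter_upwards [tendsto_natCast_atTop_atTop.eventually_ge_atTop (1 / (4 * κ))] with n hn
      rw [div_le_iff₀ (by positivity)] at hn
      have h1 : ⌊κ * (4 * n)⌋₊ ≠ 0 := by
        have := (Nat.one_le_floor_iff (κ * (4 * n))).2 (by linarith)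
        omega
      exact lt_of_lt_of_le (Nat.one_lt_two_pow h1) (Nat.le_mul_of_pos_right _ (by positivity))
    · exact Eventually.of_forall fun n =>
        Nat.floor_pos.2 (Real.one_le_rpow (hx n) (by linarith))
    · simpa using eventually_log_clique_le hκ0.le (by linarith : κ < (κ + 1 / 2) / 2)
    · simpa using tendsto_div_floor_sq (η := 3 / 4 - κ / 2) (by linarith)
    · simpa using tendsto_clique_mul_div (η := 3 / 4 - κ / 2) hκ0.le hκ1 (by linarith)
    · simpa using tendsto_clique_sq_mul_exp hκ0.le hκ1 hθ0 hc0
    · simpa using tendsto_sparsity_mul_log_div hκ0.le hγ0.le hβ1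
    · intro n
      have hx0 : (0 : ℝ) < 16 ^ n := by positivity
      have h1 : ((16 : ℝ) ^ n) ^ (-θ) * (c * ((16 : ℝ) ^ n) ^ θ) = c := by
        rw [mul_left_comm, ← Real.rpow_add hx0, neg_add_cancel, Real.rpow_zero, mul_one]
      have h2 : l n * (c * ((16 : ℝ) ^ n) ^ θ) ≤ c := by
        exact (mul_le_mul_of_nonneg_right (hl n) (by positivity)).trans_eq h1
      calc Real.exp (l n * (c * ((16 : ℝ) ^ n) ^ θ)) ^ 2 ≤ Real.exp c ^ 2 := by gcongr
        _ = 3 / 2 := by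
          rw [← Real.exp_nat_mul, hc, Nat.cast_ofNat, mul_div_cancel₀ _ two_ne_zero,
            Real.exp_log (by norm_num)]
  constructor
  · refine (key (fun n => ((16 : ℝ) ^ n) ^ (-θ)) (fun n => by positivity) (fun n => le_rfl)
      (fun n M => M) (fun n => measurable_id) (fun n s F hF => hF)).trans_eq ?_
    congr 1
    funext n
    simp only [srosError, error]
    push_cast
    rfl
  -- Half the mean shift gives the spike strength μ/2, which symmetrization turns into μ/√2.
  · refine (key (fun n => ((16 : ℝ) ^ n) ^ (-θ) / 2) (fun n => by positivity)
      (fun n => half_le_self (by positivity)) (fun n => symmPart) (fun n => measurable_symmPart)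
      (fun n s F hF => isAffine_symmPart hF)).trans_eq ?_
    congr 1
    funext n
    simp only [sswError, error]
    have h1 : Measurable fun M => (φ n).prOne (encodeMatrix (16 ^ n) M) :=
      (φ n).measurable_prOne.comp (measurable_encodeMatrix _)
    have h0 : Measurable fun M => (φ n).prZero (encodeMatrix (16 ^ n) M) :=
      (φ n).measurable_prZero.comp (measurable_encodeMatrix _)
    rw [← gaussianMatrix_map_symmPart (16 ^ n), lintegral_map h1 measurable_symmPart,
      gaussianMatrix_map_symmPart]
    congr 1
    refine iSup_congr fun v => iSup_congr fun _ => ?_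
    rw [← spiked_map_symmPart, lintegral_map h0 measurable_symmPart]
    push_cast
    rw [div_mul_eq_mul_div]

end SparseSpike

theorem mainTheorem7 (α β : ℝ) (hβ0 : 0 < β) (hβ1 : β < 1) :
    -- the hard side of the boundary, given the planted clique conjecture at density `1/2`
    (0 < α → β < 1 / 2 + α →
      ∃ (N K : ℕ → ℕ) (μ : ℕ → ℝ), SparseSpike.InRegime α β N K μ ∧
        (PlantedClique.Conjecture ⟨1 / 2, by norm_num, by norm_num⟩ →
          ∀ φ : ℕ → RealProgram.Prog, RealProgram.PolyTime N φ →
            1 ≤ liminf (fun n => SparseSpike.srosError (N n) (K n) (μ n) (φ n)) atTop ∧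
            1 ≤ liminf
              (fun n => SparseSpike.sswError (N n) (K n) (μ n / Real.sqrt 2) (φ n)) atTop)) ∧
    -- the easy side of the boundary
    ((0 < α ∧ 1 / 2 + α < β) ∨ (β < 1 / 2 ∧ α < 0) →
      ∀ (N K : ℕ → ℕ) (μ : ℕ → ℝ), SparseSpike.InRegime α β N K μ →
        (∃ φ : ℕ → RealProgram.Prog, RealProgram.PolyTime N φ ∧
          Tendsto (fun n => SparseSpike.srosError (N n) (K n) (μ n) (φ n)) atTop (𝓝 0)) ∧
        (∃ φ : ℕ → RealProgram.Prog, RealProgram.PolyTime N φ ∧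
          Tendsto (fun n => SparseSpike.sswError (N n) (K n) (μ n) (φ n)) atTop (𝓝 0))) := by
  refine ⟨fun hα hαβ => SparseSpike.exists_hard_instances hα hβ0 hβ1 hαβ, fun hαβ N K μ h =>
    ⟨h.exists_test hαβ SparseSpike.gaussianMatrix_map_diag,
      h.exists_test hαβ SparseSpike.goe_map_diag⟩⟩
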